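/- Let $L,\nu,T>0$ and $D=(\mathbb R/L\mathbb Z)^2$. Write $\mathbb L^2=L^2(D)^2$, $\mathbb W^{1,2}=W^{1,2}(D)^2$, $|\cdot|_{L^2}$ and $(\cdot,\cdot)$ for the $L^2$ norm and inner product, $L^2_{per}$ for the functions of $L^2(D)$ with mean zero, $H$ for the mean-zero, weakly divergence-free fields in $\mathbb L^2$, $V=H\cap\mathbb W^{1,2}$ with the norm $\|u\|_V^2=|u|_{L^2}^2+|\nabla u|_{L^2}^2$, and $A=-\Delta$ with $\mathrm{Dom}(A)=H\cap W^{2,2}(D)^2$, so that $(A^{1/2}u,A^{1/2}\phi)=(\nabla u,\nabla\phi)$. Let $(\zeta_j)_{j\ge1}$ be an orthonormal basis of $H$ consisting of eigenfunctions of $A$, with eigenvalues $0<\lambda_1\le\lambda_2\le\cdots$. On a filtered probability space $(\Omega,\mathcal F,(\mathcal F_t)_{t\ge0},\mathbb P)$ let $W(t)=\sum_{j}\sqrt{q_j}\,\beta_j(t)\,\zeta_j$, where $(\beta_j)$ are independent one-dimensional $(\mathcal F_t)$-Brownian motions (the increments of the family $(\beta_j)_j$ after time $s$ are independent of $\mathcal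 F_s$), $q_j\ge0$, and $$K_0:=\sum_j\lambda_jq_j<\infty .$$ Let $u_0$ be an $\mathcal F_0$-measurable, $V$-valued random variable such that $\mathbb E\big[\exp(\gamma_0|\nabla u_0|_{L^2}^2)\big]<\infty$ for some $\gamma_0>0$. For $N\ge1$ and $t_l=lT/N$, let $\mathbf u^0=u_0$ and let $(\mathbf u^l,\pi^l)$, $l=1,\dots,N$, be $\mathcal F_{t_l}$-measurable $V\times L^2_{per}$-valued random variables which solve the fully implicit Euler scheme: a.s., for all $l=1,\dots,N$, $\phi\in\mathbb W^{1,2}$ and $\psi\in L^2_{per}$, $$(\mathbf u^l-\mathbf u^{l-1},\phi)+\frac TN\Big[\nu(\nabla\mathbf u^l,\nabla\phi)+\int_D\big((\mathbf u^l\cdot\nabla)\mathbf u^l\big)\cdot\phi\,dx\Big]-\frac TN(\pi^l,\operatorname{div}\phi)=(W(t_l)-W(t_{l-1}),\phi),$$ $$(\operatorname{div}\mathbf u^l,\psi)=0 .$$ Then for every $q\in[2,\infty)$ there is a constant $C$, depending only on $L,\nu,T,q,K_0$ and the (finite) moment $\mathbb E(\|u_0\|_V^{6q})$, such that for every $N\ge1$,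 a.s. $\pi^l\in W^{1,2}(D)$ for $l=1,\dots,N$, and $$\mathbb E\left(\left|\frac TN\sum_{l=1}^N|\nabla\pi^l|_{L^2}^2\right|^q\right)\le C .$$ -/

import Mathlib

open MeasureTheory ProbabilityTheory
open scoped NNReal ENNReal

noncomputable section

namespace TorusNSE

/-! ### Function spaces on the two-dimensional torus of period `L` -/

/-- The torus `(ℝ / Lℤ)²`, i.e. the square `[0, L]²` with opposite sides identified. Its measure
`volume` is the product of the Lebesgue measures, of total mass `L²`. -/
abbrev Torus (L : ℝ) : Type := Fin 2 → AddCircle L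

/-- Scalar square integrable functions on the torus. -/
abbrev ScalarL2 (L : ℝ) [Fact (0 < L)] : Type := Lp ℝ 2 (volume : Measure (Torus L))

/-- Square integrable vector fields on the torus. -/
abbrev VectorL2 (L : ℝ) [Fact (0 < L)] : Type :=
  Lp (EuclideanSpace ℝ (Fin 2)) 2 (volume : Measure (Torus L))

/-- Smooth functions on the torus: those whose periodic lift to `ℝ²` is `C^∞`. -/
def IsSmooth {L : ℝ} (φ : Torus L → ℝ) : Prop :=
  ContDiff ℝ ((⊤ : ℕ∞) : WithTop ℕ∞) (fun x : Fin 2 → ℝ => φ (fun i => (x i : AddCircle L)))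

/-- The classical partial derivative in the `i`-th direction at the point `x` of the torus. -/
def pderiv {L : ℝ} (i : Fin 2) (φ : Torus L → ℝ) (x : Torus L) : ℝ :=
  deriv (fun s : ℝ => φ (x + Pi.single i (s : AddCircle L))) 0

variable {L : ℝ} [Fact (0 < L)]

/-- `g` is the `i`-th weak partial derivative of `f`. -/
def IsWeakPartial (i : Fin 2) (f g : ScalarL2 L) : Prop :=
  ∀ φ : Torus L → ℝ, IsSmooth φ → ∫ x, f x * pderiv i φ x = -∫ x, g x * φ x

/-- `f ∈ W^{1,2}`: both weak partial derivatives exist in `L²`. -/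
def MemW12 (f : ScalarL2 L) : Prop := ∀ i : Fin 2, ∃ g : ScalarL2 L, IsWeakPartial i f g

open Classical in
/-- The `i`-th weak partial derivative of `f` (with the value `0` if there is none in `L²`). -/
def wpartial (i : Fin 2) (f : ScalarL2 L) : ScalarL2 L :=
  if h : ∃ g : ScalarL2 L, IsWeakPartial i f g then h.choose else 0

/-- `f ∈ W^{2,2}`. -/
def MemW22 (f : ScalarL2 L) : Prop := MemW12 f ∧ ∀ i : Fin 2, MemW12 (wpartial i f)

/-- `|∇f|²_{L²}`. -/
def gradNormSq (f : ScalarL2 L) : ℝ := ∑ i : Fin 2, ‖wpartial i f‖ ^ 2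

/-- The subspace of `L²` of functions with mean zero. -/
def MeanZero (f : ScalarL2 L) : Prop := ∫ x, f x = 0

/-- The `j`-th component of a vector field. -/
def coord (j : Fin 2) (u : VectorL2 L) : ScalarL2 L :=
  (EuclideanSpace.proj j : EuclideanSpace ℝ (Fin 2) →L[ℝ] ℝ).compLp u

/-- Vector fields whose components are in `W^{1,2}`. -/
def VecMemW12 (u : VectorL2 L) : Prop := ∀ j : Fin 2, MemW12 (coord j u)

/-- The divergence of a vector field in `W^{1,2}`. -/
def divergence (u : VectorL2 L) : ScalarL2 L := ∑ i : Fin 2, wpartial i (coord i u)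

/-- `(A^{1/2} u, A^{1/2} v) = (∇u, ∇v)` for vector fields in `W^{1,2}`. -/
def gradInner (u v : VectorL2 L) : ℝ :=
  ∑ j : Fin 2, ∑ i : Fin 2, inner ℝ (wpartial i (coord j u)) (wpartial i (coord j v))

/-- The norm of `W^{1,2}`, which is also the norm of `V`. -/
def normV (u : VectorL2 L) : ℝ := Real.sqrt (‖u‖ ^ 2 + gradInner u u)

/-- `∫ ((u · ∇) v) · w dx`. -/
def trilinear (u v w : VectorL2 L) : ℝ :=
  ∫ x, ∑ j : Fin 2, ∑ i : Fin 2, u x i * wpartial i (coord j v) x * w x j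

variable (L) in
/-- `H`: the mean zero vector fields in `L²` that are weakly divergence free. -/
def spaceH : Set (VectorL2 L) :=
  {u | (∫ x, u x = 0) ∧
    ∀ φ : Torus L → ℝ, IsSmooth φ → ∫ x, ∑ i : Fin 2, u x i * pderiv i φ x = 0}

variable (L) in
/-- `V = H ∩ W^{1,2}`. -/
def spaceV : Set (VectorL2 L) := {u | u ∈ spaceH L ∧ VecMemW12 u}

variable (L) in
/-- `Dom A = H ∩ W^{2,2}`, the domain of the Stokes operator `A = -Δ`. -/
def domA : Set (VectorL2 L) := {u | u ∈ spaceH L ∧ ∀ j : Fin 2, MemW22 (coord j u)}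

/-- The Laplacian of a scalar function in `W^{2,2}`. -/
def laplacian (f : ScalarL2 L) : ScalarL2 L := ∑ i : Fin 2, wpartial i (wpartial i f)

/-- `(ζ j)` is an orthonormal basis of `H` which consists of eigenfunctions of the Stokes operator
`A = -Δ`, with the nondecreasing sequence `(lam j)` of positive eigenvalues. -/
structure IsStokesEigenbasis (ζ : ℕ → VectorL2 L) (lam : ℕ → ℝ) : Prop where
  orthonormal : Orthonormal ℝ ζ
  dense : closure (Submodule.span ℝ (Set.range ζ) : Set (VectorL2 L)) = spaceH L
  mem_domA : ∀ n, ζ n ∈ domA L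
  eigen : ∀ n, ∀ j : Fin 2, -laplacian (coord j (ζ n)) = lam n • coord j (ζ n)
  pos : ∀ n, 0 < lam n
  mono : Monotone lam

/-! ### The noise -/

/-- Independent one-dimensional Brownian motions with respect to the filtration `ℱ`: each `β j` is
an adapted Brownian motion, the processes `β j` are mutually independent, and the increments of the
whole family after time `s` are independent of `ℱ s`. -/
structure IsBrownianFamily {Ω : Type*} {mΩ : MeasurableSpace Ω} (ℱ : Filtration ℝ≥0 mΩ)
    (P : Measure Ω) (β : ℕ → ℝ≥0 → Ω → ℝ) : Prop where
  adapted : ∀ j t, Measurable[ℱ t] (β j t)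
  brownian : ∀ j, IsBrownianReal (β j) P
  indep : iIndepFun (fun (j : ℕ) (ω : Ω) (t : ℝ≥0) => β j t ω) P
  indep_past : ∀ s t : ℝ≥0, s ≤ t →
    Indep (ℱ s) (MeasurableSpace.comap (fun (ω : Ω) (j : ℕ) => β j t ω - β j s ω) inferInstance) P

/-- The Wiener process `W(t) = ∑ⱼ √(qⱼ) βⱼ(t) ζⱼ` (when `∑ⱼ qⱼ < ∞`, the series converges in `H`
almost surely). -/
def wiener {Ω : Type*} (ζ : ℕ → VectorL2 L) (qs : ℕ → ℝ) (β : ℕ → ℝ≥0 → Ω → ℝ)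
    (t : ℝ≥0) (ω : Ω) : VectorL2 L :=
  ∑' j, (Real.sqrt (qs j) * β j t ω) • ζ j

/-! ### The time Euler scheme -/

/-- The point `t_l = l T / N` of the time grid. -/
def gridTime (T : ℝ≥0) (N l : ℕ) : ℝ≥0 := l * T / N

/-- `(u l, π l)` solves the fully implicit Euler scheme with `N` steps on `[0, T]`, with viscosity
`ν`, initial condition `u₀` and driving process `W`. The pairs are `V × L²_per`-valued random
variables, measurable with respect to the filtration `ℱ` at the time `t_l` (only the indices
`l ≤ N` of `u`, and `1 ≤ l ≤ N` of `π`, matter). -/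
structure IsEulerScheme {Ω : Type*} {mΩ : MeasurableSpace Ω} (ℱ : Filtration ℝ≥0 mΩ)
    (P : Measure Ω) (ν : ℝ) (T : ℝ≥0) (N : ℕ) (u₀ : Ω → VectorL2 L)
    (W : ℝ≥0 → Ω → VectorL2 L) (u : ℕ → Ω → VectorL2 L) (π : ℕ → Ω → ScalarL2 L) : Prop where
  init : u 0 = u₀
  adapted_u : ∀ l ≤ N, StronglyMeasurable[ℱ (gridTime T N l)] (u l)
  adapted_π : ∀ l ∈ Finset.Icc 1 N, StronglyMeasurable[ℱ (gridTime T N l)] (π l)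
  mem_V : ∀ l ∈ Finset.Icc 1 N, ∀ᵐ ω ∂P, u l ω ∈ spaceV L
  meanZero : ∀ l ∈ Finset.Icc 1 N, ∀ᵐ ω ∂P, MeanZero (π l ω)
  momentum : ∀ l ∈ Finset.Icc 1 N, ∀ᵐ ω ∂P, ∀ φ : VectorL2 L, VecMemW12 φ →
    inner ℝ (u l ω - u (l - 1) ω) φ
      + (T / N : ℝ) * (ν * gradInner (u l ω) φ + trilinear (u l ω) (u l ω) φ)
      - (T / N : ℝ) * inner ℝ (π l ω) (divergence φ)
      = inner ℝ (W (gridTime T N l) ω - W (gridTime T N (l - 1)) ω) φ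
  incompressible : ∀ l ∈ Finset.Icc 1 N, ∀ᵐ ω ∂P, ∀ ψ : ScalarL2 L, MeanZero ψ →
    inner ℝ (divergence (u l ω)) ψ = 0

end TorusNSE

end

/-!
The pressure is recovered from the velocity, and the velocity is controlled by its enstrophy
`a = |∇u|²` and palinstrophy `d = |Au|²`.

*One step, pathwise.* In Fourier variables the equation of one step is algebraic
(`momentum_fourier`). Its product with the wave vector gives `|∇π| ≤ |(u·∇)u|` coefficientwise
(`IsStep.pressure_le`). A bootstrap (`tsum_ne_top_of_le_conv`) shows that the Fourier series of `u`
converges absolutely and that `u ∈ W^{2,2}`; then Young's inequality for convolutions and Agmon's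
inequality (`agmon_fourier`) yield `|∇π|² ≤ C a^{3/2} d^{1/2} ≤ C (a³ + d)`
(`IsStep.gradNormSq_le`). On the two-dimensional torus `((u·∇)u, Au) = 0`: in terms of the stream
function the summand vanishes after symmetrization over the three interacting frequencies
(`tsum_tri_eq_zero`). Hence the step from `u'` to `u` with the noise increment `ΔW` satisfies
`a + 2κν d ≤ |A^{1/2}(u' + ΔW)|²`, where `κ = T/N` (`IsStep.ens_add_pal_le`). The right-hand side is
written in terms of the coefficients with respect to the eigenbasis, where it is an explicit
quadratic function of the Gaussian increments.

*Moments.* Let `x_l = 1 + a_l + 2κν ∑_{i ≤ l} d_i`, so that `x_{l+1} ≤ x_l + 2m + h` with a mixed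
term `m`, linear in the increment, and the noise energy `h = |A^{1/2} ΔW|²`. As `|m| ≤ x_l √h`, an
expansion of the power `p = 3q` bounds `x_{l+1}^p` by `x_l^p + 2p x_l^{p-1} m` up to a remainder
`C x_l^p (h + h^{2n})` (`add_rpow_le`). The mixed term has mean zero, and `h` is independent of
`x_l` with moments `E h^j ≤ C κ^j` because `∑ λ_j q_j = K₀`; therefore
`E x_{l+1}^p ≤ (1 + Cκ) E x_l^p` (`lintegral_step_le`), and the iteration gives
`E x_l^p ≤ e^{CT} E x_0^p`. Since `κ ∑ |∇π_l|² ≤ C (κ ∑ a_l³ + κ ∑ d_l)`, Jensen's inequality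
bounds its `q`-th moment by those of order `3q` of the `x_l` (`rpow_sum_gradNormSq_le`).
-/

noncomputable section

namespace TorusNSE

/-! ### Fourier series on the torus -/

section

variable {L : ℝ}

open Submodule Set ComplexConjugate

variable (L) in
/-- The character `x ↦ exp (2πi k·x / L)` of the torus. -/
def char (k : Fin 2 → ℤ) : C(Torus L, ℂ) where
  toFun x := ∏ i : Fin 2, fourier (k i) (x i)
  continuous_toFun := by fun_prop

lemma char_apply (k : Fin 2 → ℤ) (x : Torus L) : char L k x = ∏ i, fourier (k i) (x i) := rfl

lemma char_neg (k : Fin 2 → ℤ) (x : Torus L) : char L (-k) x = conj (char L k x) := by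
  simp only [char_apply, Pi.neg_apply, fourier_neg, map_prod]

lemma char_add (k m : Fin 2 → ℤ) (x : Torus L) : char L (k + m) x = char L k x * char L m x := by
  simp only [char_apply, Pi.add_apply, fourier_add, ← Finset.prod_mul_distrib]

lemma char_zero (x : Torus L) : char L 0 x = 1 := by
  simp [char_apply]

lemma norm_char (k : Fin 2 → ℤ) (x : Torus L) : ‖char L k x‖ = 1 := by
  rw [char_apply, norm_prod]
  exact Finset.prod_eq_one fun i _ => by rw [fourier_apply, Circle.norm_coe]

variable [hL : Fact (0 < L)]

/-- The star subalgebra generated by the characters. -/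
def charSubalgebra (L : ℝ) [Fact (0 < L)] : StarSubalgebra ℂ C(Torus L, ℂ) where
  toSubalgebra := Algebra.adjoin ℂ (range (char L))
  star_mem' := by
    change Algebra.adjoin ℂ (range (char L)) ≤ star (Algebra.adjoin ℂ (range (char L)))
    refine Algebra.adjoin_le ?_
    rintro _ ⟨n, rfl⟩
    refine Algebra.subset_adjoin ⟨-n, ?_⟩
    ext1 x
    simp only [char_neg, starRingEnd_apply, ContinuousMap.star_apply]

lemma charSubalgebra_coe :
    (charSubalgebra L).toSubalgebra.toSubmodule = span ℂ (range (char L)) := by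
  apply Algebra.adjoin_eq_span_of_subset
  refine .trans (fun x ↦ Submonoid.closure_induction (fun _ ↦ id) ⟨0, ?_⟩ ?_) subset_span
  · ext z
    simp [char_zero]
  · rintro _ _ _ _ ⟨m, rfl⟩ ⟨n, rfl⟩
    refine ⟨m + n, ?_⟩
    ext z
    simp [char_add]

lemma charSubalgebra_separatesPoints : (charSubalgebra L).SeparatesPoints := by
  intro x y hxy
  rw [Ne, funext_iff, not_forall] at hxy
  obtain ⟨i, hi⟩ := hxy
  refine ⟨_, ⟨char L (Pi.single i 1), Algebra.subset_adjoin ⟨Pi.single i 1, rfl⟩, rfl⟩, ?_⟩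
  have key : ∀ z : Torus L, char L (Pi.single i 1) z = AddCircle.toCircle (z i) := by
    intro z
    rw [char_apply, Finset.prod_eq_single i]
    · simp
    · intro j _ hj
      simp [Pi.single_eq_of_ne hj]
    · simp
  simp only [key]
  contrapose hi
  exact AddCircle.injective_toCircle hL.out.ne' (Subtype.ext hi)

lemma span_char_closure_eq_top : (span ℂ (range (char L))).topologicalClosure = ⊤ := by
  rw [← charSubalgebra_coe]
  exact congr_arg (Subalgebra.toSubmodule <| StarSubalgebra.toSubalgebra ·)
    (ContinuousMap.starSubalgebra_topologicalClosure_eq_top_of_separatesPoints (charSubalgebra L)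
      (charSubalgebra_separatesPoints (L := L)))

lemma integral_fourier_one (n : ℤ) :
    ∫ x : AddCircle L, fourier n x = if n = 0 then (L : ℂ) else 0 := by
  have h := AddCircle.integral_haarAddCircle (T := L) (f := fun x => fourier n x)
  have h2 := fourierCoeff_fourier (hT := hL) n
  have h3 : fourierCoeff (T := L) (fourier n) 0
      = ∫ x : AddCircle L, fourier n x ∂AddCircle.haarAddCircle := by
    simp [fourierCoeff]
  rw [h2, h] at h3
  have hL' : (L : ℂ) ≠ 0 := by exact_mod_cast hL.out.ne'
  have h4 : ∫ x : AddCircle L, fourier n x = L * (Pi.single n (1:ℂ) : ℤ → ℂ) 0 := by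
    rw [h3, Complex.real_smul]
    push_cast
    field_simp
  rw [h4]
  by_cases hn : n = 0
  · simp [hn]
  · rw [Pi.single_eq_of_ne (Ne.symm hn)]; simp [hn]

lemma integral_char (k : Fin 2 → ℤ) :
    ∫ x : Torus L, char L k x = if k = 0 then (L : ℂ) ^ 2 else 0 := by
  simp only [char_apply]
  rw [MeasureTheory.integral_fintype_prod_volume_eq_prod]
  simp only [integral_fourier_one]
  by_cases hk : k = 0
  · simp [hk]
  · obtain ⟨i, hi⟩ := Function.ne_iff.mp hk
    rw [if_neg hk]
    apply Finset.prod_eq_zero (Finset.mem_univ i)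
    rw [if_neg (by simpa using hi)]

variable (L) in
/-- The character divided by the square root `L` of the volume of the torus, as an element of
complex `L²`. -/
def charLp (k : Fin 2 → ℤ) : Lp ℂ 2 (volume : Measure (Torus L)) :=
  ContinuousMap.toLp (E := ℂ) 2 volume ℂ ((L⁻¹ : ℂ) • char L k)

lemma coeFn_charLp (k : Fin 2 → ℤ) : charLp L k =ᵐ[volume] fun x => (L⁻¹ : ℂ) * char L k x :=
  ContinuousMap.coeFn_toLp volume _

lemma orthonormal_charLp : Orthonormal ℂ (charLp L) := by
  rw [orthonormal_iff_ite]
  intro m n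
  simp only [charLp, ContinuousMap.inner_toLp]
  have : ∀ x : Torus L, ((L⁻¹ : ℂ) • char L n) x * (starRingEnd ℂ) (((L⁻¹ : ℂ) • char L m) x)
      = (L⁻¹ : ℂ) ^ 2 * char L (n + -m) x := by
    intro x
    rw [char_add, char_neg]
    simp
    ring
  simp only [this]
  rw [integral_const_mul, integral_char]
  have hL' : (L : ℂ) ≠ 0 := by exact_mod_cast hL.out.ne'
  by_cases h : m = n
  · simp [h, hL']
  · have : n + -m ≠ 0 := by rwa [← sub_eq_add_neg, sub_ne_zero, ne_comm]
    simp [h, this]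

lemma span_charLp_closure_eq_top : (span ℂ (range (charLp L))).topologicalClosure = ⊤ := by
  have hL' : (L⁻¹ : ℂ) ≠ 0 := inv_ne_zero (by exact_mod_cast hL.out.ne')
  have h := (ContinuousMap.toLp_denseRange ℂ (volume : Measure (Torus L)) ℂ
    (p := 2) (by simp)).topologicalClosure_map_submodule (span_char_closure_eq_top (L := L))
  rw [← h]
  congr 1
  rw [map_span]
  apply le_antisymm
  · rw [span_le]
    rintro _ ⟨k, rfl⟩
    have : charLp L k = (L⁻¹ : ℂ) • ContinuousMap.toLp (E := ℂ) 2 volume ℂ (char L k) := by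
      simp [charLp]
    rw [this]
    exact Submodule.smul_mem _ _ (subset_span ⟨_, ⟨k, rfl⟩, rfl⟩)
  · rw [span_le]
    rintro _ ⟨_, ⟨k, rfl⟩, rfl⟩
    have : ContinuousMap.toLp (E := ℂ) 2 volume ℂ (char L k) = (L : ℂ) • charLp L k := by
      rw [charLp, map_smul, smul_smul, mul_inv_cancel₀ (by simpa using hL'), one_smul]
    change ContinuousMap.toLp (E := ℂ) 2 volume ℂ (char L k) ∈ _
    rw [this]
    exact Submodule.smul_mem _ _ (subset_span ⟨k, rfl⟩)

variable (L) in
/-- The Fourier basis of complex `L²` of the torus. -/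
def charBasis : HilbertBasis (Fin 2 → ℤ) ℂ (Lp ℂ 2 (volume : Measure (Torus L))) :=
  HilbertBasis.mk orthonormal_charLp span_charLp_closure_eq_top.ge

lemma coe_charBasis : ⇑(charBasis L) = charLp L := HilbertBasis.coe_mk _ _

/-- The Fourier coefficient `L⁻¹ ∫ f(x) exp (-2πi k·x / L) dx` of a real function, normalized such
that Parseval's identity holds without a constant. -/
def fc (f : Torus L → ℝ) (k : Fin 2 → ℤ) : ℂ := (L⁻¹ : ℂ) * ∫ x, (f x : ℂ) * char L (-k) x

lemma fc_congr {f g : Torus L → ℝ} (h : f =ᵐ[volume] g) (k : Fin 2 → ℤ) : fc f k = fc g k := by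
  unfold fc
  congr 1
  apply integral_congr_ae
  filter_upwards [h] with x hx
  rw [hx]

lemma fc_neg (f : Torus L → ℝ) (k : Fin 2 → ℤ) : fc f (-k) = conj (fc f k) := by
  unfold fc
  rw [map_mul, ← integral_conj]
  simp [char_neg]

/-- The complexification of a real function. -/
def toC (f : ScalarL2 L) : Lp ℂ 2 (volume : Measure (Torus L)) :=
  Complex.ofRealCLM.compLp f

lemma coeFn_toC (f : ScalarL2 L) : toC f =ᵐ[volume] fun x => (f x : ℂ) :=
  ContinuousLinearMap.coeFn_compLp _ _

lemma charBasis_inner (g : Lp ℂ 2 (volume : Measure (Torus L))) (k : Fin 2 → ℤ) :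
    inner ℂ (charBasis L k) g = (L⁻¹ : ℂ) * ∫ x, g x * char L (-k) x := by
  rw [coe_charBasis, MeasureTheory.L2.inner_def, ← integral_const_mul]
  apply integral_congr_ae
  filter_upwards [coeFn_charLp (L := L) k] with x hx
  rw [hx, char_neg]
  simp
  ring

lemma charBasis_inner_toC (f : ScalarL2 L) (k : Fin 2 → ℤ) :
    inner ℂ (charBasis L k) (toC f) = fc f k := by
  rw [charBasis_inner, fc]
  congr 1
  apply integral_congr_ae
  filter_upwards [coeFn_toC f] with x hx
  rw [hx]

lemma inner_toC (f g : ScalarL2 L) : inner ℂ (toC f) (toC g) = ((inner ℝ f g : ℝ) : ℂ) := by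
  rw [MeasureTheory.L2.inner_def, MeasureTheory.L2.inner_def, ← integral_complex_ofReal]
  apply integral_congr_ae
  filter_upwards [coeFn_toC f, coeFn_toC g] with x hx hy
  rw [hx, hy]
  simp

/-- **Parseval's identity** for real functions on the torus. -/
lemma hasSum_fc_inner (f g : ScalarL2 L) :
    HasSum (fun k => fc f k * conj (fc g k)) ((inner ℝ f g : ℝ) : ℂ) := by
  rw [← real_inner_comm, ← inner_toC]
  refine ((charBasis L).hasSum_inner_mul_inner (toC g) (toC f)).congr_fun fun k => ?_
  rw [charBasis_inner_toC, ← inner_conj_symm, charBasis_inner_toC, mul_comm]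

lemma hasSum_fc_sq (f : ScalarL2 L) : HasSum (fun k => ‖fc f k‖ ^ 2) (‖f‖ ^ 2) := by
  have h := hasSum_fc_inner f f
  rw [real_inner_self_eq_norm_sq] at h
  have h2 : ∀ k, fc f k * conj (fc f k) = ((‖fc f k‖ ^ 2 : ℝ) : ℂ) := by
    intro k
    rw [Complex.mul_conj, Complex.normSq_eq_norm_sq]
  simp only [h2] at h
  exact_mod_cast h

lemma fc_add (f g : ScalarL2 L) (k : Fin 2 → ℤ) : fc (f + g : ScalarL2 L) k = fc f k + fc g k := by
  simp only [← charBasis_inner_toC, toC, ← inner_add_right]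
  congr 1
  exact map_add (ContinuousLinearMap.compLpL 2 volume Complex.ofRealCLM) f g

lemma fc_smul (c : ℝ) (f : ScalarL2 L) (k : Fin 2 → ℤ) :
    fc (c • f : ScalarL2 L) k = c * fc f k := by
  rw [← charBasis_inner_toC, ← charBasis_inner_toC, ← inner_smul_right]
  congr 1
  exact ((Complex.ofRealCLM.compLpL 2 volume).map_smul c f).trans (by
    ext1
    filter_upwards [Lp.coeFn_smul c (Complex.ofRealCLM.compLp f),
      Lp.coeFn_smul (c : ℂ) (Complex.ofRealCLM.compLp f)] with x hx hy
    exact hx.trans (hy.trans (by simp)).symm)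

lemma fc_sub (f g : ScalarL2 L) (k : Fin 2 → ℤ) : fc (f - g : ScalarL2 L) k = fc f k - fc g k := by
  have h := fc_add f ((-1 : ℝ) • g) k
  rw [fc_smul] at h
  rw [sub_eq_add_neg, ← neg_one_smul ℝ g, h]
  push_cast; ring

lemma fc_zero (k : Fin 2 → ℤ) : fc (0 : ScalarL2 L) k = 0 := by
  simpa using fc_smul (0 : ℝ) (0 : ScalarL2 L) k

/-- A square integrable function is determined by its Fourier coefficients. -/
lemma ext_fc {f g : ScalarL2 L} (h : ∀ k, fc f k = fc g k) : f = g := by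
  have h2 := hasSum_fc_sq (f - g)
  have h3 : ∀ k, ‖fc (f - g : ScalarL2 L) k‖ ^ 2 = 0 := by
    intro k
    rw [fc_sub, h k]; simp
  simp only [h3] at h2
  have h4 := h2.unique hasSum_zero
  rw [← sub_eq_zero]
  simpa using h4

/-- **Riesz–Fischer**: a square summable sequence with the symmetry of the coefficients of a real
function is the sequence of Fourier coefficients of a real square integrable function. -/
lemma exists_fc_eq {a : (Fin 2 → ℤ) → ℂ} (ha : Summable fun k => ‖a k‖ ^ 2)
    (hs : ∀ k, a (-k) = conj (a k)) : ∃ f : ScalarL2 L, ∀ k, fc f k = a k := by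
  have hm : Memℓp a 2 := by
    rw [memℓp_gen_iff (by simp)]
    simpa using ha
  let g := (charBasis L).repr.symm ⟨a, hm⟩
  have hg : ∀ k, inner ℂ (charBasis L k) g = a k := by
    intro k
    rw [← HilbertBasis.repr_apply_apply]
    simp [g]
  refine ⟨Complex.reCLM.compLp g, fun k => ?_⟩
  have h1 : fc (Complex.reCLM.compLp g) k
      = (L⁻¹ : ℂ) * ∫ x, ((1/2 : ℂ) * (g x * char L (-k) x) + (1/2) * conj (g x * char L k x)) := by
    unfold fc
    congr 1
    apply integral_congr_ae
    filter_upwards [ContinuousLinearMap.coeFn_compLp Complex.reCLM g] with x hx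
    rw [hx, Complex.reCLM_apply, Complex.re_eq_add_conj, char_neg, map_mul]
    ring
  have hint : ∀ k, Integrable (fun x => g x * char L k x) volume := by
    intro k
    have hg1 : Integrable g volume := (Lp.memLp g).integrable (by norm_num)
    refine hg1.mul_bdd (c := 1) ?_ ?_
    · exact (char L k).continuous.aestronglyMeasurable
    · exact Filter.Eventually.of_forall fun x => (norm_char k x).le
  have hc : Integrable (fun x => conj (g x * char L k x)) volume := by
    have := (Complex.conjCLE : ℂ →L[ℝ] ℂ).integrable_comp (hint k)
    exact this
  rw [h1, integral_add ((hint (-k)).const_mul _) (hc.const_mul _), integral_const_mul,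
    integral_const_mul, integral_conj]
  have e1 := hg k
  have e2 := hg (-k)
  rw [charBasis_inner] at e1 e2
  rw [neg_neg, hs] at e2
  have e3 := congrArg conj e2
  rw [Complex.conj_conj, map_mul] at e3
  rw [mul_add, mul_left_comm, e1]
  have e4 : conj ((L : ℂ)⁻¹) = (L : ℂ)⁻¹ := by simp
  rw [e4] at e3
  rw [mul_left_comm ((L:ℂ)⁻¹), e3]
  ring

/-- The Fourier coefficients of a product are the convolution of the Fourier coefficients. -/
lemma hasSum_fc_mul (f g : ScalarL2 L) (k : Fin 2 → ℤ) :
    HasSum (fun m => fc f m * fc g (k - m)) (L * fc (fun x => f x * g x) k) := by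
  have hL' : (L : ℂ) ≠ 0 := by exact_mod_cast hL.out.ne'
  have hm : MemLp (fun x => (g x : ℂ) * char L (-k) x) 2 (volume : Measure (Torus L)) := by
    have h1 : MemLp (fun x => (g x : ℂ)) 2 (volume : Measure (Torus L)) := (Lp.memLp g).ofReal
    have h2 : MemLp (fun x => char L (-k) x) ∞ (volume : Measure (Torus L)) :=
      memLp_top_of_bound (char L (-k)).continuous.aestronglyMeasurable 1
        (Filter.Eventually.of_forall fun x => (norm_char _ x).le)
    exact h2.mul h1
  let h : Lp ℂ 2 (volume : Measure (Torus L)) := hm.toLp _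
  have hh : h =ᵐ[volume] fun x => (g x : ℂ) * char L (-k) x := hm.coeFn_toLp
  have key := (charBasis L).hasSum_inner_mul_inner (toC f) h
  have e1 : inner ℂ (toC f) h = L * fc (fun x => f x * g x) k := by
    rw [MeasureTheory.L2.inner_def, fc, ← mul_assoc, mul_inv_cancel₀ hL', one_mul]
    apply integral_congr_ae
    filter_upwards [hh, coeFn_toC f] with x hx hy
    rw [hx, hy]
    simp
    ring
  rw [e1] at key
  have e2 : ∀ m, inner ℂ (charBasis L m) h = fc g (k + m) := by
    intro m
    rw [charBasis_inner, fc]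
    congr 1
    apply integral_congr_ae
    filter_upwards [hh] with x hx
    rw [hx, mul_assoc, ← char_add, neg_add]
  simp only [e2] at key
  rw [← (Equiv.neg _).hasSum_iff] at key
  refine key.congr_fun fun m => ?_
  change _ = inner ℂ (toC f) (charBasis L (-m)) * fc g (k + -m)
  rw [← inner_conj_symm, charBasis_inner_toC, ← fc_neg, neg_neg, sub_eq_add_neg]

end

/-! ### Weak derivatives in Fourier variables -/

section

open ComplexConjugate

variable {L : ℝ}

variable (L) in
/-- The `i`-th component `2π kᵢ / L` of the wave vector of the character with index `k`. -/
def wv (k : Fin 2 → ℤ) (i : Fin 2) : ℝ := 2 * Real.pi * k i / L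

lemma wv_neg (k : Fin 2 → ℤ) (i : Fin 2) : wv L (-k) i = -wv L k i := by
  simp [wv]; ring

lemma wv_add (k m : Fin 2 → ℤ) (i : Fin 2) : wv L (k + m) i = wv L k i + wv L m i := by
  simp [wv]; ring

lemma wv_zero (i : Fin 2) : wv L 0 i = 0 := by simp [wv]

lemma char_coe (k : Fin 2 → ℤ) (x : Fin 2 → ℝ) :
    char L k (fun i => (x i : AddCircle L)) = Complex.exp (∑ i, Complex.I * (wv L k i * x i)) := by
  rw [char_apply, Complex.exp_sum]
  refine Finset.prod_congr rfl fun i _ => ?_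
  rw [fourier_coe_apply]
  congr 1
  simp [wv]
  ring

lemma char_add_single (k : Fin 2 → ℤ) (i : Fin 2) (x : Torus L) (s : ℝ) :
    char L k (x + Pi.single i (s : AddCircle L))
      = char L k x * Complex.exp (Complex.I * (wv L k i * s)) := by
  have h1 : ∀ y : Torus L, char L k (x + y) = char L k x * char L k y := by
    intro y
    simp only [char_apply, ← Finset.prod_mul_distrib, Pi.add_apply]
    refine Finset.prod_congr rfl fun i _ => ?_
    simp [fourier_apply, smul_add, AddCircle.toCircle_add]
  have h2 : (Pi.single i (s : AddCircle L) : Torus L)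
      = fun j => ((Pi.single i s : Fin 2 → ℝ) j : AddCircle L) := by
    ext j
    by_cases h : j = i
    · subst h; simp
    · simp [Pi.single_eq_of_ne h]
  rw [h1, h2, char_coe, Finset.sum_eq_single i]
  · simp
  · intro j _ hj
    simp [Pi.single_eq_of_ne hj]
  · simp

lemma hasDerivAt_char (k : Fin 2 → ℤ) (i : Fin 2) (x : Torus L) :
    HasDerivAt (fun s : ℝ => char L k (x + Pi.single i (s : AddCircle L)))
      (Complex.I * wv L k i * char L k x) 0 := by
  simp only [char_add_single]
  have h1 : HasDerivAt (fun s : ℝ => Complex.I * (wv L k i * (s : ℂ)))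
      (Complex.I * wv L k i) 0 := by
    have := ((hasDerivAt_id (0 : ℝ)).ofReal_comp.const_mul (wv L k i : ℂ)).const_mul Complex.I
    simpa using this
  have h2 := (h1.cexp).const_mul (char L k x)
  simpa [mul_comm] using h2

lemma contDiff_char (k : Fin 2 → ℤ) :
    ContDiff ℝ ((⊤ : ℕ∞) : WithTop ℕ∞)
      (fun x : Fin 2 → ℝ => char L k (fun i => (x i : AddCircle L))) := by
  simp only [char_coe]
  refine ContDiff.cexp (ContDiff.sum fun i _ => ?_)
  exact contDiff_const.mul
    (contDiff_const.mul (Complex.ofRealCLM.contDiff.comp (contDiff_apply ℝ ℝ i)))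

lemma isSmooth_re_char (k : Fin 2 → ℤ) : IsSmooth (fun x : Torus L => (char L k x).re) :=
  Complex.reCLM.contDiff.comp (contDiff_char k)

lemma isSmooth_im_char (k : Fin 2 → ℤ) : IsSmooth (fun x : Torus L => (char L k x).im) :=
  Complex.imCLM.contDiff.comp (contDiff_char k)

lemma pderiv_re_char (k : Fin 2 → ℤ) (i : Fin 2) (x : Torus L) :
    pderiv i (fun x : Torus L => (char L k x).re) x = -(wv L k i * (char L k x).im) := by
  have h := (Complex.reCLM.hasFDerivAt.comp_hasDerivAt (0 : ℝ) (hasDerivAt_char k i x)).deriv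
  refine h.trans ?_
  simp [mul_assoc]

lemma pderiv_im_char (k : Fin 2 → ℤ) (i : Fin 2) (x : Torus L) :
    pderiv i (fun x : Torus L => (char L k x).im) x = wv L k i * (char L k x).re := by
  have h := (Complex.imCLM.hasFDerivAt.comp_hasDerivAt (0 : ℝ) (hasDerivAt_char k i x)).deriv
  refine h.trans ?_
  simp [mul_assoc]

lemma isOpenQuotientMap_torus :
    IsOpenQuotientMap (fun (x : Fin 2 → ℝ) (i : Fin 2) => (x i : AddCircle L)) :=
  IsOpenQuotientMap.piMap fun _ => QuotientAddGroup.isOpenQuotientMap_mk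

lemma IsSmooth.continuous {φ : Torus L → ℝ} (hφ : IsSmooth φ) : Continuous φ :=
  isOpenQuotientMap_torus.isQuotientMap.continuous_iff.mpr (ContDiff.continuous hφ)

lemma IsSmooth.hasDerivAt_coe {φ : Torus L → ℝ} (hφ : IsSmooth φ) (i : Fin 2) (x : Fin 2 → ℝ) :
    HasDerivAt (fun s : ℝ => φ ((fun j => (x j : AddCircle L)) + Pi.single i (s : AddCircle L)))
      (fderiv ℝ (fun x : Fin 2 → ℝ => φ (fun i => (x i : AddCircle L))) x (Pi.single i 1)) 0 := by
  have h1 : HasDerivAt (fun s : ℝ => x + s • (Pi.single i (1 : ℝ) : Fin 2 → ℝ))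
      (Pi.single i 1) 0 := by
    simpa using ((hasDerivAt_id (0 : ℝ)).smul_const
      (Pi.single i (1 : ℝ) : Fin 2 → ℝ)).const_add x
  have h2 : HasFDerivAt (fun x : Fin 2 → ℝ => φ (fun i => (x i : AddCircle L)))
      (fderiv ℝ (fun x : Fin 2 → ℝ => φ (fun i => (x i : AddCircle L))) x)
      (x + (0 : ℝ) • (Pi.single i (1 : ℝ) : Fin 2 → ℝ)) := by
    rw [zero_smul, add_zero]
    exact (ContDiff.differentiable hφ (by simp) x).hasFDerivAt
  refine (h2.comp_hasDerivAt (0 : ℝ) h1).congr_of_eventuallyEq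
    (Filter.Eventually.of_forall fun s => ?_)
  simp only [Function.comp]
  congr 1
  ext j
  by_cases h : j = i
  · subst h; simp
  · simp [Pi.single_eq_of_ne h]

lemma IsSmooth.hasDerivAt {φ : Torus L → ℝ} (hφ : IsSmooth φ) (i : Fin 2) (x : Torus L) :
    HasDerivAt (fun s : ℝ => φ (x + Pi.single i (s : AddCircle L))) (pderiv i φ x) 0 := by
  obtain ⟨y, rfl⟩ := isOpenQuotientMap_torus.surjective x
  exact (hφ.hasDerivAt_coe i y).differentiableAt.hasDerivAt

lemma IsSmooth.continuous_pderiv {φ : Torus L → ℝ} (hφ : IsSmooth φ) (i : Fin 2) :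
    Continuous (pderiv i φ) := by
  refine isOpenQuotientMap_torus.isQuotientMap.continuous_iff.mpr ?_
  have h : pderiv i φ ∘ (fun (x : Fin 2 → ℝ) (i : Fin 2) => (x i : AddCircle L))
      = fun x => fderiv ℝ (fun x : Fin 2 → ℝ => φ (fun i => (x i : AddCircle L))) x
        (Pi.single i 1) := by
    funext x
    exact (hφ.hasDerivAt_coe i x).deriv
  rw [h]
  exact (ContDiff.continuous_fderiv hφ (by simp)).clm_apply continuous_const

variable [hL : Fact (0 < L)]

/-- The integral of a directional derivative over the torus vanishes, by translation invariance. -/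
lemma integral_deriv_eq_zero {ψ ψ' : Torus L → ℂ} (i : Fin 2) (hc : Continuous ψ)
    (hc' : Continuous ψ')
    (h : ∀ x, HasDerivAt (fun s : ℝ => ψ (x + Pi.single i (s : AddCircle L))) (ψ' x) 0) :
    ∫ x, ψ' x = 0 := by
  obtain ⟨C, hC⟩ := hc'.bounded_above_of_compact_support (HasCompactSupport.of_compactSpace _)
  have ht : ∀ y : Torus L, Continuous fun x => ψ (x + y) := fun y =>
    hc.comp (continuous_id.add continuous_const)
  have ht' : ∀ y : Torus L, Continuous fun x => ψ' (x + y) := fun y =>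
    hc'.comp (continuous_id.add continuous_const)
  have key := hasDerivAt_integral_of_dominated_loc_of_deriv_le (μ := (volume : Measure (Torus L)))
    (F := fun (s : ℝ) x => ψ (x + Pi.single i (s : AddCircle L)))
    (F' := fun (s : ℝ) x => ψ' (x + Pi.single i (s : AddCircle L)))
    (x₀ := (0 : ℝ)) (s := Set.univ) (bound := fun _ => C) Filter.univ_mem
    (Filter.Eventually.of_forall fun s => (ht _).aestronglyMeasurable)
    ((ht _).integrable_of_hasCompactSupport (HasCompactSupport.of_compactSpace _))
    (ht' _).aestronglyMeasurable
    (Filter.Eventually.of_forall fun x s _ => hC _)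
    (integrable_const C)
    (Filter.Eventually.of_forall fun x s _ => by
      have h1 := h (x + Pi.single i (s : AddCircle L))
      have h2 : HasDerivAt (fun t : ℝ => t - s) 1 s := (hasDerivAt_id s).sub_const s
      have h3 := HasDerivAt.scomp (h := fun t : ℝ => t - s) s (by simpa using h1) h2
      rw [one_smul] at h3
      refine h3.congr_of_eventuallyEq (Filter.Eventually.of_forall fun t => ?_)
      simp only [Function.comp]
      congr 1
      rw [add_assoc, ← Pi.single_add, AddCircle.coe_sub]
      simp)
  have h0 : ∀ s : ℝ, ∫ x : Torus L, ψ (x + Pi.single i (s : AddCircle L)) = ∫ x, ψ x := fun s =>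
    integral_add_right_eq_self ψ _
  have h1 := key.2
  simp only [h0] at h1
  have h2 := h1.unique (hasDerivAt_const (0 : ℝ) _)
  simpa using h2

/-- Fourier coefficients turn derivatives into multiplication by the wave vector. -/
lemma fc_pderiv {φ : Torus L → ℝ} (hφ : IsSmooth φ) (i : Fin 2) (k : Fin 2 → ℤ) :
    fc (pderiv i φ) k = Complex.I * wv L k i * fc φ k := by
  have hd : ∀ x : Torus L,
      HasDerivAt (fun s : ℝ => (φ (x + Pi.single i (s : AddCircle L)) : ℂ)
        * char L (-k) (x + Pi.single i (s : AddCircle L)))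
      ((pderiv i φ x : ℂ) * char L (-k) x
        + (φ x : ℂ) * (Complex.I * wv L (-k) i * char L (-k) x)) 0 := by
    intro x
    have := (hφ.hasDerivAt i x).ofReal_comp.mul (hasDerivAt_char (-k) i x)
    simp only [AddCircle.coe_zero, Pi.single_zero, add_zero] at this
    exact this
  have c1 : Continuous fun x => (φ x : ℂ) := Complex.continuous_ofReal.comp hφ.continuous
  have c2 : Continuous fun x => (pderiv i φ x : ℂ) :=
    Complex.continuous_ofReal.comp (hφ.continuous_pderiv i)
  have c3 := (char L (-k)).continuous
  have key := integral_deriv_eq_zero i (c1.mul c3)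
    ((c2.mul c3).add (c1.mul ((continuous_const (y := Complex.I * wv L (-k) i)).mul c3))) hd
  have hi : ∀ {f : Torus L → ℂ}, Continuous f → Integrable f volume := fun hf =>
    hf.integrable_of_hasCompactSupport (HasCompactSupport.of_compactSpace _)
  have key := (integral_add (hi (c2.mul c3))
    (hi (c1.mul ((continuous_const (y := Complex.I * wv L (-k) i)).mul c3)))).symm.trans key
  simp only [Pi.mul_apply] at key
  have e : ∫ x, (φ x : ℂ) * (Complex.I * wv L (-k) i * char L (-k) x)
      = -(Complex.I * wv L k i) * ∫ x, (φ x : ℂ) * char L (-k) x := by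
    rw [← integral_const_mul]
    congr 1
    funext x
    rw [wv_neg]
    push_cast
    ring
  rw [e] at key
  unfold fc
  linear_combination (L⁻¹ : ℂ) * key

lemma integral_mul_char_neg (f : Torus L → ℝ) (k : Fin 2 → ℤ) :
    ∫ x, (f x : ℂ) * char L (-k) x = L * fc f k := by
  have hL' : (L : ℂ) ≠ 0 := by exact_mod_cast hL.out.ne'
  rw [fc, mul_inv_cancel_left₀ hL']

lemma integrable_mul_char {f : Torus L → ℝ} (hf : Integrable f volume) (k : Fin 2 → ℤ) :
    Integrable (fun x => (f x : ℂ) * char L k x) volume :=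
  hf.ofReal.mul_bdd (c := 1) (char L k).continuous.aestronglyMeasurable
    (Filter.Eventually.of_forall fun x => (norm_char k x).le)

lemma integral_mul_re_char {f : Torus L → ℝ} (hf : Integrable f volume) (k : Fin 2 → ℤ) :
    ∫ x, f x * (char L k x).re = L * (fc f k).re := by
  have h := Complex.reCLM.integral_comp_comm (integrable_mul_char hf (-k))
  rw [integral_mul_char_neg] at h
  simpa [char_neg] using h

lemma integral_mul_im_char {f : Torus L → ℝ} (hf : Integrable f volume) (k : Fin 2 → ℤ) :
    ∫ x, f x * (char L k x).im = -(L * (fc f k).im) := by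
  have h := Complex.imCLM.integral_comp_comm (integrable_mul_char hf (-k))
  rw [integral_mul_char_neg] at h
  simp [char_neg, integral_neg] at h
  linarith

lemma integrable_scalarL2 (f : ScalarL2 L) : Integrable f volume :=
  (Lp.memLp f).integrable (by norm_num)

/-- Weak derivatives in terms of Fourier coefficients: one direction tests with trigonometric
functions, the other one is Parseval's identity. -/
lemma isWeakPartial_iff (i : Fin 2) (f g : ScalarL2 L) :
    IsWeakPartial i f g ↔ ∀ k, fc g k = Complex.I * wv L k i * fc f k := by
  constructor
  · intro h k
    have h1 := h _ (isSmooth_re_char k)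
    have h2 := h _ (isSmooth_im_char k)
    simp only [pderiv_re_char, pderiv_im_char] at h1 h2
    have hL0 := hL.out.ne'
    have e1 : ∫ x, f x * -(wv L k i * (char L k x).im)
        = -(wv L k i) * ∫ x, f x * (char L k x).im := by
      rw [← integral_const_mul]; congr 1; funext x; ring
    have e2 : ∫ x, f x * (wv L k i * (char L k x).re)
        = wv L k i * ∫ x, f x * (char L k x).re := by
      rw [← integral_const_mul]; congr 1; funext x; ring
    have If := integrable_scalarL2 f
    have Ig := integrable_scalarL2 g
    rw [e1, integral_mul_im_char If, integral_mul_re_char Ig] at h1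
    rw [e2, integral_mul_re_char If, integral_mul_im_char Ig] at h2
    apply Complex.ext
    · simp
      apply mul_left_cancel₀ hL0
      linarith
    · simp
      apply mul_left_cancel₀ hL0
      linarith
  · intro h φ hφ
    have m1 : MemLp φ 2 (volume : Measure (Torus L)) :=
      hφ.continuous.memLp_of_hasCompactSupport (HasCompactSupport.of_compactSpace _)
    have m2 : MemLp (pderiv i φ) 2 (volume : Measure (Torus L)) :=
      (hφ.continuous_pderiv i).memLp_of_hasCompactSupport (HasCompactSupport.of_compactSpace _)
    have e1 : ∫ x, f x * pderiv i φ x = inner ℝ f (m2.toLp _) := by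
      rw [MeasureTheory.L2.inner_def]
      apply integral_congr_ae
      filter_upwards [m2.coeFn_toLp] with x hx
      rw [hx]; simp [mul_comm]
    have e2 : ∫ x, g x * φ x = inner ℝ g (m1.toLp _) := by
      rw [MeasureTheory.L2.inner_def]
      apply integral_congr_ae
      filter_upwards [m1.coeFn_toLp] with x hx
      rw [hx]; simp [mul_comm]
    rw [e1, e2]
    have s1 := hasSum_fc_inner f (m2.toLp _)
    have s2 := (hasSum_fc_inner g (m1.toLp _)).neg
    have : ∀ k, fc f k * conj (fc (m2.toLp _) k) = -(fc g k * conj (fc (m1.toLp _) k)) := by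
      intro k
      rw [fc_congr m2.coeFn_toLp, fc_congr m1.coeFn_toLp, fc_pderiv hφ, h k]
      simp
      ring
    simp only [this] at s1
    exact_mod_cast s1.unique s2

end

/-! ### Inequalities for sequences on the dual lattice -/

section

variable {L : ℝ}

/-- The **Cauchy–Schwarz inequality** for series of nonnegative terms, without convergence
assumptions. -/
lemma sq_tsum_mul_le {ι : Type*} (a b : ι → ℝ≥0) :
    (∑' i, (a i * b i : ℝ≥0∞)) ^ 2 ≤ (∑' i, (a i : ℝ≥0∞) ^ 2) * ∑' i, (b i : ℝ≥0∞) ^ 2 := by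
  have h1 : ∀ f g : ι → ℝ≥0∞, (∑' i, f i) * ∑' j, g j = ∑' i, ∑' j, f i * g j := by
    intro f g
    simp only [ENNReal.tsum_mul_left, ENNReal.tsum_mul_right]
  have h2 : 2 * ((∑' i, (a i * b i : ℝ≥0∞)) ^ 2)
      ≤ 2 * ((∑' i, (a i : ℝ≥0∞) ^ 2) * ∑' i, (b i : ℝ≥0∞) ^ 2) := by
    calc 2 * ((∑' i, (a i * b i : ℝ≥0∞)) ^ 2)
        = ∑' i, ∑' j, 2 * ((a i * b i) * (a j * b j) : ℝ≥0∞) := by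
          rw [sq, h1]
          simp only [ENNReal.tsum_mul_left]
      _ ≤ ∑' i, ∑' j, ((a i : ℝ≥0∞) ^ 2 * (b j : ℝ≥0∞) ^ 2
            + (a j : ℝ≥0∞) ^ 2 * (b i : ℝ≥0∞) ^ 2) := by
          refine ENNReal.tsum_le_tsum fun i => ENNReal.tsum_le_tsum fun j => ?_
          norm_cast
          rw [← NNReal.coe_le_coe]
          push_cast
          nlinarith [sq_nonneg ((a i : ℝ) * b j - a j * b i)]
      _ = 2 * ((∑' i, (a i : ℝ≥0∞) ^ 2) * ∑' i, (b i : ℝ≥0∞) ^ 2) := by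
          simp only [ENNReal.tsum_add]
          rw [← h1, ENNReal.tsum_comm, ← h1, two_mul]
  exact (ENNReal.mul_le_mul_iff_right (by simp) (by simp)).mp h2

variable (L) in
/-- The length of the wave vector with index `k`. -/
def wn (k : Fin 2 → ℤ) : ℝ≥0 := ⟨√(∑ i, wv L k i ^ 2), Real.sqrt_nonneg _⟩

lemma wn_sq (k : Fin 2 → ℤ) : (wn L k : ℝ) ^ 2 = ∑ i, wv L k i ^ 2 :=
  Real.sq_sqrt (Finset.sum_nonneg fun _ _ => sq_nonneg _)

lemma wn_neg (k : Fin 2 → ℤ) : wn L (-k) = wn L k := by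
  apply NNReal.eq
  simp only [wn, wv_neg, neg_sq]

lemma abs_wv_le (k : Fin 2 → ℤ) (i : Fin 2) : |wv L k i| ≤ wn L k := by
  rw [← Real.sqrt_sq_eq_abs]
  exact Real.sqrt_le_sqrt (Finset.single_le_sum (f := fun i => wv L k i ^ 2)
    (fun _ _ => sq_nonneg _) (Finset.mem_univ i))

lemma wn_zero : wn L 0 = 0 := by
  apply NNReal.eq
  change √(∑ i, wv L 0 i ^ 2) = 0
  simp [wv_zero]

/-- The convolution of two nonnegative sequences on the dual lattice. -/
def conv (α β : (Fin 2 → ℤ) → ℝ≥0) (k : Fin 2 → ℤ) : ℝ≥0∞ := ∑' m, (α m * β (k - m) : ℝ≥0∞)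

/-- **Young's inequality** `ℓ¹ * ℓ² ⊆ ℓ²`. -/
lemma tsum_conv_sq_le (α β : (Fin 2 → ℤ) → ℝ≥0) :
    ∑' k, conv α β k ^ 2 ≤ (∑' k, (α k : ℝ≥0∞)) ^ 2 * ∑' k, (β k : ℝ≥0∞) ^ 2 := by
  have h1 : ∀ k, conv α β k ^ 2
      ≤ (∑' m, (α m : ℝ≥0∞)) * ∑' m, (α m * (β (k - m)) ^ 2 : ℝ≥0∞) := by
    intro k
    have := sq_tsum_mul_le (fun m => NNReal.sqrt (α m)) (fun m => NNReal.sqrt (α m) * β (k - m))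
    refine le_trans (le_of_eq ?_) (this.trans (le_of_eq ?_))
    · unfold conv
      congr 1
      refine tsum_congr fun m => ?_
      norm_cast
      rw [← mul_assoc, NNReal.mul_self_sqrt]
    · congr 1
      · refine tsum_congr fun m => ?_
        norm_cast
        rw [NNReal.sq_sqrt]
      · refine tsum_congr fun m => ?_
        norm_cast
        rw [mul_pow, NNReal.sq_sqrt]
  refine (ENNReal.tsum_le_tsum h1).trans (le_of_eq ?_)
  rw [ENNReal.tsum_mul_left, ENNReal.tsum_comm]
  simp only [ENNReal.tsum_mul_left]
  have h2 : ∀ m, ∑' k, (β (k - m) : ℝ≥0∞) ^ 2 = ∑' k, (β k : ℝ≥0∞) ^ 2 := fun m =>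
    (Equiv.subRight m).tsum_eq fun k => (β k : ℝ≥0∞) ^ 2
  simp only [h2]
  rw [ENNReal.tsum_mul_right, sq, mul_assoc]

/-- The gain of regularity in the bootstrap for the stationary problem, on the level of Fourier
coefficients, where `v = |κ|⁻¹`: if `β = |κ| α` is square summable and `|κ|² α` is bounded by the
convolution of `α` and `β` up to a square summable sequence, then `α` is summable. -/
lemma tsum_ne_top_of_le_conv {v α β f : (Fin 2 → ℤ) → ℝ≥0} {C : ℝ≥0}
    (hv3 : ∑' k, (v k : ℝ≥0∞) ^ 3 ≠ ∞)
    (hβ : ∑' k, (β k : ℝ≥0∞) ^ 2 ≠ ∞) (hf : ∑' k, (f k : ℝ≥0∞) ^ 2 ≠ ∞)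
    (hα : ∀ k, α k = v k * β k)
    (h : ∀ k, (α k : ℝ≥0∞) ≤ (v k : ℝ≥0∞) ^ 2 * (C * conv α β k + f k)) :
    ∑' k, (α k : ℝ≥0∞) ≠ ∞ := by
  have hv4 : ∑' k, (v k : ℝ≥0∞) ^ 4 ≠ ∞ := by
    refine ne_top_of_le_ne_top
      (ENNReal.mul_ne_top (ENNReal.add_ne_top.mpr ⟨ENNReal.one_ne_top, hv3⟩) hv3)
      ((ENNReal.tsum_le_tsum fun k => ?_).trans_eq ENNReal.tsum_mul_left)
    have h1 : (v k : ℝ≥0∞) ≤ 1 + (v k : ℝ≥0∞) ^ 3 := by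
      rcases le_total (v k : ℝ≥0∞) 1 with h2 | h2
      · exact h2.trans le_self_add
      · exact (le_self_pow₀ h2 (by norm_num)).trans le_add_self
    rw [pow_succ' _ 3]
    gcongr
    exact h1.trans (by gcongr; exact ENNReal.le_tsum (f := fun k => (v k : ℝ≥0∞) ^ 3) k)
  have hmain : ∑' k, (v k : ℝ≥0∞) ^ 2 * conv α β k ≠ ∞ := by
    have e : ∀ k, (v k : ℝ≥0∞) ^ 2 * conv α β k
        ≤ ∑' m, ((v k : ℝ≥0∞) ^ 3 * (β m) ^ 2
          + ((v k : ℝ≥0∞) ^ 3 + (v m : ℝ≥0∞) ^ 3) * β (k - m) ^ 2) := by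
      intro k
      unfold conv
      rw [← ENNReal.tsum_mul_left]
      refine ENNReal.tsum_le_tsum fun m => ?_
      rw [hα m]
      norm_cast
      rw [← NNReal.coe_le_coe]
      push_cast
      -- weighted arithmetic-geometric mean with the weights `v(k)³` and `v(k) v(m)²`
      have a0 : (0 : ℝ) ≤ v k := (v k).2
      have b0 : (0 : ℝ) ≤ v m := (v m).2
      change (v k : ℝ) ^ 2 * (v m * β m * β (k - m)) ≤ _
      have h1 : (v k : ℝ) * v m ^ 2 ≤ (v k : ℝ) ^ 3 + v m ^ 3 := by
        rcases le_total (v k : ℝ) (v m) with hl | hl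
        · nlinarith [mul_le_mul_of_nonneg_right hl (sq_nonneg (v m : ℝ)), pow_nonneg a0 3]
        · nlinarith [mul_le_mul_of_nonneg_left (pow_le_pow_left₀ b0 hl 2) a0, pow_nonneg b0 3]
      have h2 := mul_le_mul_of_nonneg_right h1 (sq_nonneg (β (k - m) : ℝ))
      have h3 := mul_nonneg a0 (sq_nonneg ((v k : ℝ) * β m - v m * β (k - m)))
      have h4 : (0 : ℝ) ≤ (v k : ℝ) ^ 3 * β m ^ 2 := by positivity
      have h5 : (0 : ℝ) ≤ (v k : ℝ) * v m ^ 2 * β (k - m) ^ 2 := by positivity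
      nlinarith
    refine ne_top_of_le_ne_top ?_ (ENNReal.tsum_le_tsum e)
    have e2 : ∀ k, ∑' m, ((v k : ℝ≥0∞) ^ 3 * (β m) ^ 2
          + ((v k : ℝ≥0∞) ^ 3 + (v m : ℝ≥0∞) ^ 3) * β (k - m) ^ 2)
        = 2 * ((v k : ℝ≥0∞) ^ 3 * ∑' m, (β m : ℝ≥0∞) ^ 2)
          + ∑' m, (v m : ℝ≥0∞) ^ 3 * β (k - m) ^ 2 := by
      intro k
      simp only [add_mul, ENNReal.tsum_add, ENNReal.tsum_mul_left]
      have : ∑' m, (β (k - m) : ℝ≥0∞) ^ 2 = ∑' m, (β m : ℝ≥0∞) ^ 2 :=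
        (Equiv.subLeft k).tsum_eq fun m => (β m : ℝ≥0∞) ^ 2
      rw [this]
      ring
    simp only [e2]
    rw [ENNReal.tsum_add, ENNReal.tsum_mul_left, ENNReal.tsum_mul_right, ENNReal.tsum_comm]
    have e3 : ∀ m, ∑' k, (v m : ℝ≥0∞) ^ 3 * (β (k - m) : ℝ≥0∞) ^ 2
        = (v m : ℝ≥0∞) ^ 3 * ∑' k, (β k : ℝ≥0∞) ^ 2 := by
      intro m
      rw [ENNReal.tsum_mul_left]
      congr 1
      exact (Equiv.subRight m).tsum_eq fun k => (β k : ℝ≥0∞) ^ 2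
    simp only [e3]
    rw [ENNReal.tsum_mul_right]
    exact ENNReal.add_ne_top.mpr ⟨ENNReal.mul_ne_top (by simp) (ENNReal.mul_ne_top hv3 hβ),
      ENNReal.mul_ne_top hv3 hβ⟩
  have hrest : ∑' k, (v k : ℝ≥0∞) ^ 2 * f k ≠ ∞ := by
    refine ne_top_of_le_ne_top (ENNReal.add_ne_top.mpr ⟨hv4, hf⟩) ?_
    rw [← ENNReal.tsum_add]
    refine ENNReal.tsum_le_tsum fun k => ?_
    norm_cast
    rw [← NNReal.coe_le_coe]
    push_cast
    nlinarith [sq_nonneg ((v k : ℝ) ^ 2 - f k), sq_nonneg ((v k : ℝ) ^ 2), sq_nonneg (f k : ℝ)]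
  refine ne_top_of_le_ne_top ?_ (ENNReal.tsum_le_tsum h)
  have : ∀ k, ((v k : ℝ≥0) : ℝ≥0∞) ^ 2 * (C * conv α β k + f k)
      = C * ((v k : ℝ≥0∞) ^ 2 * conv α β k) + (v k : ℝ≥0∞) ^ 2 * f k := by
    intro k; ring
  simp only [this]
  rw [ENNReal.tsum_add, ENNReal.tsum_mul_left]
  exact ENNReal.add_ne_top.mpr ⟨ENNReal.mul_ne_top (by simp) hmain, hrest⟩

variable [hL : Fact (0 < L)]

lemma wn_pos {k : Fin 2 → ℤ} (hk : k ≠ 0) : 0 < wn L k := by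
  obtain ⟨i, hi⟩ := Function.ne_iff.mp hk
  have h1 : 0 < |wv L k i| := by
    rw [abs_pos]
    have : (k i : ℝ) ≠ 0 := by exact_mod_cast hi
    have := hL.out.ne'
    have := Real.pi_ne_zero
    unfold wv
    positivity
  exact_mod_cast h1.trans_le (abs_wv_le k i)

lemma inv_wn_mul {k : Fin 2 → ℤ} (hk : k ≠ 0) : (wn L k)⁻¹ * wn L k = 1 :=
  inv_mul_cancel₀ (wn_pos hk).ne'

/-- The series `∑ |κ|⁻³` over the two-dimensional dual lattice converges. -/
lemma tsum_inv_wn_ne_top : ∑' k, (((wn L k)⁻¹ : ℝ≥0) : ℝ≥0∞) ^ 3 ≠ ∞ := by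
  have h := EisensteinSeries.summable_one_div_norm_rpow (k := 3) (by norm_num)
  have h2 : Summable fun k => ((wn L k)⁻¹ : ℝ≥0) ^ 3 := by
    rw [← NNReal.summable_coe]
    refine Summable.of_nonneg_of_le (fun _ => by positivity) (fun k => ?_)
      (h.mul_left ((L / (2 * Real.pi)) ^ 3))
    by_cases hk : k = 0
    · subst hk
      simp [wn_zero]
    have hL0 := hL.out
    have hn : 0 < ‖k‖ := norm_pos_iff.mpr hk
    have h3 : 2 * Real.pi / L * ‖k‖ ≤ wn L k := by
      have : ‖k‖ ≤ L / (2 * Real.pi) * wn L k := by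
        refine (pi_norm_le_iff_of_nonneg (by positivity)).mpr fun i => ?_
        have := abs_wv_le (L := L) k i
        rw [Int.norm_eq_abs]
        rw [wv, abs_div, abs_mul, abs_of_pos hL0, abs_of_pos (by positivity : 0 < 2 * Real.pi),
          div_le_iff₀ hL0] at this
        rw [div_mul_eq_mul_div, le_div_iff₀ (by positivity)]
        linarith
      calc 2 * Real.pi / L * ‖k‖ ≤ 2 * Real.pi / L * (L / (2 * Real.pi) * wn L k) := by gcongr
        _ = wn L k := by
          have := Real.pi_pos
          field_simp
    rw [Real.rpow_neg hn.le]
    push_cast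
    rw [show ((3 : ℝ)) = ((3 : ℕ) : ℝ) by norm_num, Real.rpow_natCast, ← inv_pow, ← mul_pow]
    gcongr
    calc (wn L k : ℝ)⁻¹ ≤ (2 * Real.pi / L * ‖k‖)⁻¹ := by gcongr
      _ = L / (2 * Real.pi) * ‖k‖⁻¹ := by rw [mul_inv, inv_div]
  have h3 := ENNReal.tsum_coe_ne_top_iff_summable.mpr h2
  simpa only [ENNReal.coe_pow] using h3

/-- **Agmon's inequality** on the level of Fourier coefficients. -/
lemma agmon_fourier {α : (Fin 2 → ℤ) → ℝ≥0} (h0 : α 0 = 0) :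
    (∑' k, (α k : ℝ≥0∞)) ^ 4 ≤ (∑' k, (((wn L k)⁻¹ : ℝ≥0) : ℝ≥0∞) ^ 3) ^ 2
      * ((∑' k, ((wn L k * α k : ℝ≥0) : ℝ≥0∞) ^ 2)
        * ∑' k, ((wn L k ^ 2 * α k : ℝ≥0) : ℝ≥0∞) ^ 2) := by
  have e1 : (∑' k, (α k : ℝ≥0∞)) ^ 2 ≤ (∑' k, (((wn L k)⁻¹ : ℝ≥0) : ℝ≥0∞) ^ 3)
      * ∑' k, ((wn L k * α k : ℝ≥0) * (wn L k ^ 2 * α k : ℝ≥0) : ℝ≥0∞) := by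
    have h := sq_tsum_mul_le (fun k => NNReal.sqrt ((wn L k)⁻¹ ^ 3))
      (fun k => NNReal.sqrt ((wn L k) ^ 3) * α k)
    refine le_trans (le_of_eq ?_) (h.trans (le_of_eq ?_))
    · congr 1
      refine tsum_congr fun k => ?_
      norm_cast
      rw [← mul_assoc, ← NNReal.sqrt_mul, ← mul_pow]
      by_cases hk : k = 0
      · subst hk; simp [h0]
      · rw [inv_wn_mul hk]; simp
    · congr 1
      · refine tsum_congr fun k => ?_
        norm_cast
        rw [NNReal.sq_sqrt]
      · refine tsum_congr fun k => ?_
        norm_cast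
        rw [mul_pow, NNReal.sq_sqrt]
        ring
  calc (∑' k, (α k : ℝ≥0∞)) ^ 4 = ((∑' k, (α k : ℝ≥0∞)) ^ 2) ^ 2 := by ring
    _ ≤ _ := pow_le_pow_left' e1 2
    _ ≤ _ := by
      rw [mul_pow]
      gcongr
      exact sq_tsum_mul_le _ _

end

/-! ### The cancellation of the nonlinear term in the enstrophy balance -/

section

open ComplexConjugate

variable {L : ℝ}

/-- The sum of the absolute values of the components of a complex vector. -/
def absSum (z : Fin 2 → ℂ) : ℝ≥0 := ∑ i, ‖z i‖₊

lemma norm_le_absSum (z : Fin 2 → ℂ) (i : Fin 2) : ‖z i‖₊ ≤ absSum z :=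
  Finset.single_le_sum (f := fun i => ‖z i‖₊) (fun _ _ => zero_le) (Finset.mem_univ i)

variable (L) in
/-- The summand of the enstrophy transfer `∫ ((u·∇)u) · Δu dx` in Fourier variables (up to a
constant), for the frequencies `m`, `n` and `-(m + n)`. -/
def tri (U : (Fin 2 → ℤ) → Fin 2 → ℂ) (p : (Fin 2 → ℤ) × (Fin 2 → ℤ)) : ℂ :=
  ∑ j, (∑ i, U p.1 i * (wv L p.2 i * U p.2 j)) * ((wn L (p.1 + p.2) : ℂ) ^ 2 * U (-(p.1 + p.2)) j)

/-- The cyclic permutation of the frequencies `m`, `n` and `-(m + n)`. -/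
def cycEquiv : (Fin 2 → ℤ) × (Fin 2 → ℤ) ≃ (Fin 2 → ℤ) × (Fin 2 → ℤ) where
  toFun p := (p.2, -(p.1 + p.2))
  invFun p := (-(p.1 + p.2), p.1)
  left_inv p := by simp
  right_inv p := by simp

lemma summable_tri {U : (Fin 2 → ℤ) → Fin 2 → ℂ}
    (hα : ∑' k, (absSum (U k) : ℝ≥0∞) ≠ ∞)
    (hβ : ∑' k, ((wn L k * absSum (U k) : ℝ≥0) : ℝ≥0∞) ^ 2 ≠ ∞)
    (hγ : ∑' k, ((wn L k ^ 2 * absSum (U k) : ℝ≥0) : ℝ≥0∞) ^ 2 ≠ ∞) :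
    Summable (tri L U) := by
  set α := fun k => absSum (U k) with hαd
  set β := fun k => wn L k * absSum (U k) with hβd
  set γ := fun k => wn L k ^ 2 * absSum (U k) with hγd
  have hb : ∀ p, ‖tri L U p‖₊ ≤ 4 * (α p.1 * (β p.2 ^ 2 + γ (-(p.1 + p.2)) ^ 2)) := by
    intro p
    have h1 : ∀ j i, ‖U p.1 i * (wv L p.2 i * U p.2 j)‖₊ ≤ α p.1 * β p.2 := by
      intro j i
      rw [nnnorm_mul, nnnorm_mul]
      have h2 : ‖(wv L p.2 i : ℂ)‖₊ ≤ wn L p.2 := by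
        rw [← NNReal.coe_le_coe]
        simpa using abs_wv_le (L := L) p.2 i
      exact mul_le_mul' (norm_le_absSum _ _) (mul_le_mul' h2 (norm_le_absSum _ _))
    have h3 : ∀ j, ‖((wn L (p.1 + p.2) : ℂ) ^ 2 * U (-(p.1 + p.2)) j)‖₊ ≤ γ (-(p.1 + p.2)) := by
      intro j
      rw [nnnorm_mul, nnnorm_pow, hγd]
      simp only [wn_neg]
      gcongr
      · rw [← NNReal.coe_le_coe]; simp
      · exact norm_le_absSum _ _
    calc ‖tri L U p‖₊ ≤ ∑ j : Fin 2, (∑ i : Fin 2, α p.1 * β p.2) * γ (-(p.1 + p.2)) := by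
          refine (nnnorm_sum_le _ _).trans (Finset.sum_le_sum fun j _ => ?_)
          rw [nnnorm_mul]
          exact mul_le_mul' ((nnnorm_sum_le _ _).trans (Finset.sum_le_sum fun i _ => h1 j i))
            (h3 j)
      _ = 4 * (α p.1 * (β p.2 * γ (-(p.1 + p.2)))) := by simp; ring
      _ ≤ _ := by
        gcongr
        rw [← NNReal.coe_le_coe]
        push_cast
        nlinarith [sq_nonneg ((β p.2 : ℝ) - γ (-(p.1 + p.2))), sq_nonneg (β p.2 : ℝ),
          sq_nonneg (γ (-(p.1 + p.2)) : ℝ)]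
  refine Summable.of_nnnorm (NNReal.summable_of_le hb ?_)
  rw [← ENNReal.tsum_coe_ne_top_iff_summable]
  push_cast
  rw [ENNReal.tsum_mul_left]
  refine ENNReal.mul_ne_top (by simp) ?_
  have hγ' : ∀ m, ∑' n, (γ (-(m + n)) : ℝ≥0∞) ^ 2 = ∑' k, (γ k : ℝ≥0∞) ^ 2 := fun m =>
    ((Equiv.addLeft m).trans (Equiv.neg _)).tsum_eq fun k => (γ k : ℝ≥0∞) ^ 2
  have e := ENNReal.tsum_prod (f := fun m n : Fin 2 → ℤ =>
    (α m : ℝ≥0∞) * ((β n : ℝ≥0∞) ^ 2 + (γ (-(m + n)) : ℝ≥0∞) ^ 2))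
  refine ne_of_eq_of_ne e ?_
  simp only [ENNReal.tsum_mul_left, ENNReal.tsum_add, hγ', ENNReal.tsum_mul_right]
  exact ENNReal.mul_ne_top hα (ENNReal.add_ne_top.mpr ⟨hβ, hγ⟩)

lemma wn_sq_complex (k : Fin 2 → ℤ) :
    ((wn L k : ℝ) : ℂ) ^ 2 = (wv L k 0 : ℂ) ^ 2 + (wv L k 1 : ℂ) ^ 2 := by
  have := wn_sq (L := L) k
  rw [Fin.sum_univ_two] at this
  exact_mod_cast this

/-- A divergence-free field on the two-dimensional torus has a stream function. -/
lemma exists_stream [Fact (0 < L)] {U : (Fin 2 → ℤ) → Fin 2 → ℂ} (h0 : ∀ i, U 0 i = 0)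
    (hdiv : ∀ k, ∑ i, (wv L k i : ℂ) * U k i = 0) :
    ∃ ψ : (Fin 2 → ℤ) → ℂ, ∀ k, U k 0 = -(wv L k 1 * ψ k) ∧ U k 1 = wv L k 0 * ψ k := by
  refine ⟨fun k => (wv L k 0 * U k 1 - wv L k 1 * U k 0) / ((wn L k : ℝ) : ℂ) ^ 2, fun k => ?_⟩
  by_cases hk : k = 0
  · subst hk
    simp [h0, wn_zero]
  have hw : ((wn L k : ℝ) : ℂ) ^ 2 ≠ 0 := by
    have := (wn_pos (L := L) hk).ne'
    exact_mod_cast pow_ne_zero 2 this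
  have hd := hdiv k
  rw [Fin.sum_univ_two] at hd
  have hs := wn_sq_complex (L := L) k
  constructor
  · rw [← mul_div_assoc, ← neg_div, eq_div_iff hw, hs]
    linear_combination (wv L k 0 : ℂ) * hd
  · rw [← mul_div_assoc, eq_div_iff hw, hs]
    linear_combination (wv L k 1 : ℂ) * hd

/-- In two dimensions the nonlinear term does not contribute to the enstrophy balance:
`∫ ((u·∇)u) · Δu dx = 0` for divergence-free `u`. In terms of the stream function, the summand is
annihilated by the symmetrization over the six permutations of the three frequencies. -/
lemma tsum_tri_eq_zero [Fact (0 < L)] {U : (Fin 2 → ℤ) → Fin 2 → ℂ} (h0 : ∀ i, U 0 i = 0)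
    (hdiv : ∀ k, ∑ i, (wv L k i : ℂ) * U k i = 0) (hs : Summable (tri L U)) :
    ∑' p, tri L U p = 0 := by
  obtain ⟨ψ, hψ⟩ := exists_stream h0 hdiv
  let sw := Equiv.prodComm (Fin 2 → ℤ) (Fin 2 → ℤ)
  have H := hs.hasSum
  have H1 := cycEquiv.hasSum_iff.mpr H
  have H2 := cycEquiv.hasSum_iff.mpr H1
  have K := sw.hasSum_iff.mpr H
  have K1 := sw.hasSum_iff.mpr H1
  have K2 := sw.hasSum_iff.mpr H2
  have key : ∀ p, tri L U p + (tri L U ∘ cycEquiv) p + ((tri L U ∘ cycEquiv) ∘ cycEquiv) p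
      + ((tri L U ∘ sw) p + ((tri L U ∘ cycEquiv) ∘ sw) p
        + (((tri L U ∘ cycEquiv) ∘ cycEquiv) ∘ sw) p) = 0 := by
    rintro ⟨m, n⟩
    have hp : ∀ i, wv L (-(m + n)) i = -(wv L m i + wv L n i) := fun i => by
      rw [wv_neg, wv_add]
    have e1 : -(m + n) = -(n + m) := by abel
    have e2 : n + -(m + n) = -m := by abel
    have e3 : -(m + n) + m = -n := by abel
    have e4 : m + -(n + m) = -n := by abel
    have e5 : -(n + m) + n = -m := by abel
    have e6 : m + n = n + m := by abel
    simp only [Function.comp, cycEquiv, sw, Equiv.coe_fn_mk, Equiv.prodComm_apply, Prod.swap, tri,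
      Fin.sum_univ_two]
    rw [e2, e4, neg_neg, neg_neg, e3, e5]
    rw [← e6]
    simp only [neg_neg, wn_neg, (hψ _).1, (hψ _).2, hp, wn_sq_complex, wv_add]
    push_cast
    ring
  have hsum := ((H.add H1).add H2).add ((K.add K1).add K2)
  simp only [key] at hsum
  have h6 := hsum.unique hasSum_zero
  linear_combination h6 / 6

end

/-! ### Scalar Sobolev functions in Fourier variables -/

section

open ComplexConjugate

variable {L : ℝ} [hL : Fact (0 < L)]

lemma fc_wpartial {f : ScalarL2 L} (hf : MemW12 f) (i : Fin 2) (k : Fin 2 → ℤ) :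
    fc (wpartial i f) k = Complex.I * wv L k i * fc f k := by
  have h : IsWeakPartial i f (wpartial i f) := by
    rw [wpartial, dif_pos (hf i)]
    exact (hf i).choose_spec
  exact (isWeakPartial_iff i f _).mp h k

lemma wpartial_eq {f g : ScalarL2 L} {i : Fin 2}
    (h : ∀ k, fc g k = Complex.I * wv L k i * fc f k) : wpartial i f = g := by
  have hg : IsWeakPartial i f g := (isWeakPartial_iff i f g).mpr h
  have h2 : IsWeakPartial i f (wpartial i f) := by
    rw [wpartial, dif_pos ⟨g, hg⟩]
    exact Exists.choose_spec (⟨g, hg⟩ : ∃ g, IsWeakPartial i f g)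
  refine ext_fc fun k => ?_
  rw [h k, (isWeakPartial_iff i f _).mp h2 k]

lemma wpartial_zero (i : Fin 2) : wpartial i (0 : ScalarL2 L) = 0 :=
  wpartial_eq fun k => by rw [fc_zero]; simp

lemma memW12_zero : MemW12 (0 : ScalarL2 L) := fun i =>
  ⟨0, (isWeakPartial_iff i _ _).mpr fun k => by rw [fc_zero]; simp⟩

/-- Functions with a square summable Fourier gradient are in `W^{1,2}`. -/
lemma memW12_of_summable {f : ScalarL2 L}
    (h : Summable fun k => (wn L k : ℝ) ^ 2 * ‖fc f k‖ ^ 2) : MemW12 f := by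
  intro i
  obtain ⟨g, hg⟩ := exists_fc_eq (L := L) (a := fun k => Complex.I * wv L k i * fc f k)
    (by
      refine Summable.of_nonneg_of_le (fun _ => sq_nonneg _) (fun k => ?_) h
      rw [norm_mul, norm_mul, Complex.norm_I, one_mul, mul_pow, Complex.norm_real,
        Real.norm_eq_abs]
      gcongr
      exact abs_wv_le k i)
    (by
      intro k
      rw [fc_neg, wv_neg]
      simp)
  exact ⟨g, (isWeakPartial_iff i f g).mpr hg⟩

lemma hasSum_gradNormSq {f : ScalarL2 L} (hf : MemW12 f) :
    HasSum (fun k => (wn L k : ℝ) ^ 2 * ‖fc f k‖ ^ 2) (gradNormSq f) := by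
  have h := hasSum_sum (s := Finset.univ) fun i (_ : i ∈ Finset.univ) =>
    hasSum_fc_sq (wpartial i f)
  refine h.congr_fun fun k => ?_
  rw [wn_sq, Finset.sum_mul]
  refine Finset.sum_congr rfl fun i _ => ?_
  rw [fc_wpartial hf, norm_mul, norm_mul, Complex.norm_I, one_mul, mul_pow, Complex.norm_real,
    Real.norm_eq_abs, sq_abs]

/-! ### Vector fields in Fourier variables -/

/-- The Fourier coefficients of the components of a vector field. -/
def vfc (u : VectorL2 L) (k : Fin 2 → ℤ) (j : Fin 2) : ℂ := fc (coord j u) k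

lemma coeFn_coord (j : Fin 2) (u : VectorL2 L) : coord j u =ᵐ[volume] fun x => u x j :=
  ContinuousLinearMap.coeFn_compLp _ _

lemma coord_sub (j : Fin 2) (u v : VectorL2 L) : coord j (u - v) = coord j u - coord j v :=
  map_sub ((EuclideanSpace.proj j : EuclideanSpace ℝ (Fin 2) →L[ℝ] ℝ).compLpL 2 volume) u v

lemma vfc_sub (u v : VectorL2 L) (k : Fin 2 → ℤ) (j : Fin 2) :
    vfc (u - v) k j = vfc u k j - vfc v k j := by
  rw [vfc, coord_sub, fc_sub]; rfl

lemma vfc_neg (u : VectorL2 L) (k : Fin 2 → ℤ) (j : Fin 2) :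
    vfc u (-k) j = conj (vfc u k j) := fc_neg _ _

lemma inner_eq_sum_coord (u v : VectorL2 L) :
    inner ℝ u v = ∑ j, inner ℝ (coord j u) (coord j v) := by
  simp only [MeasureTheory.L2.inner_def]
  rw [← integral_finsetSum]
  · apply integral_congr_ae
    filter_upwards [coeFn_coord 0 u, coeFn_coord 1 u, coeFn_coord 0 v, coeFn_coord 1 v]
      with x h1 h2 h3 h4
    rw [Fin.sum_univ_two, h1, h2, h3, h4, PiLp.inner_apply, Fin.sum_univ_two]
  · intro j _
    exact L2.integrable_inner _ _

/-- **Parseval's identity** for vector fields. -/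
lemma hasSum_vfc_inner (u v : VectorL2 L) :
    HasSum (fun k => ∑ j, vfc u k j * conj (vfc v k j)) ((inner ℝ u v : ℝ) : ℂ) := by
  rw [inner_eq_sum_coord]
  push_cast
  exact hasSum_sum fun j _ => hasSum_fc_inner _ _

lemma hasSum_vfc_sq (u : VectorL2 L) : HasSum (fun k => ∑ j, ‖vfc u k j‖ ^ 2) (‖u‖ ^ 2) := by
  rw [← real_inner_self_eq_norm_sq, inner_eq_sum_coord]
  refine hasSum_sum fun j _ => ?_
  rw [real_inner_self_eq_norm_sq]
  exact hasSum_fc_sq _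

/-- The vector field with the given components. -/
def mkVec (f : Fin 2 → ScalarL2 L) : VectorL2 L :=
  ∑ j, (ContinuousLinearMap.toSpanSingleton ℝ (EuclideanSpace.single j (1 : ℝ))).compLp (f j)

lemma coeFn_mkVec (f : Fin 2 → ScalarL2 L) :
    mkVec f =ᵐ[volume] fun x => ∑ j, f j x • EuclideanSpace.single j (1 : ℝ) := by
  rw [mkVec, Fin.sum_univ_two]
  filter_upwards [Lp.coeFn_add
    ((ContinuousLinearMap.toSpanSingleton ℝ
      (EuclideanSpace.single (0 : Fin 2) (1 : ℝ))).compLp (f 0))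
    ((ContinuousLinearMap.toSpanSingleton ℝ
      (EuclideanSpace.single (1 : Fin 2) (1 : ℝ))).compLp (f 1)),
    ContinuousLinearMap.coeFn_compLp
      (ContinuousLinearMap.toSpanSingleton ℝ (EuclideanSpace.single (0 : Fin 2) (1 : ℝ))) (f 0),
    ContinuousLinearMap.coeFn_compLp
      (ContinuousLinearMap.toSpanSingleton ℝ (EuclideanSpace.single (1 : Fin 2) (1 : ℝ))) (f 1)]
    with x h1 h2 h3
  rw [h1, Pi.add_apply, h2, h3, Fin.sum_univ_two]
  rfl

lemma coord_mkVec (f : Fin 2 → ScalarL2 L) (j : Fin 2) : coord j (mkVec f) = f j := by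
  ext1
  filter_upwards [coeFn_coord j (mkVec f), coeFn_mkVec f] with x h1 h2
  rw [h1, h2]
  simp [Fin.sum_univ_two]
  fin_cases j <;> simp

lemma exists_vfc_eq {a : (Fin 2 → ℤ) → Fin 2 → ℂ} (ha : ∀ j, Summable fun k => ‖a k j‖ ^ 2)
    (hs : ∀ k j, a (-k) j = conj (a k j)) : ∃ u : VectorL2 L, ∀ k j, vfc u k j = a k j := by
  choose f hf using fun j => exists_fc_eq (L := L) (ha j) (fun k => hs k j)
  refine ⟨mkVec f, fun k j => ?_⟩
  rw [vfc, coord_mkVec, hf]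

/-- The mean zero, divergence-free vector fields in terms of their Fourier coefficients. -/
lemma mem_spaceH_iff (u : VectorL2 L) : u ∈ spaceH L ↔
    (∀ j, vfc u 0 j = 0) ∧ ∀ k, ∑ j, (wv L k j : ℂ) * vfc u k j = 0 := by
  have hLC : (L : ℂ) ≠ 0 := by exact_mod_cast hL.out.ne'
  have hmean : (∫ x, u x = 0) ↔ ∀ j, vfc u 0 j = 0 := by
    have h1 : ∀ j, vfc u 0 j = (L⁻¹ : ℂ) * ((∫ x, u x) j : ℝ) := by
      intro j
      rw [vfc, fc, neg_zero]
      congr 1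
      have h2 := (EuclideanSpace.proj j : EuclideanSpace ℝ (Fin 2) →L[ℝ] ℝ).integral_comp_comm
        ((Lp.memLp u).integrable (by norm_num : (1 : ℝ≥0∞) ≤ 2))
      change ∫ x, u x j = (∫ x, u x) j at h2
      rw [← h2, ← integral_complex_ofReal]
      apply integral_congr_ae
      filter_upwards [coeFn_coord j u] with x hx
      rw [hx, char_zero]
      simp
    constructor
    · intro h j
      rw [h1, h]; simp
    · intro h
      ext j
      have h3 := h j
      rw [h1, mul_eq_zero] at h3
      rcases h3 with h3 | h3
      · exact absurd h3 (inv_ne_zero hLC)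
      · simpa using h3
  have hint : ∀ {φ : Torus L → ℝ}, Continuous φ → ∀ j,
      Integrable (fun x => coord j u x * φ x) volume := by
    intro φ hφ j
    obtain ⟨C, hC⟩ := hφ.bounded_above_of_compact_support (HasCompactSupport.of_compactSpace _)
    exact (integrable_scalarL2 _).mul_bdd (c := C) hφ.aestronglyMeasurable
      (Filter.Eventually.of_forall hC)
  have hsplit : ∀ φ : Torus L → ℝ, IsSmooth φ →
      ∫ x, ∑ i : Fin 2, u x i * pderiv i φ x = ∑ i, ∫ x, coord i u x * pderiv i φ x := by
    intro φ hφ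
    rw [← integral_finsetSum _ fun i _ => hint (hφ.continuous_pderiv i) i]
    apply integral_congr_ae
    filter_upwards [coeFn_coord 0 u, coeFn_coord 1 u] with x h1 h2
    rw [Fin.sum_univ_two, Fin.sum_univ_two, h1, h2]
  rw [spaceH, Set.mem_ofPred_eq, hmean]
  refine and_congr_right fun _ => ?_
  constructor
  · intro h k
    have h1 := h _ (isSmooth_re_char k)
    have h2 := h _ (isSmooth_im_char k)
    rw [hsplit _ (isSmooth_re_char k)] at h1
    rw [hsplit _ (isSmooth_im_char k)] at h2
    simp only [pderiv_re_char, pderiv_im_char] at h1 h2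
    have e1 : ∀ i, ∫ x, coord i u x * -(wv L k i * (char L k x).im)
        = wv L k i * (L * (vfc u k i).im) := by
      intro i
      rw [← neg_neg (L * _), vfc, ← integral_mul_im_char (integrable_scalarL2 _), mul_neg,
        ← neg_mul, ← integral_const_mul]
      congr 1; funext x; ring
    have e2 : ∀ i, ∫ x, coord i u x * (wv L k i * (char L k x).re)
        = wv L k i * (L * (vfc u k i).re) := by
      intro i
      rw [vfc, ← integral_mul_re_char (integrable_scalarL2 _), ← integral_const_mul]
      congr 1; funext x; ring
    simp only [e1, e2, Fin.sum_univ_two] at h1 h2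
    have hL0 := hL.out.ne'
    rw [Fin.sum_univ_two]
    apply Complex.ext
    · simp
      apply mul_left_cancel₀ hL0
      linarith
    · simp
      apply mul_left_cancel₀ hL0
      linarith
  · intro h φ hφ
    rw [hsplit φ hφ]
    have m1 : MemLp φ 2 (volume : Measure (Torus L)) :=
      hφ.continuous.memLp_of_hasCompactSupport (HasCompactSupport.of_compactSpace _)
    have m2 : ∀ i, MemLp (pderiv i φ) 2 (volume : Measure (Torus L)) := fun i =>
      (hφ.continuous_pderiv i).memLp_of_hasCompactSupport (HasCompactSupport.of_compactSpace _)
    have e1 : ∀ i, ∫ x, coord i u x * pderiv i φ x = inner ℝ (coord i u) ((m2 i).toLp _) := by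
      intro i
      rw [MeasureTheory.L2.inner_def]
      apply integral_congr_ae
      filter_upwards [(m2 i).coeFn_toLp] with x hx
      rw [hx]; simp [mul_comm]
    simp only [e1]
    have s := hasSum_sum (s := Finset.univ) fun i (_ : i ∈ Finset.univ) =>
      hasSum_fc_inner (coord i u) ((m2 i).toLp _)
    have : ∀ k, ∑ i, fc (coord i u) k * conj (fc ((m2 i).toLp _) k) = 0 := by
      intro k
      have : ∀ i, fc (coord i u) k * conj (fc ((m2 i).toLp _) k)
          = -Complex.I * conj (fc φ k) * (wv L k i * vfc u k i) := by
        intro i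
        rw [fc_congr (m2 i).coeFn_toLp, fc_pderiv hφ, vfc]
        simp
        ring
      simp only [this]
      rw [← Finset.mul_sum, h k, mul_zero]
    simp only [this] at s
    have := s.unique hasSum_zero
    exact_mod_cast this

/-! ### Trigonometric test functions -/

variable (L) in
/-- The real part of a character, as an element of `L²`. -/
def cosLp (k : Fin 2 → ℤ) : ScalarL2 L :=
  ((isSmooth_re_char (L := L) k).continuous.memLp_of_hasCompactSupport
    (HasCompactSupport.of_compactSpace _) : MemLp _ 2 (volume : Measure (Torus L))).toLp _

variable (L) in
/-- The imaginary part of a character, as an element of `L²`. -/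
def sinLp (k : Fin 2 → ℤ) : ScalarL2 L :=
  ((isSmooth_im_char (L := L) k).continuous.memLp_of_hasCompactSupport
    (HasCompactSupport.of_compactSpace _) : MemLp _ 2 (volume : Measure (Torus L))).toLp _

lemma coeFn_cosLp (k : Fin 2 → ℤ) : cosLp L k =ᵐ[volume] fun x => (char L k x).re :=
  MemLp.coeFn_toLp _

lemma coeFn_sinLp (k : Fin 2 → ℤ) : sinLp L k =ᵐ[volume] fun x => (char L k x).im :=
  MemLp.coeFn_toLp _

lemma inner_cosLp (f : ScalarL2 L) (k : Fin 2 → ℤ) :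
    inner ℝ f (cosLp L k) = L * (fc f k).re := by
  rw [← integral_mul_re_char (integrable_scalarL2 f), MeasureTheory.L2.inner_def]
  apply integral_congr_ae
  filter_upwards [coeFn_cosLp (L := L) k] with x hx
  rw [hx]; simp [mul_comm]

lemma inner_sinLp (f : ScalarL2 L) (k : Fin 2 → ℤ) :
    inner ℝ f (sinLp L k) = -(L * (fc f k).im) := by
  rw [← integral_mul_im_char (integrable_scalarL2 f), MeasureTheory.L2.inner_def]
  apply integral_congr_ae
  filter_upwards [coeFn_sinLp (L := L) k] with x hx
  rw [hx]; simp [mul_comm]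

lemma isWeakPartial_cosLp (k : Fin 2 → ℤ) (i : Fin 2) :
    IsWeakPartial i (cosLp L k) (-wv L k i • sinLp L k) := by
  rw [isWeakPartial_iff]
  intro m
  rw [fc_smul, fc_congr (coeFn_sinLp k), fc_congr (coeFn_cosLp k), ← fc_pderiv (isSmooth_re_char k)]
  simp only [funext (pderiv_re_char (L := L) k i), fc]
  rw [mul_left_comm, ← integral_const_mul]
  congr 2
  funext x
  push_cast
  ring

lemma isWeakPartial_sinLp (k : Fin 2 → ℤ) (i : Fin 2) :
    IsWeakPartial i (sinLp L k) (wv L k i • cosLp L k) := by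
  rw [isWeakPartial_iff]
  intro m
  rw [fc_smul, fc_congr (coeFn_sinLp k), fc_congr (coeFn_cosLp k), ← fc_pderiv (isSmooth_im_char k)]
  simp only [funext (pderiv_im_char (L := L) k i), fc]
  rw [mul_left_comm, ← integral_const_mul]
  congr 2
  funext x
  push_cast
  ring

lemma memW12_cosLp (k : Fin 2 → ℤ) : MemW12 (cosLp L k) := fun i => ⟨_, isWeakPartial_cosLp k i⟩

lemma memW12_sinLp (k : Fin 2 → ℤ) : MemW12 (sinLp L k) := fun i => ⟨_, isWeakPartial_sinLp k i⟩

lemma wpartial_cosLp (k : Fin 2 → ℤ) (i : Fin 2) :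
    wpartial i (cosLp L k) = -wv L k i • sinLp L k :=
  wpartial_eq ((isWeakPartial_iff i _ _).mp (isWeakPartial_cosLp k i))

lemma wpartial_sinLp (k : Fin 2 → ℤ) (i : Fin 2) :
    wpartial i (sinLp L k) = wv L k i • cosLp L k :=
  wpartial_eq ((isWeakPartial_iff i _ _).mp (isWeakPartial_sinLp k i))

end

/-! ### The weak momentum equation in Fourier variables -/

section

open ComplexConjugate

variable {L : ℝ} [hL : Fact (0 < L)]

/-- The Fourier coefficients of the components of the nonlinear term `(u·∇)u`. -/
def nfc (u : VectorL2 L) (k : Fin 2 → ℤ) (j : Fin 2) : ℂ :=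
  ∑ i, fc (fun x => coord i u x * wpartial i (coord j u) x) k

lemma integrable_mul (f g : ScalarL2 L) : Integrable (fun x => f x * g x) volume := by
  have h := L2.integrable_inner (𝕜 := ℝ) g f
  exact h

lemma hasSum_nfc {u : VectorL2 L} (hu : VecMemW12 u) (k : Fin 2 → ℤ) (j : Fin 2) :
    HasSum (fun m => ∑ i, vfc u m i * (Complex.I * wv L (k - m) i * vfc u (k - m) j))
      (L * nfc u k j) := by
  rw [nfc, Finset.mul_sum]
  refine hasSum_sum fun i _ => ?_
  refine (hasSum_fc_mul (coord i u) (wpartial i (coord j u)) k).congr_fun fun m => ?_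
  rw [fc_wpartial (hu j)]
  rfl

lemma enorm_nfc_le {u : VectorL2 L} (hu : VecMemW12 u) (k : Fin 2 → ℤ) (j : Fin 2) :
    (‖nfc u k j‖₊ : ℝ≥0∞) ≤ (L.toNNReal⁻¹ : ℝ≥0) * conv (fun m => absSum (vfc u m))
      (fun m => wn L m * absSum (vfc u m)) k := by
  have h := (hasSum_nfc hu k j).tsum_eq
  have hLp : 0 < L.toNNReal := Real.toNNReal_pos.mpr hL.out
  have h1 : ‖(L : ℂ)‖₊ = L.toNNReal := by
    rw [← NNReal.coe_inj, coe_nnnorm, Complex.norm_real, Real.coe_toNNReal _ hL.out.le,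
      Real.norm_of_nonneg hL.out.le]
  have h2 : ((L.toNNReal * ‖nfc u k j‖₊ : ℝ≥0) : ℝ≥0∞) ≤ conv (fun m => absSum (vfc u m))
      (fun m => wn L m * absSum (vfc u m)) k := by
    have e : ((L.toNNReal * ‖nfc u k j‖₊ : ℝ≥0) : ℝ≥0∞) = ‖(L : ℂ) * nfc u k j‖ₑ := by
      rw [← h1, ← nnnorm_mul]; rfl
    rw [e, ← h]
    refine enorm_tsum_le_tsum_enorm.trans (ENNReal.tsum_le_tsum fun m => ?_)
    change ((‖_‖₊ : ℝ≥0) : ℝ≥0∞) ≤ _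
    norm_cast
    refine (nnnorm_sum_le _ _).trans ?_
    simp only [absSum]
    rw [Finset.sum_mul]
    refine Finset.sum_le_sum fun i _ => ?_
    rw [nnnorm_mul, nnnorm_mul, nnnorm_mul, Complex.nnnorm_I, one_mul]
    have h2 : ‖(wv L (k - m) i : ℂ)‖₊ ≤ wn L (k - m) := by
      rw [← NNReal.coe_le_coe]
      simpa using abs_wv_le (L := L) (k - m) i
    exact mul_le_mul' le_rfl (mul_le_mul' h2 (norm_le_absSum _ _))
  calc (‖nfc u k j‖₊ : ℝ≥0∞)
      = (L.toNNReal⁻¹ : ℝ≥0) * ((L.toNNReal * ‖nfc u k j‖₊ : ℝ≥0) : ℝ≥0∞) := by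
        norm_cast
        rw [inv_mul_cancel_left₀ hLp.ne']
    _ ≤ _ := by gcongr

/-- The vector field whose `j`-th component is `f` and whose other component vanishes. -/
def single (j : Fin 2) (f : ScalarL2 L) : VectorL2 L := mkVec (Pi.single j f)

lemma coord_single (j : Fin 2) (f : ScalarL2 L) (i : Fin 2) :
    coord i (single j f) = if i = j then f else 0 := by
  rw [single, coord_mkVec, Pi.single_apply]

lemma vecMemW12_single {f : ScalarL2 L} (hf : MemW12 f) (j : Fin 2) : VecMemW12 (single j f) := by
  intro i
  rw [coord_single]
  split_ifs
  · exact hf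
  · exact memW12_zero

lemma inner_single (u : VectorL2 L) (j : Fin 2) (f : ScalarL2 L) :
    inner ℝ u (single j f) = inner ℝ (coord j u) f := by
  rw [inner_eq_sum_coord, Finset.sum_eq_single j]
  · rw [coord_single, if_pos rfl]
  · intro i _ hi
    rw [coord_single, if_neg hi, inner_zero_right]
  · simp

lemma gradInner_single (u : VectorL2 L) (j : Fin 2) (f : ScalarL2 L) :
    gradInner u (single j f) = ∑ i, inner ℝ (wpartial i (coord j u)) (wpartial i f) := by
  rw [gradInner, Finset.sum_eq_single j]
  · simp only [coord_single, if_pos]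
  · intro i _ hi
    simp only [coord_single, if_neg hi, wpartial_zero, inner_zero_right, Finset.sum_const_zero]
  · simp

lemma divergence_single (j : Fin 2) (f : ScalarL2 L) :
    divergence (single j f) = wpartial j f := by
  rw [divergence, Finset.sum_eq_single j]
  · rw [coord_single, if_pos rfl]
  · intro i _ hi
    rw [coord_single, if_neg hi, wpartial_zero]
  · simp

lemma trilinear_single (u v : VectorL2 L) (j : Fin 2) {f : ScalarL2 L} {φ : Torus L → ℝ}
    (hf : f =ᵐ[volume] φ) : trilinear u v (single j f)
      = ∫ x, (∑ i, coord i u x * wpartial i (coord j v) x) * φ x := by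
  have key : ∀ i, ∀ᵐ x, single j f x i = if i = j then φ x else 0 := by
    intro i
    have h0 := coord_single j f i
    split_ifs at h0 ⊢
    · filter_upwards [coeFn_coord i (single j f), hf] with x h1 h2
      rw [← h1, h0, h2]
    · filter_upwards [coeFn_coord i (single j f),
        Lp.coeFn_zero ℝ 2 (volume : Measure (Torus L))] with x h1 h2
      rw [← h1, h0, h2, Pi.zero_apply]
  apply integral_congr_ae
  filter_upwards [coeFn_coord 0 u, coeFn_coord 1 u, key j, key 0, key 1] with x h1 h2 h5 h3 h4
  rw [Finset.sum_eq_single j]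
  · rw [Finset.sum_mul, Fin.sum_univ_two, Fin.sum_univ_two, h1, h2, h5, if_pos rfl]
  · intro i _ hi
    fin_cases i <;> simp_all
  · simp

/-- The momentum equation for the Fourier coefficients. The test functions are the trigonometric
functions in one component; they are not divergence free, so that the pressure is retained. -/
lemma momentum_fourier {u f : VectorL2 L} {p : ScalarL2 L} {κ ν : ℝ} (hu : VecMemW12 u)
    (h : ∀ φ, VecMemW12 φ → inner ℝ u φ + κ * (ν * gradInner u φ + trilinear u u φ)
      - κ * inner ℝ p (divergence φ) = inner ℝ f φ) (k : Fin 2 → ℤ) (j : Fin 2) :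
    vfc u k j + κ * (ν * (wn L k : ℂ) ^ 2 * vfc u k j + nfc u k j)
      + κ * (Complex.I * wv L k j * fc p k) = vfc f k j := by
  have hL0 := hL.out.ne'
  have hN : Integrable (fun x => ∑ i, coord i u x * wpartial i (coord j u) x) volume :=
    integrable_finsetSum _ fun i _ => integrable_mul _ _
  have hfcN : fc (fun x => ∑ i, coord i u x * wpartial i (coord j u) x) k = nfc u k j := by
    unfold nfc fc
    rw [← Finset.mul_sum,
      ← integral_finsetSum _ fun i _ => integrable_mul_char (integrable_mul _ _) _]
    congr 2
    funext x
    rw [← Finset.sum_mul]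
    push_cast
    rfl
  have hc := h _ (vecMemW12_single (memW12_cosLp k) j)
  have hs := h _ (vecMemW12_single (memW12_sinLp k) j)
  rw [inner_single, inner_single, gradInner_single, divergence_single,
    trilinear_single u u j (coeFn_cosLp k), integral_mul_re_char hN, hfcN] at hc
  rw [inner_single, inner_single, gradInner_single, divergence_single,
    trilinear_single u u j (coeFn_sinLp k), integral_mul_im_char hN, hfcN] at hs
  have hw : ((wn L k : ℝ) : ℂ) ^ 2 = ((wv L k 0 ^ 2 + wv L k 1 ^ 2 : ℝ) : ℂ) := by
    rw [wn_sq_complex]; push_cast; rfl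
  simp only [wpartial_cosLp, wpartial_sinLp, inner_smul_right, inner_cosLp, inner_sinLp,
    fc_wpartial (hu j), Fin.sum_univ_two] at hc hs
  have hv : ∀ u : VectorL2 L, fc (coord j u) k = vfc u k j := fun _ => rfl
  simp only [hv, Complex.mul_re, Complex.mul_im, Complex.I_re, Complex.I_im, Complex.ofReal_re,
    Complex.ofReal_im] at hc hs
  rw [hw]
  apply Complex.ext
  · apply mul_left_cancel₀ hL0
    simp only [Complex.add_re, Complex.mul_re, Complex.mul_im, Complex.I_re, Complex.I_im,
      Complex.ofReal_re, Complex.ofReal_im, Complex.add_im]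
    linear_combination hc
  · apply mul_left_cancel₀ hL0
    simp only [Complex.add_re, Complex.mul_re, Complex.mul_im, Complex.I_re, Complex.I_im,
      Complex.ofReal_re, Complex.ofReal_im, Complex.add_im]
    linear_combination -hs

end

/-! ### Regularity of the stationary problem of one time step -/

section

open ComplexConjugate

variable {L : ℝ}

lemma absSum_sq_le (z : Fin 2 → ℂ) : (absSum z : ℝ) ^ 2 ≤ 2 * ∑ j, ‖z j‖ ^ 2 := by
  simp only [absSum, Fin.sum_univ_two]
  push_cast
  nlinarith [sq_nonneg (‖z 0‖ - ‖z 1‖)]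

lemma tsum_absSum_sq_le {c : (Fin 2 → ℤ) → ℝ≥0} {U : (Fin 2 → ℤ) → Fin 2 → ℂ} {S : ℝ}
    (h : HasSum (fun k => (c k : ℝ) ^ 2 * ∑ j, ‖U k j‖ ^ 2) S) :
    ∑' k, ((c k * absSum (U k) : ℝ≥0) : ℝ≥0∞) ^ 2 ≤ 2 * ENNReal.ofReal S := by
  rw [← h.tsum_eq, ENNReal.ofReal_tsum_of_nonneg (fun _ => by positivity) h.summable,
    ← ENNReal.tsum_mul_left]
  refine ENNReal.tsum_le_tsum fun k => ?_
  rw [← ENNReal.ofReal_coe_nnreal, ← ENNReal.ofReal_pow (by positivity),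
    ← ENNReal.ofReal_ofNat 2, ← ENNReal.ofReal_mul (by norm_num)]
  apply ENNReal.ofReal_le_ofReal
  push_cast
  rw [mul_pow]
  nlinarith [absSum_sq_le (U k), sq_nonneg (c k : ℝ)]

variable [hL : Fact (0 < L)]

/-- The data of one time step: `u` and `p` solve the stationary equation
`u - κ ν Δu + κ (u·∇)u + κ ∇p = f` weakly, for divergence-free `u ∈ W^{1,2}` and `f ∈ L²`. -/
structure IsStep (κ ν : ℝ) (u f : VectorL2 L) (p : ScalarL2 L) : Prop where
  mem_V : u ∈ spaceV L
  mem_H : f ∈ spaceH L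
  eqn : ∀ φ, VecMemW12 φ → inner ℝ u φ + κ * (ν * gradInner u φ + trilinear u u φ)
      - κ * inner ℝ p (divergence φ) = inner ℝ f φ

variable {κ ν : ℝ} {u f : VectorL2 L} {p : ScalarL2 L}

lemma IsStep.fourier (h : IsStep κ ν u f p) (k : Fin 2 → ℤ) (j : Fin 2) :
    vfc u k j + κ * (ν * (wn L k : ℂ) ^ 2 * vfc u k j + nfc u k j)
      + κ * (Complex.I * wv L k j * fc p k) = vfc f k j :=
  momentum_fourier h.mem_V.2 h.eqn k j

lemma IsStep.div (h : IsStep κ ν u f p) (k : Fin 2 → ℤ) : ∑ j, (wv L k j : ℂ) * vfc u k j = 0 :=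
  ((mem_spaceH_iff u).mp h.mem_V.1).2 k

lemma IsStep.zero (h : IsStep κ ν u f p) (j : Fin 2) : vfc u 0 j = 0 :=
  ((mem_spaceH_iff u).mp h.mem_V.1).1 j

/-- The Fourier coefficients of `∇p` are bounded by those of `(u·∇)u`: since `u` and `f` are
divergence free, the product of the momentum equation with the wave vector leaves only these two
terms. -/
lemma IsStep.pressure_le (h : IsStep κ ν u f p) (hκ : 0 < κ) (k : Fin 2 → ℤ) :
    wn L k * ‖fc p k‖₊ ≤ absSum (nfc u k) := by
  by_cases hk : k = 0
  · subst hk; simp [wn_zero]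
  have e0 := h.fourier k 0
  have e1 := h.fourier k 1
  have d1 := h.div k
  have d2 := ((mem_spaceH_iff f).mp h.mem_H).2 k
  rw [Fin.sum_univ_two] at d1 d2
  have hκ' : (κ : ℂ) ≠ 0 := by exact_mod_cast hκ.ne'
  have hw := wn_sq_complex (L := L) k
  have key : (wn L k : ℂ) ^ 2 * (Complex.I * fc p k)
      = -(wv L k 0 * nfc u k 0 + wv L k 1 * nfc u k 1) := by
    apply mul_left_cancel₀ hκ'
    have : (wn L k : ℂ) ^ 2 * (Complex.I * fc p k)
      = ((wv L k 0 : ℂ) ^ 2 + (wv L k 1 : ℂ) ^ 2) * (Complex.I * fc p k) := by rw [← hw]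
    rw [this]
    linear_combination (wv L k 0 : ℂ) * e0 + (wv L k 1 : ℂ) * e1
      - (1 + κ * ν * (wn L k : ℂ) ^ 2) * d1 + d2
  have hn : ∀ i, ‖(wv L k i : ℂ)‖₊ ≤ wn L k := by
    intro i
    rw [← NNReal.coe_le_coe]
    simpa using abs_wv_le (L := L) k i
  have h2 : wn L k * (wn L k * ‖fc p k‖₊) ≤ wn L k * absSum (nfc u k) := by
    calc wn L k * (wn L k * ‖fc p k‖₊) = ‖(wn L k : ℂ) ^ 2 * (Complex.I * fc p k)‖₊ := by
          rw [nnnorm_mul, nnnorm_mul, Complex.nnnorm_I, one_mul, nnnorm_pow, ← mul_assoc, ← sq]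
          congr 2
          rw [← NNReal.coe_inj]
          simp
      _ ≤ wn L k * absSum (nfc u k) := by
          rw [key, nnnorm_neg]
          refine (nnnorm_add_le _ _).trans ?_
          simp only [absSum]
          rw [nnnorm_mul, nnnorm_mul, Fin.sum_univ_two, mul_add]
          gcongr
          · exact hn 0
          · exact hn 1
  exact le_of_mul_le_mul_left h2 (wn_pos hk)

/-- The momentum equation bounds `Δu` by the right-hand side and the nonlinear term. -/
lemma IsStep.visc_le (h : IsStep κ ν u f p) (hκ : 0 < κ) (hν : 0 < ν) (k : Fin 2 → ℤ) :
    ((wn L k ^ 2 * absSum (vfc u k) : ℝ≥0) : ℝ)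
      ≤ (κ * ν)⁻¹ * absSum (vfc f k) + 4 / ν * absSum (nfc u k) := by
  have h1 : ∀ j, κ * ν * (wn L k : ℝ) ^ 2 * ‖vfc u k j‖
      ≤ ‖vfc f k j‖ + κ * (‖nfc u k j‖ + absSum (nfc u k)) := by
    intro j
    have e := h.fourier k j
    have e2 : ((1 + κ * ν * (wn L k : ℝ) ^ 2 : ℝ) : ℂ) * vfc u k j
        = vfc f k j - κ * (nfc u k j + Complex.I * wv L k j * fc p k) := by
      push_cast
      linear_combination e
    have e3 := congrArg norm e2
    rw [norm_mul, Complex.norm_real, Real.norm_of_nonneg (by positivity)] at e3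
    have e4 : ‖(κ : ℂ) * (nfc u k j + Complex.I * wv L k j * fc p k)‖
        ≤ κ * (‖nfc u k j‖ + absSum (nfc u k)) := by
      rw [norm_mul, Complex.norm_real, Real.norm_of_nonneg hκ.le]
      gcongr
      refine (norm_add_le _ _).trans ?_
      gcongr
      have e5 := h.pressure_le hκ k
      rw [← NNReal.coe_le_coe] at e5
      push_cast at e5
      rw [norm_mul, norm_mul, Complex.norm_I, one_mul, Complex.norm_real, Real.norm_eq_abs]
      exact (mul_le_mul_of_nonneg_right (abs_wv_le k j) (norm_nonneg _)).trans e5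
    have e6 := norm_sub_le (vfc f k j) (κ * (nfc u k j + Complex.I * wv L k j * fc p k))
    nlinarith [norm_nonneg (vfc u k j)]
  have h2 := add_le_add (h1 0) (h1 1)
  have h3 : (absSum (vfc u k) : ℝ) = ‖vfc u k 0‖ + ‖vfc u k 1‖ := by
    simp [absSum]
  have h4 : (absSum (vfc f k) : ℝ) = ‖vfc f k 0‖ + ‖vfc f k 1‖ := by
    simp [absSum]
  have h5 : (absSum (nfc u k) : ℝ) = ‖nfc u k 0‖ + ‖nfc u k 1‖ := by
    simp [absSum]
  have h6 : κ * ν * ((wn L k : ℝ) ^ 2 * absSum (vfc u k))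
      ≤ absSum (vfc f k) + κ * (4 * absSum (nfc u k)) := by
    have : (0 : ℝ) ≤ κ * absSum (nfc u k) := by positivity
    have h7 : κ * ‖nfc u k 0‖ + κ * ‖nfc u k 1‖ = κ * absSum (nfc u k) := by rw [h5]; ring
    rw [h3]
    linarith
  have hκν : 0 < κ * ν := mul_pos hκ hν
  push_cast
  refine le_of_mul_le_mul_left (h6.trans (le_of_eq ?_)) hκν
  field_simp

lemma absSum_nfc_le (hu : VecMemW12 u) (k : Fin 2 → ℤ) :
    (absSum (nfc u k) : ℝ≥0∞) ≤ (2 * L.toNNReal⁻¹ : ℝ≥0) * conv (fun m => absSum (vfc u m))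
      (fun m => wn L m * absSum (vfc u m)) k := by
  simp only [absSum]
  rw [Fin.sum_univ_two]
  push_cast
  refine (add_le_add (enorm_nfc_le hu k 0) (enorm_nfc_le hu k 1)).trans (le_of_eq ?_)
  rw [mul_assoc, two_mul]
  rfl

lemma tsum_gradient_ne_top (hu : VecMemW12 u) :
    ∑' k, ((wn L k * absSum (vfc u k) : ℝ≥0) : ℝ≥0∞) ^ 2 ≠ ∞ := by
  have h := hasSum_sum (s := Finset.univ) fun j (_ : j ∈ Finset.univ) => hasSum_gradNormSq (hu j)
  simp only [← Finset.mul_sum] at h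
  exact ne_top_of_le_ne_top (ENNReal.mul_ne_top (by simp) ENNReal.ofReal_ne_top)
    (tsum_absSum_sq_le (c := wn L) (U := vfc u) h)

/-- Regularity for the stationary problem: the Fourier series of `u` converges absolutely. -/
lemma IsStep.tsum_absSum_ne_top (h : IsStep κ ν u f p) (hκ : 0 < κ) (hν : 0 < ν) :
    ∑' k, (absSum (vfc u k) : ℝ≥0∞) ≠ ∞ := by
  have hf : ∑' k, (((κ * ν).toNNReal⁻¹ * absSum (vfc f k) : ℝ≥0) : ℝ≥0∞) ^ 2 ≠ ∞ := by
    have h1 := (hasSum_vfc_sq f).mul_left (((κ * ν).toNNReal⁻¹ : ℝ≥0) : ℝ) |>.mul_left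
      (((κ * ν).toNNReal⁻¹ : ℝ≥0) : ℝ)
    simp only [← mul_assoc, ← sq] at h1
    exact ne_top_of_le_ne_top (ENNReal.mul_ne_top (by simp) ENNReal.ofReal_ne_top)
      (tsum_absSum_sq_le (c := fun _ => (κ * ν).toNNReal⁻¹) (U := vfc f) h1)
  refine tsum_ne_top_of_le_conv (v := fun k => (wn L k)⁻¹)
    (β := fun m => wn L m * absSum (vfc u m))
    (C := (4 / ν).toNNReal * (2 * L.toNNReal⁻¹)) tsum_inv_wn_ne_top
    (tsum_gradient_ne_top h.mem_V.2) hf (fun k => ?_) (fun k => ?_)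
  · by_cases hk : k = 0
    · subst hk
      simp [absSum, h.zero]
    · rw [← mul_assoc, inv_wn_mul hk, one_mul]
  · by_cases hk : k = 0
    · subst hk
      simp [absSum, h.zero]
    have h1 : wn L k ^ 2 * absSum (vfc u k)
        ≤ (4 / ν).toNNReal * absSum (nfc u k) + (κ * ν).toNNReal⁻¹ * absSum (vfc f k) := by
      rw [← NNReal.coe_le_coe]
      refine (h.visc_le hκ hν k).trans (le_of_eq ?_)
      push_cast
      rw [Real.coe_toNNReal _ (by positivity), Real.coe_toNNReal _ (by positivity)]
      ring
    have h2 : absSum (vfc u k) = (wn L k)⁻¹ ^ 2 * (wn L k ^ 2 * absSum (vfc u k)) := by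
      rw [← mul_assoc, ← mul_pow, inv_wn_mul hk, one_pow, one_mul]
    calc (absSum (vfc u k) : ℝ≥0∞)
        ≤ ((((wn L k)⁻¹ ^ 2 * ((4 / ν).toNNReal * absSum (nfc u k)
          + (κ * ν).toNNReal⁻¹ * absSum (vfc f k)) : ℝ≥0)) : ℝ≥0∞) := by
          rw [ENNReal.coe_le_coe]
          conv_lhs => rw [h2]
          gcongr
      _ = (((wn L k)⁻¹ : ℝ≥0) : ℝ≥0∞) ^ 2 * ((4 / ν).toNNReal * (absSum (nfc u k) : ℝ≥0∞)
          + (((κ * ν).toNNReal⁻¹ * absSum (vfc f k) : ℝ≥0) : ℝ≥0∞)) := by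
          simp only [ENNReal.coe_mul, ENNReal.coe_add, ENNReal.coe_pow]
      _ ≤ _ := by
          rw [ENNReal.coe_mul (4 / ν).toNNReal, mul_assoc (((4 / ν).toNNReal : ℝ≥0) : ℝ≥0∞)]
          gcongr
          exact absSum_nfc_le h.mem_V.2 k

lemma IsStep.tsum_absSum_nfc_sq_le (h : IsStep κ ν u f p) :
    ∑' k, (absSum (nfc u k) : ℝ≥0∞) ^ 2
      ≤ ((2 * L.toNNReal⁻¹ : ℝ≥0) : ℝ≥0∞) ^ 2 * ((∑' k, (absSum (vfc u k) : ℝ≥0∞)) ^ 2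
        * ∑' k, ((wn L k * absSum (vfc u k) : ℝ≥0) : ℝ≥0∞) ^ 2) := by
  calc ∑' k, (absSum (nfc u k) : ℝ≥0∞) ^ 2
      ≤ ∑' k, ((2 * L.toNNReal⁻¹ : ℝ≥0) : ℝ≥0∞) ^ 2 * (conv (fun m => absSum (vfc u m))
      (fun m => wn L m * absSum (vfc u m)) k) ^ 2 := by
        refine ENNReal.tsum_le_tsum fun k => ?_
        rw [← mul_pow]
        gcongr
        exact absSum_nfc_le h.mem_V.2 k
    _ ≤ _ := by
        rw [ENNReal.tsum_mul_left]
        gcongr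
        exact tsum_conv_sq_le _ _

lemma IsStep.tsum_laplacian_ne_top (h : IsStep κ ν u f p) (hκ : 0 < κ) (hν : 0 < ν) :
    ∑' k, ((wn L k ^ 2 * absSum (vfc u k) : ℝ≥0) : ℝ≥0∞) ^ 2 ≠ ∞ := by
  have hN := ne_top_of_le_ne_top (ENNReal.mul_ne_top (ENNReal.pow_ne_top ENNReal.coe_ne_top)
    (ENNReal.mul_ne_top (ENNReal.pow_ne_top (h.tsum_absSum_ne_top hκ hν))
      (tsum_gradient_ne_top h.mem_V.2))) h.tsum_absSum_nfc_sq_le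
  have hf : ∑' k, (absSum (vfc f k) : ℝ≥0∞) ^ 2 ≠ ∞ := by
    have h1 := hasSum_vfc_sq f
    have h2 := tsum_absSum_sq_le (c := fun _ => 1) (U := vfc f) (by simpa using h1)
    simp only [one_mul] at h2
    exact ne_top_of_le_ne_top (ENNReal.mul_ne_top (by simp) ENNReal.ofReal_ne_top) h2
  obtain ⟨A, hA⟩ : ∃ A : ℝ≥0, (A : ℝ) = 2 * ((κ * ν)⁻¹) ^ 2 :=
    ⟨Real.toNNReal _, Real.coe_toNNReal _ (by positivity)⟩
  obtain ⟨B, hB⟩ : ∃ B : ℝ≥0, (B : ℝ) = 2 * (4 / ν) ^ 2 :=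
    ⟨Real.toNNReal _, Real.coe_toNNReal _ (by positivity)⟩
  refine ne_top_of_le_ne_top (ENNReal.add_ne_top.mpr
    ⟨ENNReal.mul_ne_top (ENNReal.coe_ne_top (r := A)) hf,
      ENNReal.mul_ne_top (ENNReal.coe_ne_top (r := B)) hN⟩) ?_
  rw [← ENNReal.tsum_mul_left, ← ENNReal.tsum_mul_left, ← ENNReal.tsum_add]
  refine ENNReal.tsum_le_tsum fun k => ?_
  have h1 := h.visc_le hκ hν k
  have h2 : (wn L k ^ 2 * absSum (vfc u k)) ^ 2
      ≤ A * absSum (vfc f k) ^ 2 + B * absSum (nfc u k) ^ 2 := by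
    rw [← NNReal.coe_le_coe, NNReal.coe_pow]
    refine (pow_le_pow_left₀ (NNReal.coe_nonneg _) h1 2).trans ?_
    push_cast
    rw [hA, hB]
    nlinarith [sq_nonneg ((κ * ν)⁻¹ * absSum (vfc f k) - 4 / ν * absSum (nfc u k))]
  exact_mod_cast h2

end

/-! ### The enstrophy balance and the pressure estimate of one time step -/

section

open ComplexConjugate

variable {L : ℝ} [hL : Fact (0 < L)]
variable {κ ν : ℝ} {u f g : VectorL2 L} {p : ScalarL2 L}

/-- `g = Au = -Δu`, expressed in Fourier variables. -/
def IsStokes (u g : VectorL2 L) : Prop := ∀ k j, vfc g k j = (wn L k : ℂ) ^ 2 * vfc u k j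

/-- The solution of the stationary problem is in `W^{2,2}`. -/
lemma IsStep.exists_isStokes (h : IsStep κ ν u f p) (hκ : 0 < κ) (hν : 0 < ν) :
    ∃ g, IsStokes u g := by
  refine exists_vfc_eq (fun j => ?_) (fun k j => ?_)
  · have h1 := h.tsum_laplacian_ne_top hκ hν
    have h2 : Summable fun k => (wn L k ^ 2 * absSum (vfc u k)) ^ 2 := by
      rw [← ENNReal.tsum_coe_ne_top_iff_summable]
      simpa only [ENNReal.coe_pow] using h1
    rw [← NNReal.summable_coe] at h2
    refine Summable.of_nonneg_of_le (fun _ => by positivity) (fun k => ?_) h2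
    push_cast
    rw [norm_mul, norm_pow]
    gcongr
    · simp
    · exact_mod_cast norm_le_absSum (vfc u k) j
  · rw [wn_neg, vfc_neg]
    simp

lemma IsStokes.mem_spaceH (hg : IsStokes u g) (hu : u ∈ spaceH L) : g ∈ spaceH L := by
  rw [mem_spaceH_iff] at hu ⊢
  refine ⟨fun j => by rw [hg, hu.1, mul_zero], fun k => ?_⟩
  have : ∀ j, (wv L k j : ℂ) * vfc g k j = (wn L k : ℂ) ^ 2 * (wv L k j * vfc u k j) := by
    intro j; rw [hg]; ring
  simp only [this, ← Finset.mul_sum, hu.2, mul_zero]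

lemma IsStokes.hasSum_inner (hg : IsStokes u g) :
    HasSum (fun k => (wn L k : ℝ) ^ 2 * ∑ j, ‖vfc u k j‖ ^ 2) (inner ℝ u g) := by
  have h := hasSum_vfc_inner u g
  have e : ∀ k, ∑ j, vfc u k j * conj (vfc g k j)
      = (((wn L k : ℝ) ^ 2 * ∑ j, ‖vfc u k j‖ ^ 2 : ℝ) : ℂ) := by
    intro k
    push_cast
    rw [Finset.mul_sum]
    refine Finset.sum_congr rfl fun j _ => ?_
    rw [hg, map_mul, mul_left_comm, Complex.mul_conj, Complex.normSq_eq_norm_sq]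
    simp
  simp only [e] at h
  exact_mod_cast h

lemma IsStokes.hasSum_sq (hg : IsStokes u g) :
    HasSum (fun k => ((wn L k ^ 2 : ℝ≥0) : ℝ) ^ 2 * ∑ j, ‖vfc u k j‖ ^ 2) (‖g‖ ^ 2) := by
  refine (hasSum_vfc_sq g).congr_fun fun k => ?_
  rw [Finset.mul_sum]
  refine Finset.sum_congr rfl fun j _ => ?_
  rw [hg, norm_mul, mul_pow]
  simp

/-- The nonlinear term is orthogonal to `Au` in `L²`. -/
lemma IsStep.hasSum_nonlinear (h : IsStep κ ν u f p) (hκ : 0 < κ) (hν : 0 < ν) :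
    HasSum (fun k => ∑ j, nfc u k j * ((wn L k : ℂ) ^ 2 * conj (vfc u k j))) 0 := by
  have hLC : (L : ℂ) ≠ 0 := by exact_mod_cast hL.out.ne'
  have hs : Summable (tri L (vfc u)) := summable_tri (h.tsum_absSum_ne_top hκ hν)
    (tsum_gradient_ne_top h.mem_V.2) (h.tsum_laplacian_ne_top hκ hν)
  have H := hs.hasSum
  rw [tsum_tri_eq_zero h.zero h.div hs] at H
  -- the sum over `m` and `n` becomes a sum over `m` and `k = m + n`
  let e : (Fin 2 → ℤ) × (Fin 2 → ℤ) ≃ (Fin 2 → ℤ) × (Fin 2 → ℤ) :=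
    { toFun := fun q => (q.2, q.1 - q.2)
      invFun := fun q => (q.1 + q.2, q.1)
      left_inv := fun q => by simp
      right_inv := fun q => by simp }
  have H1 := e.hasSum_iff.mpr H
  have H2 := H1.prod_fiberwise (g := fun k => ∑ j, (-Complex.I * (L * nfc u k j))
      * ((wn L k : ℂ) ^ 2 * conj (vfc u k j))) (fun k => by
    simp only [Function.comp, e, Equiv.coe_fn_mk, tri, add_sub_cancel]
    refine hasSum_sum fun j _ => ?_
    rw [vfc_neg]
    refine HasSum.mul_right _ (((hasSum_nfc h.mem_V.2 k j).mul_left (-Complex.I)).congr_fun ?_)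
    intro m
    rw [Finset.mul_sum]
    refine Finset.sum_congr rfl fun i _ => ?_
    linear_combination (vfc u m i * (wv L (k - m) i * vfc u (k - m) j)) * Complex.I_mul_I)
  have H3 := H2.mul_left (Complex.I / L)
  rw [mul_zero] at H3
  refine H3.congr_fun fun k => ?_
  rw [Finset.mul_sum]
  refine Finset.sum_congr rfl fun j _ => ?_
  field_simp
  linear_combination (nfc u k j * (wn L k : ℂ) ^ 2 * conj (vfc u k j)) * Complex.I_sq

/-- The enstrophy balance of one time step: the equation is multiplied by `Au`, which removes the
pressure because `Au` is divergence free, and the nonlinear term by `IsStep.hasSum_nonlinear`. -/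
lemma IsStep.enstrophy (h : IsStep κ ν u f p) (hκ : 0 < κ) (hν : 0 < ν) (hg : IsStokes u g) :
    inner ℝ (u - f) g + κ * ν * ‖g‖ ^ 2 = 0 := by
  have h1 := hasSum_vfc_inner (u - f) g
  have h2 := (h.hasSum_nonlinear hκ hν).mul_left (κ : ℂ)
  have h3 : HasSum (fun k => ((κ * ν * ∑ j, ‖vfc g k j‖ ^ 2 : ℝ) : ℂ))
      ((κ * ν * ‖g‖ ^ 2 : ℝ) : ℂ) := by
    exact_mod_cast (hasSum_vfc_sq g).mul_left (κ * ν)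
  have h4 := (h1.add h3).add h2
  have e : ∀ k, ∑ j, vfc (u - f) k j * conj (vfc g k j)
      + ((κ * ν * ∑ j, ‖vfc g k j‖ ^ 2 : ℝ) : ℂ)
      + κ * ∑ j, nfc u k j * ((wn L k : ℂ) ^ 2 * conj (vfc u k j)) = 0 := by
    intro k
    have d := congrArg conj (h.div k)
    rw [Fin.sum_univ_two] at d
    simp only [map_add, map_mul, Complex.conj_ofReal, map_zero] at d
    have hn : ∀ j, ((‖vfc g k j‖ : ℂ)) ^ 2
        = (wn L k : ℂ) ^ 2 * vfc u k j * ((wn L k : ℂ) ^ 2 * conj (vfc u k j)) := by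
      intro j
      have hc : conj (vfc g k j) = (wn L k : ℂ) ^ 2 * conj (vfc u k j) := by
        rw [hg k j]; simp
      rw [← hg k j, ← hc, Complex.mul_conj, Complex.normSq_eq_norm_sq]
      push_cast
      rfl
    have hc : ∀ j, conj (vfc g k j) = (wn L k : ℂ) ^ 2 * conj (vfc u k j) := by
      intro j
      rw [hg k j]; simp
    push_cast
    simp only [Fin.sum_univ_two, hn, hc, vfc_sub]
    linear_combination ((wn L k : ℂ) ^ 2 * conj (vfc u k 0)) * h.fourier k 0
      + ((wn L k : ℂ) ^ 2 * conj (vfc u k 1)) * h.fourier k 1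
      - (κ * Complex.I * fc p k * (wn L k : ℂ) ^ 2) * d
  simp only [e, mul_zero, add_zero] at h4
  exact_mod_cast h4.unique hasSum_zero

/-- The pressure is in `W^{1,2}`: its gradient is bounded by `(u·∇)u`, whose Fourier coefficients
are the convolution of a summable and a square summable sequence. -/
lemma IsStep.memW12_pressure (h : IsStep κ ν u f p) (hκ : 0 < κ) (hν : 0 < ν) : MemW12 p := by
  have hN := ne_top_of_le_ne_top (ENNReal.mul_ne_top (ENNReal.pow_ne_top ENNReal.coe_ne_top)
    (ENNReal.mul_ne_top (ENNReal.pow_ne_top (h.tsum_absSum_ne_top hκ hν))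
      (tsum_gradient_ne_top h.mem_V.2))) h.tsum_absSum_nfc_sq_le
  have h2 : Summable fun k => (absSum (nfc u k)) ^ 2 := by
    rw [← ENNReal.tsum_coe_ne_top_iff_summable]
    simpa only [ENNReal.coe_pow] using hN
  rw [← NNReal.summable_coe] at h2
  refine memW12_of_summable (Summable.of_nonneg_of_le (fun _ => by positivity) (fun k => ?_) h2)
  have := h.pressure_le hκ k
  rw [← mul_pow]
  exact_mod_cast pow_le_pow_left₀ (by positivity) this 2

variable (L) in
/-- The constant in the estimate of the pressure gradient. -/
def pressConst : ℝ≥0∞ :=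
  256 * (L.toNNReal⁻¹ : ℝ≥0) ^ 4 * (∑' k, (((wn L k)⁻¹ : ℝ≥0) : ℝ≥0∞) ^ 3) ^ 2

lemma pressConst_ne_top : pressConst L ≠ ∞ :=
  ENNReal.mul_ne_top (ENNReal.mul_ne_top (by simp) (ENNReal.pow_ne_top ENNReal.coe_ne_top))
    (ENNReal.pow_ne_top tsum_inv_wn_ne_top)

/-- The pressure estimate `|∇p|² ≤ C |∇u|³ |Au|`, squared. It follows from `|∇p| ≤ |(u·∇)u|`,
from the bound of `|(u·∇)u|` by the product of the `ℓ¹` norm of the coefficients of `u` and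
`|∇u|`, and from Agmon's inequality. -/
lemma IsStep.gradNormSq_sq_le (h : IsStep κ ν u f p) (hκ : 0 < κ) (hν : 0 < ν)
    (hg : IsStokes u g) : ENNReal.ofReal (gradNormSq p) ^ 2
      ≤ pressConst L * (ENNReal.ofReal (inner ℝ u g) ^ 3 * ENNReal.ofReal (‖g‖ ^ 2)) := by
  have h1 : ENNReal.ofReal (gradNormSq p) ≤ ∑' k, (absSum (nfc u k) : ℝ≥0∞) ^ 2 := by
    have hs := hasSum_gradNormSq (h.memW12_pressure hκ hν)
    rw [← hs.tsum_eq, ENNReal.ofReal_tsum_of_nonneg (fun _ => by positivity) hs.summable]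
    refine ENNReal.tsum_le_tsum fun k => ?_
    have e := h.pressure_le hκ k
    rw [← mul_pow, ← ENNReal.ofReal_coe_nnreal, ← ENNReal.ofReal_pow (by positivity)]
    apply ENNReal.ofReal_le_ofReal
    exact_mod_cast pow_le_pow_left₀ (by positivity) e 2
  have h0 : absSum (vfc u 0) = 0 := by simp [absSum, h.zero]
  have hA := agmon_fourier (L := L) (α := fun k => absSum (vfc u k)) h0
  have hb := tsum_absSum_sq_le hg.hasSum_inner
  have hc := tsum_absSum_sq_le hg.hasSum_sq
  set a := ∑' k, (absSum (vfc u k) : ℝ≥0∞) with ha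
  set b := ∑' k, ((wn L k * absSum (vfc u k) : ℝ≥0) : ℝ≥0∞) ^ 2
  set c := ∑' k, ((wn L k ^ 2 * absSum (vfc u k) : ℝ≥0) : ℝ≥0∞) ^ 2
  set V := ∑' k, (((wn L k)⁻¹ : ℝ≥0) : ℝ≥0∞) ^ 3 with hV
  calc ENNReal.ofReal (gradNormSq p) ^ 2
      ≤ (((2 * L.toNNReal⁻¹ : ℝ≥0) : ℝ≥0∞) ^ 2 * (a ^ 2 * b)) ^ 2 := by
        gcongr
        exact h1.trans h.tsum_absSum_nfc_sq_le
    _ = ((2 * L.toNNReal⁻¹ : ℝ≥0) : ℝ≥0∞) ^ 4 * (a ^ 4 * b ^ 2) := by ring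
    _ ≤ ((2 * L.toNNReal⁻¹ : ℝ≥0) : ℝ≥0∞) ^ 4 * ((V ^ 2 * (b * c)) * b ^ 2) := by gcongr
    _ = ((2 * L.toNNReal⁻¹ : ℝ≥0) : ℝ≥0∞) ^ 4 * V ^ 2 * (b ^ 3 * c) := by ring
    _ ≤ ((2 * L.toNNReal⁻¹ : ℝ≥0) : ℝ≥0∞) ^ 4 * V ^ 2
        * ((2 * ENNReal.ofReal (inner ℝ u g)) ^ 3 * (2 * ENNReal.ofReal (‖g‖ ^ 2))) := by gcongr
    _ = _ := by
        rw [pressConst, ENNReal.coe_mul]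
        push_cast
        ring

end

/-! ### Expansions in an eigenbasis of the Stokes operator -/

section

open ComplexConjugate

variable {L : ℝ} [hL : Fact (0 < L)]
variable {κ ν : ℝ} {u v f g : VectorL2 L} {p : ScalarL2 L} {ζ : ℕ → VectorL2 L} {lam : ℕ → ℝ}

lemma fc_laplacian {f : ScalarL2 L} (hf : MemW22 f) (k : Fin 2 → ℤ) :
    fc (laplacian f) k = -((wn L k : ℂ) ^ 2 * fc f k) := by
  rw [laplacian, Fin.sum_univ_two, fc_add, fc_wpartial (hf.2 0), fc_wpartial (hf.2 1),
    fc_wpartial hf.1, fc_wpartial hf.1]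
  have hw := wn_sq_complex (L := L) k
  have : (wn L k : ℂ) ^ 2 * fc f k = ((wv L k 0 : ℂ) ^ 2 + (wv L k 1 : ℂ) ^ 2) * fc f k := by
    rw [← hw]
  rw [this]
  linear_combination ((wv L k 0 : ℂ) ^ 2 + (wv L k 1 : ℂ) ^ 2) * fc f k * Complex.I_sq

namespace IsStokesEigenbasis

lemma wn_sq_mul_vfc (hζ : IsStokesEigenbasis ζ lam) (n : ℕ) (k : Fin 2 → ℤ) (j : Fin 2) :
    (wn L k : ℂ) ^ 2 * vfc (ζ n) k j = lam n * vfc (ζ n) k j := by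
  have h1 := fc_laplacian ((hζ.mem_domA n).2 j) k
  have h2 : laplacian (coord j (ζ n)) = (-lam n) • coord j (ζ n) := by
    rw [neg_smul, ← hζ.eigen n j, neg_neg]
  rw [h2, fc_smul] at h1
  push_cast at h1
  simp only [vfc]
  linear_combination h1

/-- The coefficients of `Au` with respect to the eigenbasis. -/
lemma inner_stokes (hζ : IsStokesEigenbasis ζ lam) (hg : IsStokes u g) (n : ℕ) :
    inner ℝ g (ζ n) = lam n * inner ℝ u (ζ n) := by
  have h1 := hasSum_vfc_inner g (ζ n)
  have h2 := (hasSum_vfc_inner u (ζ n)).mul_left (lam n : ℂ)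
  have e : ∀ k, ∑ j, vfc g k j * conj (vfc (ζ n) k j)
      = lam n * ∑ j, vfc u k j * conj (vfc (ζ n) k j) := by
    intro k
    rw [Finset.mul_sum]
    refine Finset.sum_congr rfl fun j _ => ?_
    have h3 := congrArg conj (hζ.wn_sq_mul_vfc n k j)
    simp only [map_mul, map_pow, Complex.conj_ofReal] at h3
    rw [hg k j]
    linear_combination vfc u k j * h3
  simp only [e] at h1
  have := h1.unique h2
  exact_mod_cast this

/-- Fields in `H` are the sums of their expansions in the eigenbasis. -/
lemma hasSum_expansion (hζ : IsStokesEigenbasis ζ lam) (hv : v ∈ spaceH L) :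
    HasSum (fun n => inner ℝ (ζ n) v • ζ n) v := by
  have hs : Summable fun n => inner ℝ (ζ n) v • ζ n := by
    have h1 := hζ.orthonormal.orthogonalFamily.summable_iff_norm_sq_summable
      (fun n => inner ℝ (ζ n) v)
    simp only [LinearIsometry.toSpanSingleton_apply] at h1
    refine h1.mpr ?_
    have := hζ.orthonormal.inner_products_summable v
    exact this
  have H := hs.hasSum
  set v' := ∑' n, inner ℝ (ζ n) v • ζ n with hv'
  have ho : ∀ n, inner ℝ (ζ n) (v - v') = 0 := by
    intro n
    have h1 : HasSum (fun m => inner ℝ (ζ n) (inner ℝ (ζ m) v • ζ m)) (inner ℝ (ζ n) v') :=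
      (innerSL ℝ (ζ n)).hasSum H
    have h2 : ∀ m, m ≠ n → inner ℝ (ζ n) (inner ℝ (ζ m) v • ζ m) = 0 := by
      intro m hm
      rw [inner_smul_right, hζ.orthonormal.2 (Ne.symm hm), mul_zero]
    have h3 := h1.unique (hasSum_single n h2)
    rw [inner_sub_right, h3, inner_smul_right, real_inner_self_eq_norm_sq, hζ.orthonormal.1 n]
    ring
  let S : Submodule ℝ (VectorL2 L) := (Submodule.span ℝ (Set.range ζ)).topologicalClosure
  have hS : ∀ w, w ∈ S ↔ w ∈ spaceH L := by
    intro w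
    rw [← hζ.dense]
    exact Iff.rfl
  have hSζ : ∀ n, ζ n ∈ S := fun n =>
    Submodule.le_topologicalClosure _ (Submodule.subset_span ⟨n, rfl⟩)
  have hSv' : v' ∈ S := by
    refine (Submodule.isClosed_topologicalClosure _).mem_of_tendsto H
      (Filter.Eventually.of_forall fun s => ?_)
    exact Submodule.sum_mem _ fun n _ => Submodule.smul_mem _ _ (hSζ n)
  have hd : v - v' ∈ S := Submodule.sub_mem _ ((hS v).mpr hv) hSv'
  have hperp : v - v' ∈ Sᗮ := by
    rw [Submodule.orthogonal_closure]
    rw [Submodule.mem_orthogonal]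
    intro w hw
    refine Submodule.span_induction ?_ ?_ ?_ ?_ hw
    · rintro _ ⟨n, rfl⟩
      exact ho n
    · exact inner_zero_left _
    · intro x y _ _ hx hy
      rw [inner_add_left, hx, hy, add_zero]
    · intro c x _ hx
      rw [inner_smul_left, hx, mul_zero]
  have h0 : v - v' = 0 := by
    have := Submodule.inner_right_of_mem_orthogonal hd hperp
    exact inner_self_eq_zero.mp this
  rw [← sub_eq_zero.mp h0] at H
  exact H

lemma hasSum_inner (hζ : IsStokesEigenbasis ζ lam) (hv : v ∈ spaceH L) (w : VectorL2 L) :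
    HasSum (fun n => inner ℝ v (ζ n) * inner ℝ w (ζ n)) (inner ℝ v w) := by
  have h1 := (innerSL ℝ w).hasSum (hζ.hasSum_expansion hv)
  rw [real_inner_comm]
  refine h1.congr_fun fun n => ?_
  simp [real_inner_comm]

lemma gradInner_zeta (hζ : IsStokesEigenbasis ζ lam) (hu : VecMemW12 u) (n : ℕ) :
    gradInner u (ζ n) = lam n * inner ℝ u (ζ n) := by
  have hz : VecMemW12 (ζ n) := fun j => ((hζ.mem_domA n).2 j).1
  have h1 : HasSum (fun k => ∑ j, ∑ i, fc (wpartial i (coord j u)) k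
      * conj (fc (wpartial i (coord j (ζ n))) k)) ((gradInner u (ζ n) : ℝ) : ℂ) := by
    rw [gradInner]
    push_cast
    exact hasSum_sum fun j _ => hasSum_sum fun i _ => hasSum_fc_inner _ _
  have h2 := (hasSum_vfc_inner u (ζ n)).mul_left (lam n : ℂ)
  have e : ∀ k, ∑ j, ∑ i, fc (wpartial i (coord j u)) k
      * conj (fc (wpartial i (coord j (ζ n))) k)
      = lam n * ∑ j, vfc u k j * conj (vfc (ζ n) k j) := by
    intro k
    rw [Finset.mul_sum]
    refine Finset.sum_congr rfl fun j _ => ?_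
    have h3 := congrArg conj (hζ.wn_sq_mul_vfc n k j)
    simp only [map_mul, map_pow, map_add, Complex.conj_ofReal, wn_sq_complex] at h3
    simp only [Fin.sum_univ_two, fc_wpartial (hu j), fc_wpartial (hz j), map_mul,
      Complex.conj_ofReal, Complex.conj_I]
    simp only [← vfc.eq_1]
    linear_combination vfc u k j * h3 - ((wv L k 0 : ℂ) ^ 2 + (wv L k 1 : ℂ) ^ 2)
      * vfc u k j * conj (vfc (ζ n) k j) * Complex.I_sq
  simp only [e] at h1
  have := h1.unique h2
  exact_mod_cast this

/-- Bessel's inequality for the gradients of the eigenfunctions. -/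
lemma sum_le_gradInner (hζ : IsStokesEigenbasis ζ lam) (hu : VecMemW12 u) (s : Finset ℕ) :
    ∑ n ∈ s, lam n * inner ℝ u (ζ n) ^ 2 ≤ gradInner u u := by
  set c : ℕ → ℝ := fun n => inner ℝ u (ζ n) with hc
  set A := ∑ n ∈ s, lam n * c n ^ 2 with hA
  let G : Fin 2 → Fin 2 → ScalarL2 L := fun j i => ∑ n ∈ s, c n • wpartial i (coord j (ζ n))
  have e1 : ∑ j, ∑ i, inner ℝ (wpartial i (coord j u)) (G j i) = A := by
    have : ∀ j i, inner ℝ (wpartial i (coord j u)) (G j i)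
        = ∑ n ∈ s, c n * inner ℝ (wpartial i (coord j u)) (wpartial i (coord j (ζ n))) := by
      intro j i
      simp only [G, inner_sum, inner_smul_right]
    simp only [this]
    have h2 : ∀ j : Fin 2, ∑ i : Fin 2, ∑ n ∈ s,
        c n * inner ℝ (wpartial i (coord j u)) (wpartial i (coord j (ζ n)))
        = ∑ n ∈ s, ∑ i : Fin 2,
        c n * inner ℝ (wpartial i (coord j u)) (wpartial i (coord j (ζ n))) := fun j =>
      Finset.sum_comm
    simp only [h2]
    rw [Finset.sum_comm]
    refine Finset.sum_congr rfl fun n _ => ?_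
    simp only [← Finset.mul_sum]
    change c n * gradInner u (ζ n) = _
    rw [hζ.gradInner_zeta hu]
    ring
  have e2 : ∑ j, ∑ i, inner ℝ (G j i) (G j i) = A := by
    have : ∀ j i, inner ℝ (G j i) (G j i) = ∑ n ∈ s, ∑ m ∈ s, c n * (c m *
        inner ℝ (wpartial i (coord j (ζ n))) (wpartial i (coord j (ζ m)))) := by
      intro j i
      simp only [G, sum_inner, inner_sum, real_inner_smul_left, inner_smul_right, Finset.mul_sum]
      rw [Finset.sum_comm]
      refine Finset.sum_congr rfl fun n _ => Finset.sum_congr rfl fun m _ => ?_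
      ring
    simp only [this]
    have h2 : ∀ j : Fin 2, ∑ i : Fin 2, ∑ n ∈ s, ∑ m ∈ s, c n * (c m *
        inner ℝ (wpartial i (coord j (ζ n))) (wpartial i (coord j (ζ m))))
        = ∑ n ∈ s, ∑ m ∈ s, ∑ i : Fin 2, c n * (c m *
        inner ℝ (wpartial i (coord j (ζ n))) (wpartial i (coord j (ζ m)))) := by
      intro j
      rw [Finset.sum_comm]
      exact Finset.sum_congr rfl fun n _ => Finset.sum_comm
    simp only [h2]
    rw [Finset.sum_comm]
    refine Finset.sum_congr rfl fun n hn => ?_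
    rw [Finset.sum_comm]
    simp only [← Finset.mul_sum]
    have h3 : ∀ m, ∑ j, ∑ i, inner ℝ (wpartial i (coord j (ζ n))) (wpartial i (coord j (ζ m)))
        = lam m * if n = m then 1 else 0 := by
      intro m
      change gradInner (ζ n) (ζ m) = _
      rw [hζ.gradInner_zeta (fun j => ((hζ.mem_domA n).2 j).1),
        orthonormal_iff_ite.mp hζ.orthonormal]
    simp only [h3, mul_ite, mul_one, mul_zero]
    rw [Finset.sum_ite_eq s n, if_pos hn]
    ring
  have e3 : 0 ≤ ∑ j, ∑ i,
      inner ℝ (wpartial i (coord j u) - G j i) (wpartial i (coord j u) - G j i) :=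
    Finset.sum_nonneg fun j _ => Finset.sum_nonneg fun i _ => real_inner_self_nonneg
  simp only [real_inner_sub_sub_self, Finset.sum_add_distrib, Finset.sum_sub_distrib,
    ← Finset.mul_sum, e1, e2] at e3
  change 0 ≤ gradInner u u - 2 * A + A at e3
  linarith

end IsStokesEigenbasis

end

/-! ### Enstrophy and palinstrophy in terms of the eigenbasis -/

section

variable {L : ℝ} [hL : Fact (0 < L)]
variable {κ ν : ℝ} {u v f g : VectorL2 L} {p : ScalarL2 L} {ζ : ℕ → VectorL2 L} {lam : ℕ → ℝ}

/-- The enstrophy `|A^{1/2} u|²` in terms of the coefficients with respect to an eigenbasis, with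
the value `∞` outside the domain of `A^{1/2}`. -/
def ens (ζ : ℕ → VectorL2 L) (lam : ℕ → ℝ) (u : VectorL2 L) : ℝ≥0∞ :=
  ∑' n, ENNReal.ofReal (lam n * inner ℝ u (ζ n) ^ 2)

/-- The palinstrophy `|A u|²` in terms of the coefficients with respect to an eigenbasis, with the
value `∞` outside the domain of `A`. -/
def pal (ζ : ℕ → VectorL2 L) (lam : ℕ → ℝ) (u : VectorL2 L) : ℝ≥0∞ :=
  ∑' n, ENNReal.ofReal ((lam n * inner ℝ u (ζ n)) ^ 2)

namespace IsStokesEigenbasis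

lemma mem_spaceH_iff_mem_closure (hζ : IsStokesEigenbasis ζ lam) (w : VectorL2 L) :
    w ∈ spaceH L ↔ w ∈ (Submodule.span ℝ (Set.range ζ)).topologicalClosure := by
  rw [← hζ.dense]
  exact Iff.rfl

lemma add_mem (hζ : IsStokesEigenbasis ζ lam) (hu : u ∈ spaceH L) (hv : v ∈ spaceH L) :
    u + v ∈ spaceH L := by
  rw [hζ.mem_spaceH_iff_mem_closure] at *
  exact Submodule.add_mem _ hu hv

lemma sub_mem (hζ : IsStokesEigenbasis ζ lam) (hu : u ∈ spaceH L) (hv : v ∈ spaceH L) :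
    u - v ∈ spaceH L := by
  rw [hζ.mem_spaceH_iff_mem_closure] at *
  exact Submodule.sub_mem _ hu hv

lemma wiener_mem {Ω : Type*} (hζ : IsStokesEigenbasis ζ lam) (qs : ℕ → ℝ)
    (β : ℕ → ℝ≥0 → Ω → ℝ) (t : ℝ≥0) (ω : Ω) : wiener ζ qs β t ω ∈ spaceH L := by
  rw [hζ.mem_spaceH_iff_mem_closure]
  have hmem : ∀ n, (Real.sqrt (qs n) * β n t ω) • ζ n
      ∈ (Submodule.span ℝ (Set.range ζ)).topologicalClosure := fun n =>
    Submodule.smul_mem _ _ (Submodule.le_topologicalClosure _ (Submodule.subset_span ⟨n, rfl⟩))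
  by_cases hs : Summable fun n => (Real.sqrt (qs n) * β n t ω) • ζ n
  · exact (Submodule.isClosed_topologicalClosure _).mem_of_tendsto hs.hasSum
      (Filter.Eventually.of_forall fun s => Submodule.sum_mem _ fun n _ => hmem n)
  · rw [wiener, tsum_eq_zero_of_not_summable hs]
    exact Submodule.zero_mem _

lemma inner_wiener {Ω : Type*} (hζ : IsStokesEigenbasis ζ lam) {qs : ℕ → ℝ}
    (hq : ∀ j, 0 ≤ qs j) {β : ℕ → ℝ≥0 → Ω → ℝ} {t : ℝ≥0} {ω : Ω}
    (hs : Summable fun j => qs j * β j t ω ^ 2) (n : ℕ) :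
    inner ℝ (wiener ζ qs β t ω) (ζ n) = Real.sqrt (qs n) * β n t ω := by
  have h1 : Summable fun n => (Real.sqrt (qs n) * β n t ω) • ζ n := by
    have h1 := hζ.orthonormal.orthogonalFamily.summable_iff_norm_sq_summable
      (fun n => Real.sqrt (qs n) * β n t ω)
    simp only [LinearIsometry.toSpanSingleton_apply] at h1
    refine h1.mpr (hs.congr fun j => ?_)
    rw [Real.norm_eq_abs, sq_abs, mul_pow, Real.sq_sqrt (hq j)]
  have h2 := (innerSL ℝ (ζ n)).hasSum h1.hasSum
  rw [real_inner_comm]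
  refine h2.unique ?_
  have h3 : (innerSL ℝ (ζ n)) ((Real.sqrt (qs n) * β n t ω) • ζ n)
      = Real.sqrt (qs n) * β n t ω := by
    rw [innerSL_apply_apply, inner_smul_right, real_inner_self_eq_norm_sq, hζ.orthonormal.1 n]
    ring
  have h4 := hasSum_single (f := fun m => (innerSL ℝ (ζ n)) ((Real.sqrt (qs m) * β m t ω) • ζ m)) n
    (fun m hm => by
      rw [innerSL_apply_apply, inner_smul_right, hζ.orthonormal.2 (Ne.symm hm), mul_zero])
  rw [h3] at h4
  exact h4

lemma ens_le (hζ : IsStokesEigenbasis ζ lam) (hu : VecMemW12 u) :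
    ens ζ lam u ≤ ENNReal.ofReal (gradInner u u) := by
  rw [ens, ENNReal.tsum_eq_iSup_sum]
  refine iSup_le fun s => ?_
  rw [← ENNReal.ofReal_sum_of_nonneg fun n _ => mul_nonneg (hζ.pos n).le (sq_nonneg _)]
  exact ENNReal.ofReal_le_ofReal (hζ.sum_le_gradInner hu s)

lemma hasSum_ens (hζ : IsStokesEigenbasis ζ lam) (hu : u ∈ spaceH L) (hg : IsStokes u g) :
    HasSum (fun n => lam n * inner ℝ u (ζ n) ^ 2) (inner ℝ u g) := by
  refine (hζ.hasSum_inner hu g).congr_fun fun n => ?_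
  rw [hζ.inner_stokes hg]
  ring

lemma hasSum_pal (hζ : IsStokesEigenbasis ζ lam) (hu : u ∈ spaceH L) (hg : IsStokes u g) :
    HasSum (fun n => (lam n * inner ℝ u (ζ n)) ^ 2) (‖g‖ ^ 2) := by
  rw [← real_inner_self_eq_norm_sq]
  refine (hζ.hasSum_inner (hg.mem_spaceH hu) g).congr_fun fun n => ?_
  rw [hζ.inner_stokes hg]
  ring

lemma ens_eq (hζ : IsStokesEigenbasis ζ lam) (hu : u ∈ spaceH L) (hg : IsStokes u g) :
    ens ζ lam u = ENNReal.ofReal (inner ℝ u g) := by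
  have h := hζ.hasSum_ens hu hg
  rw [ens, ← ENNReal.ofReal_tsum_of_nonneg (fun n => mul_nonneg (hζ.pos n).le (sq_nonneg _))
    h.summable, h.tsum_eq]

lemma pal_eq (hζ : IsStokesEigenbasis ζ lam) (hu : u ∈ spaceH L) (hg : IsStokes u g) :
    pal ζ lam u = ENNReal.ofReal (‖g‖ ^ 2) := by
  have h := hζ.hasSum_pal hu hg
  rw [pal, ← ENNReal.ofReal_tsum_of_nonneg (fun n => sq_nonneg _) h.summable, h.tsum_eq]

end IsStokesEigenbasis

/-- The pathwise enstrophy inequality for one time step. The inequality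
`2 (A(u - f), u) ≥ (Au, u) - (Af, f)` is used coefficientwise, since `f` need not be smooth. -/
lemma IsStep.ens_add_pal_le (h : IsStep κ ν u f p) (hζ : IsStokesEigenbasis ζ lam) (hκ : 0 < κ)
    (hν : 0 < ν) : ens ζ lam u + ENNReal.ofReal (2 * κ * ν) * pal ζ lam u ≤ ens ζ lam f := by
  obtain ⟨g, hg⟩ := h.exists_isStokes hκ hν
  by_cases hf : ens ζ lam f = ∞
  · rw [hf]; exact le_top
  have hpos : ∀ w : VectorL2 L, ∀ n, 0 ≤ lam n * inner ℝ w (ζ n) ^ 2 := fun w n =>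
    mul_nonneg (hζ.pos n).le (sq_nonneg _)
  have hsf : Summable fun n => lam n * inner ℝ f (ζ n) ^ 2 := by
    have h2 := ENNReal.summable_toReal hf
    refine h2.congr fun n => ?_
    rw [ENNReal.toReal_ofReal (hpos f n)]
  have e1 := hζ.hasSum_ens h.mem_V.1 hg
  have e2 := hζ.hasSum_pal h.mem_V.1 hg
  have e3 := hζ.hasSum_inner (hg.mem_spaceH h.mem_V.1) (u - f)
  have e4 := h.enstrophy hκ hν hg
  rw [real_inner_comm] at e3
  have e5 : inner ℝ u g + 2 * κ * ν * ‖g‖ ^ 2 ≤ ∑' n, lam n * inner ℝ f (ζ n) ^ 2 := by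
    have h1 : 2 * inner ℝ (u - f) g - inner ℝ u g ≥ - ∑' n, lam n * inner ℝ f (ζ n) ^ 2 := by
      rw [ge_iff_le, ← tsum_neg]
      refine hasSum_le (fun n => ?_) hsf.neg.hasSum ((e3.mul_left 2).sub e1)
      rw [hζ.inner_stokes hg, inner_sub_left]
      have := mul_nonneg (hζ.pos n).le (sq_nonneg (inner ℝ u (ζ n) - inner ℝ f (ζ n)))
      nlinarith
    nlinarith
  have h0 : 0 ≤ inner ℝ u g := e1.nonneg (hpos u)
  rw [hζ.ens_eq h.mem_V.1 hg, hζ.pal_eq h.mem_V.1 hg, ← ENNReal.ofReal_mul (by positivity),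
    ← ENNReal.ofReal_add h0 (by positivity), ens, ← ENNReal.ofReal_tsum_of_nonneg (hpos f) hsf]
  exact ENNReal.ofReal_le_ofReal e5

/-- The pathwise pressure estimate for one time step, with the product `|∇u|³ |Au|` split by
Young's inequality. -/
lemma IsStep.gradNormSq_le (h : IsStep κ ν u f p) (hζ : IsStokesEigenbasis ζ lam) (hκ : 0 < κ)
    (hν : 0 < ν) : ENNReal.ofReal (gradNormSq p)
      ≤ (1 + pressConst L) * (ens ζ lam u ^ 3 + pal ζ lam u) := by
  obtain ⟨g, hg⟩ := h.exists_isStokes hκ hν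
  have h1 := h.gradNormSq_sq_le hκ hν hg
  rw [← hζ.ens_eq h.mem_V.1 hg, ← hζ.pal_eq h.mem_V.1 hg] at h1
  refine (ENNReal.pow_le_pow_left_iff two_ne_zero).mp ?_
  calc ENNReal.ofReal (gradNormSq p) ^ 2
      ≤ pressConst L * (ens ζ lam u ^ 3 * pal ζ lam u) := h1
    _ ≤ (1 + pressConst L) ^ 2 * ((ens ζ lam u ^ 3 + pal ζ lam u)
        * (ens ζ lam u ^ 3 + pal ζ lam u)) := by
        gcongr
        · calc pressConst L ≤ 1 + pressConst L := le_add_self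
            _ ≤ (1 + pressConst L) ^ 2 := le_self_pow₀ le_self_add (by norm_num)
        · exact le_self_add
        · exact le_add_self
    _ = _ := by ring

end

/-! ### Moment inequalities -/

section

/-- **Jensen's inequality** for a finite weighted sum. -/
lemma rpow_sum_mul_le {ι : Type*} (s : Finset ι) {p : ℝ} (hp : 1 ≤ p) (w f : ι → ℝ≥0∞) :
    (∑ i ∈ s, w i * f i) ^ p ≤ (∑ i ∈ s, w i) ^ (p - 1) * ∑ i ∈ s, w i * f i ^ p := by
  have hp0 : 0 < p := by linarith
  have h := ENNReal.rpow_le_rpow (ENNReal.inner_le_weight_mul_Lp_of_nonneg s hp w f) hp0.le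
  rwa [ENNReal.mul_rpow_of_nonneg _ _ hp0.le, ← ENNReal.rpow_mul, ← ENNReal.rpow_mul,
    inv_mul_cancel₀ hp0.ne', ENNReal.rpow_one, sub_mul, inv_mul_cancel₀ hp0.ne', one_mul] at h

/-- **Jensen's inequality** for a weighted series. -/
lemma pow_tsum_mul_le {ι : Type*} (j : ℕ) (w f : ι → ℝ≥0∞) :
    (∑' i, w i * f i) ^ (j + 1) ≤ (∑' i, w i) ^ j * ∑' i, w i * f i ^ (j + 1) := by
  have hj : ((j + 1 : ℕ) : ℝ) ≠ 0 := by positivity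
  set R := (∑' i, w i) ^ j * ∑' i, w i * f i ^ (j + 1) with hR
  have h : ∑' i, w i * f i ≤ R ^ ((((j + 1 : ℕ) : ℝ))⁻¹) := by
    rw [ENNReal.tsum_eq_iSup_sum]
    refine iSup_le fun s => ?_
    rw [ENNReal.le_rpow_inv_iff (by positivity)]
    refine (rpow_sum_mul_le s (by simp) w f).trans ?_
    have : ((j + 1 : ℕ) : ℝ) - 1 = j := by push_cast; ring
    rw [this]
    simp only [ENNReal.rpow_natCast]
    rw [hR]
    gcongr
    · exact ENNReal.sum_le_tsum s
    · exact ENNReal.sum_le_tsum s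
  calc (∑' i, w i * f i) ^ (j + 1) ≤ (R ^ ((((j + 1 : ℕ) : ℝ))⁻¹)) ^ (j + 1) := by gcongr
    _ = R := by
      rw [← ENNReal.rpow_natCast, ← ENNReal.rpow_mul, inv_mul_cancel₀ hj, ENNReal.rpow_one]

/-- The moment of order `2j` of the standard normal distribution. -/
def gaussMoment (j : ℕ) : ℝ≥0∞ := ∫⁻ x, ENNReal.ofReal (x ^ 2) ^ j ∂gaussianReal 0 1

lemma gaussMoment_ne_top (j : ℕ) : gaussMoment j ≠ ∞ := by
  by_cases hj : j = 0
  · subst hj; simp [gaussMoment]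
  have h := (memLp_id_gaussianReal (μ := 0) (v := 1) (((2 * j : ℕ) : ℝ≥0))).eLpNorm_lt_top
  have h2 := lintegral_rpow_enorm_lt_top_of_eLpNorm_lt_top (p := ((2 * j : ℕ) : ℝ≥0))
    (by simp [hj]) ENNReal.coe_ne_top h
  refine ne_of_eq_of_ne ?_ h2.ne
  refine lintegral_congr fun x => ?_
  simp only [ENNReal.coe_natCast, ENNReal.toReal_natCast, ENNReal.rpow_natCast, id]
  rw [pow_mul, ← ofReal_norm, ← ENNReal.ofReal_pow (norm_nonneg _), Real.norm_eq_abs,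
    sq_abs]

lemma lintegral_sq_pow_gaussianReal (κ : ℝ≥0) (j : ℕ) :
    ∫⁻ x, ENNReal.ofReal (x ^ 2) ^ j ∂gaussianReal 0 κ = (κ : ℝ≥0∞) ^ j * gaussMoment j := by
  have h := gaussianReal_map_const_mul (μ := 0) (v := 1) (NNReal.sqrt κ)
  have h2 : gaussianReal 0 κ = (gaussianReal 0 1).map (fun x => (NNReal.sqrt κ : ℝ) * x) := by
    rw [h]
    congr 1
    · simp
    · rw [mul_one]
      apply NNReal.eq
      simp
  rw [h2, lintegral_map (by fun_prop) (by fun_prop), gaussMoment,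
    ← lintegral_const_mul _ (by fun_prop)]
  refine lintegral_congr fun x => ?_
  rw [mul_pow, ENNReal.ofReal_mul (by positivity), mul_pow]
  congr 2
  rw [← NNReal.coe_pow, NNReal.sq_sqrt, ENNReal.ofReal_coe_nnreal]

/-- A first order expansion of `(1 + z)^p` with a global remainder. For `|p z| ≤ 1` it comes from
the expansion of `exp (p z)`; for `p z ≤ -1` the term with `p ^ 2` absorbs `1 + p z`; and for
`p z ≥ 1` one has `1 + z ≤ (p + 1) z`. -/
lemma one_add_rpow_le {p z : ℝ} {n : ℕ} (hp : 2 ≤ p) (hn : p ≤ 2 * n) (hz : -1 ≤ z) :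
    (1 + z) ^ p ≤ 1 + p * z + (p ^ 2 + (p + 1) ^ p) * (z ^ 2 + z ^ (2 * n)) := by
  have hz0 : 0 ≤ 1 + z := by linarith
  have hp0 : 0 ≤ p := by linarith
  have hC : 0 ≤ (p + 1) ^ p := Real.rpow_nonneg (by linarith) _
  have hzn : 0 ≤ z ^ (2 * n) := by rw [pow_mul]; positivity
  have hsq : (p * z) ^ 2 ≤ (p ^ 2 + (p + 1) ^ p) * (z ^ 2 + z ^ (2 * n)) := by
    have h1 : 0 ≤ (p + 1) ^ p * (z ^ 2 + z ^ (2 * n)) := by positivity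
    have h2 : 0 ≤ p ^ 2 * z ^ (2 * n) := by positivity
    nlinarith
  have hexp : (1 + z) ^ p ≤ Real.exp (p * z) := by
    have h1 : 1 + z ≤ Real.exp z := by linarith [Real.add_one_le_exp z]
    calc (1 + z) ^ p ≤ Real.exp z ^ p := Real.rpow_le_rpow hz0 h1 hp0
      _ = Real.exp (p * z) := by rw [← Real.exp_mul, mul_comm]
  rcases le_or_gt (p * z) (-1) with h1 | h1
  · have h2 : z ≤ 0 := by
      by_contra h3
      nlinarith
    have h3 : (1 + z) ^ p ≤ 1 := Real.rpow_le_one hz0 (by linarith) hp0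
    nlinarith
  rcases le_or_gt (p * z) 1 with h2 | h2
  · have h3 := Real.abs_exp_sub_one_sub_id_le (abs_le.mpr ⟨h1.le, h2⟩)
    have h4 := (abs_le.mp h3).2
    linarith
  · have hzpos : 0 < z := by
      by_contra h3
      nlinarith
    have h3 : (1 + z) ^ p ≤ (p + 1) ^ p * z ^ p := by
      rw [← Real.mul_rpow (by linarith) hzpos.le]
      exact Real.rpow_le_rpow hz0 (by nlinarith) hp0
    have h4 : z ^ p ≤ z ^ 2 + z ^ (2 * n) := by
      rcases le_total z 1 with h5 | h5
      · have := Real.rpow_le_rpow_of_exponent_ge hzpos h5 hp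
        rw [Real.rpow_ofNat] at this
        linarith
      · have := Real.rpow_le_rpow_of_exponent_le h5 (y := p) (z := ((2 * n : ℕ) : ℝ))
          (by push_cast; exact hn)
        rw [Real.rpow_natCast] at this
        nlinarith [sq_nonneg z]
    have h5 := mul_le_mul_of_nonneg_left h4 hC
    have h6 : 0 ≤ p ^ 2 * (z ^ 2 + z ^ (2 * n)) := by positivity
    nlinarith

/-- The constant in the expansion of the `p`-th power of the enstrophy increment. -/
def incrConst (p : ℝ) (n : ℕ) : ℝ := p + (p ^ 2 + (p + 1) ^ p) * (9 + 9 ^ n)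

lemma incrConst_nonneg {p : ℝ} (hp : 2 ≤ p) (n : ℕ) : 0 ≤ incrConst p n := by
  have : 0 ≤ (p + 1) ^ p := Real.rpow_nonneg (by linarith) _
  unfold incrConst
  positivity

/-- The `p`-th power of the enstrophy after a noise increment, where `x` is the enstrophy before
it, `2 m` the mixed term and `h` the energy of the noise: `one_add_rpow_le` is applied to
`z = (2 m + h) / x`, for which `|z| ≤ 2 √h + h`. -/
lemma add_rpow_le {p x m h : ℝ} {n : ℕ} (hp : 2 ≤ p) (hn : p ≤ 2 * n) (hx : 1 ≤ x) (hh : 0 ≤ h)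
    (hm : |m| ≤ x * √h) (h0 : 0 ≤ x + 2 * m + h) :
    (x + 2 * m + h) ^ p
      ≤ x ^ p + 2 * p * (x ^ (p - 1) * m) + incrConst p n * (x ^ p * (h + h ^ (2 * n))) := by
  have hx0 : 0 < x := by linarith
  have hn1 : 1 ≤ n := by
    by_contra h1
    have : n = 0 := by omega
    subst this
    norm_num at hn
    linarith
  set z := (2 * m + h) / x with hz
  have hxz : x * (1 + z) = x + 2 * m + h := by
    rw [hz]; field_simp; ring
  have hz1 : -1 ≤ z := by
    have : 0 ≤ x * (1 + z) := by rw [hxz]; exact h0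
    have := nonneg_of_mul_nonneg_right this hx0
    linarith
  set s := √h with hs
  have hs0 : 0 ≤ s := Real.sqrt_nonneg _
  have hsh : s ^ 2 = h := Real.sq_sqrt hh
  have hzabs : |z| ≤ 2 * s + s ^ 2 := by
    rw [hz, abs_div, abs_of_pos hx0, div_le_iff₀ hx0]
    calc |2 * m + h| ≤ |2 * m| + |h| := abs_add_le _ _
      _ = 2 * |m| + h := by rw [abs_mul, abs_of_nonneg hh]; norm_num
      _ ≤ 2 * (x * s) + x * h := by
        have := le_mul_of_one_le_left hh hx
        linarith
      _ = _ := by rw [hsh]; ring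
  have hzz : z ^ 2 + z ^ (2 * n) ≤ (9 + 9 ^ n) * (h + h ^ (2 * n)) := by
    have e1 : z ^ 2 ≤ (2 * s + s ^ 2) ^ 2 := by
      rw [← sq_abs z]; gcongr
    have e2 : z ^ (2 * n) ≤ ((2 * s + s ^ 2) ^ 2) ^ n := by
      rw [pow_mul]; gcongr
    have hp9 : (0 : ℝ) ≤ 9 ^ n := by positivity
    have hhn : 0 ≤ h ^ (2 * n) := by positivity
    rcases le_total s 1 with h1 | h1
    · have e3 : (2 * s + s ^ 2) ^ 2 ≤ 9 * h := by
        rw [← hsh]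
        calc (2 * s + s ^ 2) ^ 2 ≤ (3 * s) ^ 2 := by gcongr; nlinarith
          _ = 9 * s ^ 2 := by ring
      have hh1 : h ≤ 1 := by rw [← hsh]; nlinarith
      have e4 : ((2 * s + s ^ 2) ^ 2) ^ n ≤ 9 ^ n * h := by
        calc ((2 * s + s ^ 2) ^ 2) ^ n ≤ (9 * h) ^ n := by gcongr
          _ = 9 ^ n * h ^ n := mul_pow _ _ _
          _ ≤ 9 ^ n * h := by
            gcongr
            exact pow_le_of_le_one hh hh1 (by omega)
      nlinarith [mul_nonneg hp9 hhn]
    · have e3 : (2 * s + s ^ 2) ^ 2 ≤ 9 * h ^ 2 := by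
        rw [← hsh]
        calc (2 * s + s ^ 2) ^ 2 ≤ (3 * s ^ 2) ^ 2 := by gcongr; nlinarith
          _ = 9 * (s ^ 2) ^ 2 := by ring
      have hh1 : 1 ≤ h := by rw [← hsh]; nlinarith
      have e5 : h ^ 2 ≤ h ^ (2 * n) := pow_le_pow_right₀ hh1 (by omega)
      have e4 : ((2 * s + s ^ 2) ^ 2) ^ n ≤ 9 ^ n * h ^ (2 * n) := by
        calc ((2 * s + s ^ 2) ^ 2) ^ n ≤ (9 * h ^ 2) ^ n := by gcongr
          _ = 9 ^ n * h ^ (2 * n) := by rw [mul_pow, ← pow_mul]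
      nlinarith [mul_nonneg hp9 hh]
  have hC : 0 ≤ p ^ 2 + (p + 1) ^ p := by
    have : 0 ≤ (p + 1) ^ p := Real.rpow_nonneg (by linarith) _
    positivity
  have hxp : 0 ≤ x ^ p := Real.rpow_nonneg hx0.le _
  have hxp1 : x ^ p = x ^ (p - 1) * x := by
    rw [← Real.rpow_add_one hx0.ne']; simp
  have hh2 : 0 ≤ h ^ (2 * n) := by positivity
  have key := one_add_rpow_le hp hn hz1
  rw [← hxz, Real.mul_rpow hx0.le (by linarith)]
  calc x ^ p * (1 + z) ^ p
      ≤ x ^ p * (1 + p * z + (p ^ 2 + (p + 1) ^ p) * ((9 + 9 ^ n) * (h + h ^ (2 * n)))) := by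
        gcongr
        exact key.trans (by gcongr)
    _ = x ^ p + p * (x ^ (p - 1) * (2 * m + h))
        + x ^ p * ((p ^ 2 + (p + 1) ^ p) * ((9 + 9 ^ n) * (h + h ^ (2 * n)))) := by
        have : x ^ p * z = x ^ (p - 1) * (2 * m + h) := by
          rw [hxp1, hz]; field_simp
        rw [mul_add, mul_add, mul_one, ← this]; ring
    _ ≤ _ := by
        have h1 : x ^ (p - 1) ≤ x ^ p := Real.rpow_le_rpow_of_exponent_le hx (by linarith)
        have h2 : p * (x ^ (p - 1) * h) ≤ p * (x ^ p * (h + h ^ (2 * n))) := by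
          have : 0 ≤ x ^ (p - 1) := Real.rpow_nonneg hx0.le _
          gcongr
          linarith
        unfold incrConst
        linarith

end

/-! ### The enstrophy moments under one noise increment -/

section

/-- The noise energy `∑ λₙ qₙ zₙ²` of a sequence `z` of increments. -/
def noiseEnergy (lam qs : ℕ → ℝ) (z : ℕ → ℝ) : ℝ≥0∞ :=
  ∑' n, ENNReal.ofReal (lam n * qs n) * ENNReal.ofReal (z n ^ 2)

lemma measurable_noiseEnergy (lam qs : ℕ → ℝ) : Measurable (noiseEnergy lam qs) := by
  unfold noiseEnergy
  fun_prop

/-- The moments of the noise energy of Gaussian increments of variance `κ`, by Jensen's inequality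
with the weights `λₙ qₙ`. -/
lemma lintegral_noiseEnergy_pow_le {Ω : Type*} {mΩ : MeasurableSpace Ω} {P : Measure Ω}
    {lam qs : ℕ → ℝ} {K₀ : ℝ} (hnn : ∀ n, 0 ≤ lam n * qs n)
    (hK : HasSum (fun n => lam n * qs n) K₀) {κ : ℝ≥0} {Z : Ω → ℕ → ℝ} (hZ : Measurable Z)
    (hlaw : ∀ n, P.map (fun ω => Z ω n) = gaussianReal 0 κ) (j : ℕ) :
    ∫⁻ ω, noiseEnergy lam qs (Z ω) ^ (j + 1) ∂P
      ≤ ENNReal.ofReal K₀ ^ (j + 1) * ((κ : ℝ≥0∞) ^ (j + 1) * gaussMoment (j + 1)) := by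
  have hw : ∑' n, ENNReal.ofReal (lam n * qs n) = ENNReal.ofReal K₀ := by
    rw [← ENNReal.ofReal_tsum_of_nonneg hnn hK.summable, hK.tsum_eq]
  have hZn : ∀ n, Measurable fun ω => Z ω n := fun n => (measurable_pi_apply n).comp hZ
  calc ∫⁻ ω, noiseEnergy lam qs (Z ω) ^ (j + 1) ∂P
      ≤ ∫⁻ ω, ENNReal.ofReal K₀ ^ j
          * ∑' n, ENNReal.ofReal (lam n * qs n) * ENNReal.ofReal (Z ω n ^ 2) ^ (j + 1) ∂P := by
        refine lintegral_mono fun ω => ?_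
        rw [← hw]
        exact pow_tsum_mul_le j _ _
    _ = ENNReal.ofReal K₀ ^ j * ∑' n, ENNReal.ofReal (lam n * qs n)
          * ∫⁻ ω, ENNReal.ofReal (Z ω n ^ 2) ^ (j + 1) ∂P := by
        rw [lintegral_const_mul _ (by fun_prop), lintegral_tsum (by fun_prop)]
        congr 1
        refine tsum_congr fun n => ?_
        rw [lintegral_const_mul _ (by fun_prop)]
    _ = _ := by
        have : ∀ n, ∫⁻ ω, ENNReal.ofReal (Z ω n ^ 2) ^ (j + 1) ∂P
            = (κ : ℝ≥0∞) ^ (j + 1) * gaussMoment (j + 1) := by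
          intro n
          rw [← lintegral_sq_pow_gaussianReal, ← hlaw n, lintegral_map (by fun_prop) (hZn n)]
        simp only [this]
        rw [ENNReal.tsum_mul_right, hw, pow_succ]
        ring

/-- The pathwise algebra of one noise increment: the enstrophy of `c + √q z` is
`∑ λ c² + 2 m + h` with `|m| ≤ √(∑ λ c²) √h`. -/
lemma exists_increment {lam qs c z : ℕ → ℝ} (hlam : ∀ n, 0 ≤ lam n) (hq : ∀ n, 0 ≤ qs n)
    (hc : ∑' n, ENNReal.ofReal (lam n * c n ^ 2) ≠ ∞) (hz : noiseEnergy lam qs z ≠ ∞) :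
    Summable (fun n => |lam n * c n * (√(qs n) * z n)|) ∧
    (∑' n, |lam n * c n * (√(qs n) * z n)|) ^ 2
      ≤ (∑' n, ENNReal.ofReal (lam n * c n ^ 2)).toReal * (noiseEnergy lam qs z).toReal ∧
    ∑' n, ENNReal.ofReal (lam n * (c n + √(qs n) * z n) ^ 2)
      = ENNReal.ofReal ((∑' n, ENNReal.ofReal (lam n * c n ^ 2)).toReal
        + 2 * (∑' n, lam n * c n * (√(qs n) * z n)) + (noiseEnergy lam qs z).toReal) ∧
    0 ≤ (∑' n, ENNReal.ofReal (lam n * c n ^ 2)).toReal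
        + 2 * (∑' n, lam n * c n * (√(qs n) * z n)) + (noiseEnergy lam qs z).toReal := by
  have n1 : ∀ n, 0 ≤ lam n * c n ^ 2 := fun n => mul_nonneg (hlam n) (sq_nonneg _)
  have n2 : ∀ n, 0 ≤ lam n * qs n * z n ^ 2 := fun n =>
    mul_nonneg (mul_nonneg (hlam n) (hq n)) (sq_nonneg _)
  have eN : noiseEnergy lam qs z = ∑' n, ENNReal.ofReal (lam n * qs n * z n ^ 2) := by
    unfold noiseEnergy
    exact tsum_congr fun n => (ENNReal.ofReal_mul (mul_nonneg (hlam n) (hq n))).symm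
  rw [eN] at hz ⊢
  have s1 : Summable fun n => lam n * c n ^ 2 :=
    (ENNReal.summable_toReal hc).congr fun n => ENNReal.toReal_ofReal (n1 n)
  have s2 : Summable fun n => lam n * qs n * z n ^ 2 :=
    (ENNReal.summable_toReal hz).congr fun n => ENNReal.toReal_ofReal (n2 n)
  have t1 : (∑' n, ENNReal.ofReal (lam n * c n ^ 2)).toReal = ∑' n, lam n * c n ^ 2 := by
    rw [← ENNReal.ofReal_tsum_of_nonneg n1 s1, ENNReal.toReal_ofReal (tsum_nonneg n1)]
  have t2 : (∑' n, ENNReal.ofReal (lam n * qs n * z n ^ 2)).toReal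
      = ∑' n, lam n * qs n * z n ^ 2 := by
    rw [← ENNReal.ofReal_tsum_of_nonneg n2 s2, ENNReal.toReal_ofReal (tsum_nonneg n2)]
  have esq : ∀ n, lam n * (√(qs n) * z n) ^ 2 = lam n * qs n * z n ^ 2 := fun n => by
    rw [mul_pow, Real.sq_sqrt (hq n)]; ring
  have s3 : Summable fun n => |lam n * c n * (√(qs n) * z n)| := by
    refine Summable.of_nonneg_of_le (fun n => abs_nonneg _) (fun n => ?_) (s1.add s2)
    rw [← esq, abs_le]
    constructor
    · nlinarith [mul_nonneg (hlam n) (sq_nonneg (c n + √(qs n) * z n)), n1 n,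
        mul_nonneg (hlam n) (sq_nonneg (√(qs n) * z n))]
    · nlinarith [mul_nonneg (hlam n) (sq_nonneg (c n - √(qs n) * z n)), n1 n,
        mul_nonneg (hlam n) (sq_nonneg (√(qs n) * z n))]
  have s4 : Summable fun n => lam n * c n * (√(qs n) * z n) := s3.of_abs
  have hsum : HasSum (fun n => lam n * (c n + √(qs n) * z n) ^ 2)
      (∑' n, lam n * c n ^ 2 + 2 * (∑' n, lam n * c n * (√(qs n) * z n))
        + ∑' n, lam n * qs n * z n ^ 2) := by
    refine ((s1.hasSum.add (s4.hasSum.mul_left 2)).add s2.hasSum).congr_fun fun n => ?_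
    rw [← esq]; ring
  have n3 : ∀ n, 0 ≤ lam n * (c n + √(qs n) * z n) ^ 2 := fun n =>
    mul_nonneg (hlam n) (sq_nonneg _)
  rw [t1, t2]
  refine ⟨s3, ?_, ?_, hsum.nonneg n3⟩
  · have h := sq_tsum_mul_le (fun n => (√(lam n) * |c n|).toNNReal)
      (fun n => (√(lam n) * |√(qs n) * z n|).toNNReal)
    have e1 : ∀ n, (((√(lam n) * |c n|).toNNReal : ℝ≥0∞)
        * ((√(lam n) * |√(qs n) * z n|).toNNReal : ℝ≥0∞))
        = ENNReal.ofReal |lam n * c n * (√(qs n) * z n)| := by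
      intro n
      change ENNReal.ofReal _ * ENNReal.ofReal _ = _
      rw [← ENNReal.ofReal_mul (by positivity), abs_mul (lam n * c n),
        abs_mul (lam n), abs_of_nonneg (hlam n)]
      congr 1
      have := Real.mul_self_sqrt (hlam n)
      linear_combination |c n| * |√(qs n) * z n| * this
    have e2 : ∀ n, ((√(lam n) * |c n|).toNNReal : ℝ≥0∞) ^ 2 = ENNReal.ofReal (lam n * c n ^ 2) := by
      intro n
      change ENNReal.ofReal _ ^ 2 = _
      rw [← ENNReal.ofReal_pow (by positivity), mul_pow, sq_abs, Real.sq_sqrt (hlam n)]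
    have e3 : ∀ n, ((√(lam n) * |√(qs n) * z n|).toNNReal : ℝ≥0∞) ^ 2
        = ENNReal.ofReal (lam n * qs n * z n ^ 2) := by
      intro n
      change ENNReal.ofReal _ ^ 2 = _
      rw [← ENNReal.ofReal_pow (by positivity), mul_pow, sq_abs, Real.sq_sqrt (hlam n), esq]
    simp only [e1, e2, e3] at h
    rw [← ENNReal.ofReal_tsum_of_nonneg (fun n => abs_nonneg _) s3,
      ← ENNReal.ofReal_tsum_of_nonneg n1 s1, ← ENNReal.ofReal_tsum_of_nonneg n2 s2,
      ← ENNReal.ofReal_pow (tsum_nonneg fun n => abs_nonneg _),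
      ← ENNReal.ofReal_mul (tsum_nonneg n1)] at h
    exact (ENNReal.ofReal_le_ofReal_iff (mul_nonneg (tsum_nonneg n1) (tsum_nonneg n2))).mp h
  · rw [← ENNReal.ofReal_tsum_of_nonneg n3 hsum.summable, hsum.tsum_eq]

/-- The growth rate of the moments of the enstrophy. -/
def growthConst (p : ℝ) (n : ℕ) (K₀ : ℝ) (T : ℝ≥0) : ℝ≥0∞ :=
  ENNReal.ofReal (incrConst p (n + 1)) * (ENNReal.ofReal K₀ * gaussMoment 1
    + ENNReal.ofReal K₀ ^ (2 * n + 2) * ((T : ℝ≥0∞) ^ (2 * n + 1) * gaussMoment (2 * n + 2)))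

lemma growthConst_ne_top (p : ℝ) (n : ℕ) (K₀ : ℝ) (T : ℝ≥0) : growthConst p n K₀ T ≠ ∞ := by
  unfold growthConst
  have h1 := gaussMoment_ne_top 1
  have h2 := gaussMoment_ne_top (2 * n + 2)
  exact ENNReal.mul_ne_top ENNReal.ofReal_ne_top (ENNReal.add_ne_top.mpr
    ⟨ENNReal.mul_ne_top ENNReal.ofReal_ne_top h1,
      ENNReal.mul_ne_top (ENNReal.pow_ne_top ENNReal.ofReal_ne_top)
        (ENNReal.mul_ne_top (ENNReal.pow_ne_top ENNReal.coe_ne_top) h2)⟩)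

lemma measurable_tsum_ofReal {Ω : Type*} {mΩ : MeasurableSpace Ω} (lam : ℕ → ℝ) {c : ℕ → Ω → ℝ}
    (hc : ∀ n, Measurable (c n)) :
    Measurable fun ω => ∑' j, ENNReal.ofReal (lam j * c j ω ^ 2) := by
  fun_prop

section OneStep

variable {Ω : Type*} {𝒢 mΩ : MeasurableSpace Ω} {P : Measure Ω}
  {lam qs : ℕ → ℝ} {K₀ : ℝ} {κ T : ℝ≥0} {Z : Ω → ℕ → ℝ}

/-- The remainder in one step has mean of order `κ`. -/
lemma lintegral_remainder_le (hlam : ∀ n, 0 ≤ lam n) (hq : ∀ n, 0 ≤ qs n)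
    (hK : HasSum (fun n => lam n * qs n) K₀) (hκT : κ ≤ T) (hZ : Measurable Z)
    (hlaw : ∀ n, P.map (fun ω => Z ω n) = gaussianReal 0 κ) (p : ℝ) (n : ℕ) :
    ENNReal.ofReal (incrConst p (n + 1)) * ∫⁻ ω, (noiseEnergy lam qs (Z ω)
      + noiseEnergy lam qs (Z ω) ^ (2 * (n + 1))) ∂P ≤ growthConst p n K₀ T * κ := by
  have hHm : Measurable fun ω => noiseEnergy lam qs (Z ω) := (measurable_noiseEnergy lam qs).comp hZ
  have hnn : ∀ n, 0 ≤ lam n * qs n := fun n => mul_nonneg (hlam n) (hq n)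
  have h1 := lintegral_noiseEnergy_pow_le hnn hK hZ hlaw 0
  have h2 := lintegral_noiseEnergy_pow_le hnn hK hZ hlaw (2 * n + 1)
  simp only [zero_add, pow_one] at h1
  rw [growthConst, mul_assoc, lintegral_add_left hHm]
  gcongr
  refine (add_le_add h1 h2).trans ?_
  have hκ : (κ : ℝ≥0∞) ≤ T := by exact_mod_cast hκT
  calc _ = (ENNReal.ofReal K₀ * gaussMoment 1 + ENNReal.ofReal K₀ ^ (2 * n + 2)
        * ((κ : ℝ≥0∞) ^ (2 * n + 1) * gaussMoment (2 * n + 2))) * κ := by ring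
    _ ≤ _ := by gcongr

/-- One step of the growth estimate for the moments of the enstrophy. The coefficients `c` and the
accumulated dissipation `B` belong to the past `𝒢`, of which the increments `Z` are independent; so
the term of first order in `Z` has mean zero, and the remainder is of order `κ`. -/
lemma lintegral_step_le [IsProbabilityMeasure P] (h𝒢 : 𝒢 ≤ mΩ)
    (hlam : ∀ n, 0 ≤ lam n) (hq : ∀ n, 0 ≤ qs n)
    (hK : HasSum (fun n => lam n * qs n) K₀) (hκT : κ ≤ T) (hZ : Measurable Z)
    (hlaw : ∀ n, P.map (fun ω => Z ω n) = gaussianReal 0 κ)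
    (hind : Indep 𝒢 (MeasurableSpace.comap Z inferInstance) P)
    {c : ℕ → Ω → ℝ} (hc : ∀ n, Measurable[𝒢] (c n)) {B : Ω → ℝ≥0∞} (hB : Measurable[𝒢] B)
    {p : ℝ} {n : ℕ} (hp : 2 ≤ p) (hn : p ≤ 2 * (n + 1 : ℕ)) :
    ∫⁻ ω, (1 + (∑' j, ENNReal.ofReal (lam j * (c j ω + √(qs j) * Z ω j) ^ 2) + B ω)) ^ p ∂P
      ≤ (1 + growthConst p n K₀ T * κ)
        * ∫⁻ ω, (1 + (∑' j, ENNReal.ofReal (lam j * c j ω ^ 2) + B ω)) ^ p ∂P := by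
  set X : Ω → ℝ≥0∞ := fun ω => 1 + (∑' j, ENNReal.ofReal (lam j * c j ω ^ 2) + B ω) with hX
  set E := ∫⁻ ω, X ω ^ p ∂P with hE
  by_cases hEtop : E = ∞
  · rw [hEtop, ENNReal.mul_top (by simp)]
    exact le_top
  have hp0 : 0 < p := by linarith
  have hXm : Measurable[𝒢] X := by
    exact ((measurable_tsum_ofReal lam hc).add hB).const_add 1
  set H : Ω → ℝ≥0∞ := fun ω => noiseEnergy lam qs (Z ω) with hH
  have hHm : Measurable[MeasurableSpace.comap Z inferInstance] H :=
    (measurable_noiseEnergy lam qs).comp (comap_measurable Z)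
  have hZle : MeasurableSpace.comap Z inferInstance ≤ mΩ := hZ.comap_le
  have hXm' : Measurable X := hXm.mono h𝒢 le_rfl
  have hHm' : Measurable H := hHm.mono hZle le_rfl
  set G : Ω → ℝ≥0∞ := fun ω => H ω + H ω ^ (2 * (n + 1)) with hG
  have hGm : Measurable[MeasurableSpace.comap Z inferInstance] G := hHm.add (hHm.pow_const _)
  have hGm' : Measurable G := hGm.mono hZle le_rfl
  have hrem := lintegral_remainder_le hlam hq hK hκT hZ hlaw p n
  have hC0 := incrConst_nonneg hp (n + 1)
  have hC1 : 0 < incrConst p (n + 1) := by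
    have : 0 ≤ (p + 1) ^ p := Real.rpow_nonneg (by linarith) _
    unfold incrConst
    positivity
  have hEG : ∫⁻ ω, G ω ∂P ≠ ∞ := by
    intro h
    rw [h, ENNReal.mul_top (by simpa using hC1), top_le_iff] at hrem
    exact ENNReal.mul_ne_top (growthConst_ne_top p n K₀ T) ENNReal.coe_ne_top hrem
  have hXfin : ∀ᵐ ω ∂P, X ω ≠ ∞ := by
    filter_upwards [ae_lt_top (hXm'.pow_const p) hEtop] with ω hω h
    rw [h, ENNReal.top_rpow_of_pos hp0] at hω
    exact lt_irrefl _ hω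
  have hHfin : ∀ᵐ ω ∂P, H ω ≠ ∞ := by
    filter_upwards [ae_lt_top hGm' hEG] with ω hω h
    simp [hG, h] at hω
  have hprod : ∫⁻ ω, X ω ^ p * G ω ∂P = E * ∫⁻ ω, G ω ∂P :=
    lintegral_mul_eq_lintegral_mul_lintegral_of_independent_measurableSpace h𝒢 hZle hind
      (hXm.pow_const p) hGm
  have hprodfin : ∫⁻ ω, X ω ^ p * G ω ∂P ≠ ∞ := by
    rw [hprod]; exact ENNReal.mul_ne_top hEtop hEG
  have hF1 : Integrable (fun ω => (X ω ^ p).toReal) P :=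
    integrable_toReal_of_lintegral_ne_top (hXm'.pow_const p).aemeasurable hEtop
  have hF3 : Integrable (fun ω => (X ω ^ p * G ω).toReal) P :=
    integrable_toReal_of_lintegral_ne_top ((hXm'.pow_const p).mul hGm').aemeasurable hprodfin
  have hI1 : ∫ ω, (X ω ^ p).toReal ∂P = E.toReal :=
    integral_toReal (hXm'.pow_const p).aemeasurable
      (ae_lt_top (hXm'.pow_const p) hEtop)
  have hI3 : ∫ ω, (X ω ^ p * G ω).toReal ∂P = (E * ∫⁻ ω, G ω ∂P).toReal := by
    rw [← hprod]
    exact integral_toReal ((hXm'.pow_const p).mul hGm').aemeasurable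
      (ae_lt_top ((hXm'.pow_const p).mul hGm') hprodfin)
  -- almost surely all quantities are finite, so the increment can be written with real numbers
  have hpath : ∀ᵐ ω ∂P, 1 ≤ (X ω).toReal ∧
      Summable (fun j => |lam j * c j ω * (√(qs j) * Z ω j)|) ∧
      ∑' j, |lam j * c j ω * (√(qs j) * Z ω j)| ≤ (X ω).toReal * √((H ω).toReal) ∧
      0 ≤ (X ω).toReal + 2 * (∑' j, lam j * c j ω * (√(qs j) * Z ω j)) + (H ω).toReal ∧
      1 + (∑' j, ENNReal.ofReal (lam j * (c j ω + √(qs j) * Z ω j) ^ 2) + B ω)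
        = ENNReal.ofReal ((X ω).toReal + 2 * (∑' j, lam j * c j ω * (√(qs j) * Z ω j))
          + (H ω).toReal) ∧
      (X ω ^ p * G ω).toReal
        = (X ω).toReal ^ p * ((H ω).toReal + (H ω).toReal ^ (2 * (n + 1))) := by
    filter_upwards [hXfin, hHfin] with ω h1 h2
    have h3 : ∑' j, ENNReal.ofReal (lam j * c j ω ^ 2) ≠ ∞ ∧ B ω ≠ ∞ := by
      simpa [hX] using h1
    obtain ⟨s1, s2, s3, s4⟩ := exists_increment hlam hq h3.1 h2
    set s := ∑' j, ENNReal.ofReal (lam j * c j ω ^ 2) with hs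
    set m := ∑' j, lam j * c j ω * (√(qs j) * Z ω j) with hm
    have hx : (X ω).toReal = 1 + (s.toReal + (B ω).toReal) := by
      rw [hX]
      simp only
      rw [ENNReal.toReal_add ENNReal.one_ne_top (ENNReal.add_ne_top.mpr h3),
        ENNReal.toReal_add h3.1 h3.2, ENNReal.toReal_one]
    have hb0 : 0 ≤ (B ω).toReal := ENNReal.toReal_nonneg
    have hs0 : 0 ≤ s.toReal := ENNReal.toReal_nonneg
    have hh0 : 0 ≤ (H ω).toReal := ENNReal.toReal_nonneg
    have hx1 : 1 ≤ (X ω).toReal := by rw [hx]; linarith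
    refine ⟨hx1, s1, ?_, ?_, ?_, ?_⟩
    · refine le_of_sq_le_sq ?_ (mul_nonneg (by linarith) (Real.sqrt_nonneg _))
      rw [mul_pow, Real.sq_sqrt hh0]
      refine s2.trans (mul_le_mul_of_nonneg_right ?_ hh0)
      nlinarith
    · rw [hx]; linarith
    · rw [s3, hx]
      have e1 : 1 + (s.toReal + (B ω).toReal) + 2 * m + (H ω).toReal
          = 1 + ((s.toReal + 2 * m + (H ω).toReal) + (B ω).toReal) := by ring
      rw [e1, ENNReal.ofReal_add zero_le_one (by linarith), ENNReal.ofReal_add s4 hb0,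
        ENNReal.ofReal_one, ENNReal.ofReal_toReal h3.2]
    · rw [ENNReal.toReal_mul, ← ENNReal.toReal_rpow, hG]
      simp only
      rw [ENNReal.toReal_add h2 (ENNReal.pow_ne_top h2), ENNReal.toReal_pow]
  set x : Ω → ℝ := fun ω => (X ω).toReal with hx
  have hxm : Measurable[𝒢] x := hXm.ennreal_toReal
  set g : ℕ → Ω → ℝ := fun j ω => x ω ^ (p - 1) * (lam j * c j ω * (√(qs j) * Z ω j)) with hg
  have hgm : ∀ j, Measurable (g j) := fun j => by
    have h1 : Measurable x := hxm.mono h𝒢 le_rfl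
    have h2 : Measurable (c j) := (hc j).mono h𝒢 le_rfl
    have h3 : Measurable fun ω => Z ω j := (measurable_pi_apply j).comp hZ
    exact (h1.pow_const _).mul ((h2.const_mul _).mul (h3.const_mul _))
  -- an integrable majorant of the partial sums of the mixed term, since `√h ≤ 1 + h`
  set bound : Ω → ℝ := fun ω => (X ω ^ p).toReal + (X ω ^ p * G ω).toReal with hbd
  have hbound : ∀ᵐ ω ∂P, x ω ^ (p - 1) * ∑' j, |lam j * c j ω * (√(qs j) * Z ω j)|
      ≤ bound ω := by
    filter_upwards [hpath] with ω ⟨h1, h2, h3, h4, h5, h6⟩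
    simp only [hbd]
    rw [h6, ← ENNReal.toReal_rpow]
    have hx0 : 0 < x ω := by linarith
    have hh0 : 0 ≤ (H ω).toReal := ENNReal.toReal_nonneg
    have e1 : x ω ^ p = x ω ^ (p - 1) * x ω := by
      rw [← Real.rpow_add_one hx0.ne']; simp
    have e2 : √((H ω).toReal) ≤ 1 + (H ω).toReal := by
      rw [Real.sqrt_le_left (by linarith)]
      nlinarith
    have e3 : 0 ≤ (H ω).toReal ^ (2 * (n + 1)) := by positivity
    calc _ ≤ x ω ^ (p - 1) * (x ω * √((H ω).toReal)) := by gcongr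
      _ = x ω ^ p * √((H ω).toReal) := by rw [e1]; ring
      _ ≤ x ω ^ p * (1 + ((H ω).toReal + (H ω).toReal ^ (2 * (n + 1)))) := by
        gcongr
        linarith
      _ = _ := by ring
  have hpart : ∀ (s : Finset ℕ), ∀ᵐ ω ∂P, ‖∑ j ∈ s, g j ω‖ ≤ bound ω := by
    intro s
    filter_upwards [hpath, hbound] with ω ⟨h1, h2, h3, h4, h5, h6⟩ h7
    refine le_trans ?_ h7
    rw [hg]
    simp only
    have hx0 : 0 < x ω := by linarith
    rw [← Finset.mul_sum, norm_mul, Real.norm_of_nonneg (by positivity)]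
    gcongr
    exact (Finset.abs_sum_le_sum_abs _ _).trans (h2.sum_le_tsum s fun _ _ => abs_nonneg _)
  have hbi : Integrable bound P := hF1.add hF3
  have hgi : ∀ j, Integrable (g j) P := fun j =>
    hbi.mono' (hgm j).aestronglyMeasurable (by simpa using hpart {j})
  -- each term of the martingale part is a product of independent factors, one of them centred
  have hg0 : ∀ j, ∫ ω, g j ω ∂P = 0 := by
    intro j
    have hZj : Measurable fun ω => Z ω j := (measurable_pi_apply j).comp hZ
    have ha : Measurable[𝒢] fun ω => x ω ^ (p - 1) * (lam j * c j ω * √(qs j)) :=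
      (hxm.pow_const _).mul (((hc j).const_mul _).mul_const _)
    have hI : IndepFun (fun ω => x ω ^ (p - 1) * (lam j * c j ω * √(qs j)))
        (fun ω => Z ω j) P := by
      rw [IndepFun_iff_Indep]
      refine indep_of_indep_of_le_left (indep_of_indep_of_le_right hind ?_) ha.comap_le
      exact ((measurable_pi_apply j).comp (comap_measurable Z)).comap_le
    have hmean : ∫ ω, Z ω j ∂P = 0 := by
      have h1 := integral_map (μ := P) hZj.aemeasurable (f := fun y : ℝ => y)
        aestronglyMeasurable_id
      rw [hlaw j, integral_id_gaussianReal] at h1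
      exact h1.symm
    have h2 := hI.integral_fun_mul_eq_mul_integral
      (ha.mono h𝒢 le_rfl).aestronglyMeasurable hZj.aestronglyMeasurable
    rw [hmean, mul_zero] at h2
    rw [← h2]
    refine integral_congr_ae (Filter.Eventually.of_forall fun ω => ?_)
    simp only [hg]
    ring
  set m : Ω → ℝ := fun ω => ∑' j, lam j * c j ω * (√(qs j) * Z ω j) with hm
  have htend : ∀ᵐ ω ∂P, Filter.Tendsto (fun k => ∑ j ∈ Finset.range k, g j ω) Filter.atTop
      (nhds (x ω ^ (p - 1) * m ω)) := by
    filter_upwards [hpath] with ω ⟨h1, h2, h3, h4, h5, h6⟩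
    exact (h2.of_abs.hasSum.mul_left (x ω ^ (p - 1))).tendsto_sum_nat
  have hmm : AEStronglyMeasurable (fun ω => x ω ^ (p - 1) * m ω) P :=
    aestronglyMeasurable_of_tendsto_ae Filter.atTop
      (fun k => (Finset.measurable_sum _ fun j _ => hgm j).aestronglyMeasurable) htend
  have hF2 : Integrable (fun ω => x ω ^ (p - 1) * m ω) P := by
    refine hbi.mono' hmm ?_
    filter_upwards [htend, ae_all_iff.mpr fun k => hpart (Finset.range k)] with ω h1 h2
    exact le_of_tendsto h1.norm (Filter.Eventually.of_forall h2)
  have hI2 : ∫ ω, x ω ^ (p - 1) * m ω ∂P = 0 := by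
    have h1 := tendsto_integral_of_dominated_convergence bound
      (fun k => (Finset.measurable_sum (Finset.range k) fun j _ => hgm j).aestronglyMeasurable)
      hbi (fun k => hpart (Finset.range k)) htend
    refine tendsto_nhds_unique h1 ?_
    simp only [integral_finsetSum _ fun j _ => hgi j, hg0, Finset.sum_const_zero]
    exact tendsto_const_nhds
  set F : Ω → ℝ := fun ω => (X ω ^ p).toReal + 2 * p * (x ω ^ (p - 1) * m ω)
    + incrConst p (n + 1) * (X ω ^ p * G ω).toReal with hF
  have hFi : Integrable F P := (hF1.add (hF2.const_mul _)).add (hF3.const_mul _)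
  have hIF : ∫ ω, F ω ∂P = E.toReal + incrConst p (n + 1) * (E * ∫⁻ ω, G ω ∂P).toReal := by
    have h1 : ∫ ω, F ω ∂P = ∫ ω, (X ω ^ p).toReal ∂P + 2 * p * ∫ ω, x ω ^ (p - 1) * m ω ∂P
        + incrConst p (n + 1) * ∫ ω, (X ω ^ p * G ω).toReal ∂P := by
      have h2 : Integrable (fun ω => (X ω ^ p).toReal + 2 * p * (x ω ^ (p - 1) * m ω)) P :=
        hF1.add (hF2.const_mul _)
      rw [← integral_const_mul, ← integral_const_mul, ← integral_add hF1 (hF2.const_mul _),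
        ← integral_add h2 (hF3.const_mul _)]
    rw [h1, hI1, hI2, hI3, mul_zero, add_zero]
  have hstep : ∀ᵐ ω ∂P,
      (1 + (∑' j, ENNReal.ofReal (lam j * (c j ω + √(qs j) * Z ω j) ^ 2) + B ω)) ^ p
        ≤ ENNReal.ofReal (F ω) ∧ 0 ≤ F ω := by
    filter_upwards [hpath] with ω ⟨h1, h2, h3, h4, h5, h6⟩
    have hm1 : |m ω| ≤ x ω * √((H ω).toReal) := by
      refine le_trans ?_ h3
      simpa using norm_tsum_le_tsum_norm (f := fun j => lam j * c j ω * (√(qs j) * Z ω j)) h2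
    have h7 := add_rpow_le hp hn h1 ENNReal.toReal_nonneg hm1 h4
    have h8 : ((X ω).toReal + 2 * m ω + (H ω).toReal) ^ p ≤ F ω := by
      simp only [hF]
      rw [h6, ← ENNReal.toReal_rpow]
      exact h7
    refine ⟨?_, (Real.rpow_nonneg h4 p).trans h8⟩
    rw [h5, ENNReal.ofReal_rpow_of_nonneg h4 hp0.le]
    exact ENNReal.ofReal_le_ofReal h8
  calc _ ≤ ∫⁻ ω, ENNReal.ofReal (F ω) ∂P := lintegral_mono_ae (hstep.mono fun _ h => h.1)
    _ = ENNReal.ofReal (∫ ω, F ω ∂P) :=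
      (ofReal_integral_eq_lintegral_ofReal hFi (hstep.mono fun _ h => h.2)).symm
    _ = E + ENNReal.ofReal (incrConst p (n + 1)) * (E * ∫⁻ ω, G ω ∂P) := by
      rw [hIF, ENNReal.ofReal_add ENNReal.toReal_nonneg
        (mul_nonneg hC0 ENNReal.toReal_nonneg), ENNReal.ofReal_mul hC0,
        ENNReal.ofReal_toReal hEtop, ENNReal.ofReal_toReal (ENNReal.mul_ne_top hEtop hEG)]
    _ = E + (ENNReal.ofReal (incrConst p (n + 1)) * ∫⁻ ω, G ω ∂P) * E := by ring
    _ ≤ E + growthConst p n K₀ T * κ * E := by gcongr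
    _ = _ := by ring

end OneStep

end

/-! ### The enstrophy moments of the Euler scheme -/

section

section Grid

lemma gridTime_mono (T : ℝ≥0) (N : ℕ) : Monotone (gridTime T N) := by
  intro l m h
  unfold gridTime
  gcongr

lemma gridTime_succ (T : ℝ≥0) (N l : ℕ) : gridTime T N (l + 1) = gridTime T N l + T / N := by
  unfold gridTime
  push_cast
  ring

lemma one_add_mul_pow_le_exp (g : ℝ≥0∞) (hg : g ≠ ∞) (T : ℝ≥0) {N l : ℕ} (hN : 1 ≤ N)
    (hl : l ≤ N) : (1 + g * ((T / N : ℝ≥0) : ℝ≥0∞)) ^ l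
      ≤ ENNReal.ofReal (Real.exp (g.toReal * T)) := by
  lift g to ℝ≥0 using hg
  have hN0 : (N : ℝ) ≠ 0 := by positivity
  have h1 : (1 + (g : ℝ) * (T / N)) ^ l ≤ Real.exp (g * T) := by
    calc (1 + (g : ℝ) * (T / N)) ^ l ≤ (1 + (g : ℝ) * (T / N)) ^ N :=
          pow_le_pow_right₀ (le_add_of_nonneg_right (by positivity)) hl
      _ ≤ Real.exp (g * (T / N)) ^ N := by
          gcongr
          linarith [Real.add_one_le_exp ((g : ℝ) * (T / N))]
      _ = Real.exp (g * T) := by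
          rw [← Real.exp_nat_mul]
          congr 1
          field_simp
  have h2 : (1 + (g : ℝ≥0∞) * ((T / N : ℝ≥0) : ℝ≥0∞)) ^ l
      = ENNReal.ofReal ((1 + (g : ℝ) * (T / N)) ^ l) := by
    rw [ENNReal.ofReal_pow (by positivity), ENNReal.ofReal_add zero_le_one (by positivity),
      ENNReal.ofReal_one, ENNReal.ofReal_mul g.coe_nonneg, ENNReal.ofReal_coe_nnreal]
    congr 3
    rw [← ENNReal.ofReal_coe_nnreal]
    push_cast
    rfl
  rw [h2, ENNReal.coe_toReal]
  exact ENNReal.ofReal_le_ofReal h1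

end Grid

section Scheme

variable {L : ℝ} [hL : Fact (0 < L)] {Ω : Type*} {mΩ : MeasurableSpace Ω} {P : Measure Ω}
  {ℱ : Filtration ℝ≥0 mΩ} {ζ : ℕ → VectorL2 L} {lam qs : ℕ → ℝ} {β : ℕ → ℝ≥0 → Ω → ℝ}
  {K₀ ν : ℝ} {T : ℝ≥0} {N : ℕ} {u₀ : Ω → VectorL2 L} {u : ℕ → Ω → VectorL2 L}
  {π : ℕ → Ω → ScalarL2 L}

lemma measurable_ens (ζ : ℕ → VectorL2 L) (lam : ℕ → ℝ) {f : Ω → VectorL2 L}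
    (hf : StronglyMeasurable f) : Measurable fun ω => ens ζ lam (f ω) := by
  have h : ∀ n, Measurable fun ω => inner ℝ (f ω) (ζ n) := fun n =>
    (hf.inner stronglyMeasurable_const).measurable
  unfold ens
  fun_prop

lemma measurable_pal (ζ : ℕ → VectorL2 L) (lam : ℕ → ℝ) {f : Ω → VectorL2 L}
    (hf : StronglyMeasurable f) : Measurable fun ω => pal ζ lam (f ω) := by
  have h : ∀ n, Measurable fun ω => inner ℝ (f ω) (ζ n) := fun n =>
    (hf.inner stronglyMeasurable_const).measurable
  unfold pal
  fun_prop

/-- The series defining the Wiener process converges almost surely in `H`. -/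
lemma IsBrownianFamily.ae_summable (hβ : IsBrownianFamily ℱ P β)
    (hζ : IsStokesEigenbasis ζ lam) (hq : ∀ j, 0 ≤ qs j)
    (hK : HasSum (fun j => lam j * qs j) K₀) (t : ℝ≥0) :
    ∀ᵐ ω ∂P, Summable fun j => qs j * β j t ω ^ 2 := by
  have hm : Measurable fun ω j => β j t ω :=
    measurable_pi_lambda _ fun j => (hβ.adapted j t).mono (ℱ.le t) le_rfl
  have h1 := lintegral_noiseEnergy_pow_le (fun n => mul_nonneg (hζ.pos n).le (hq n)) hK hm
    (fun n => ((hβ.brownian n).toIsPreBrownianReal.hasLaw_eval t).map_eq) 0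
  have h2 : ∫⁻ ω, noiseEnergy lam qs (fun j => β j t ω) ∂P ≠ ∞ := by
    simp only [zero_add, pow_one] at h1
    exact ne_top_of_le_ne_top (ENNReal.mul_ne_top ENNReal.ofReal_ne_top
      (ENNReal.mul_ne_top ENNReal.coe_ne_top (gaussMoment_ne_top 1))) h1
  filter_upwards [ae_lt_top ((measurable_noiseEnergy lam qs).comp hm) h2] with ω hω
  -- the expected energy `∑ λⱼ qⱼ βⱼ²` is finite, and the eigenvalues are bounded below by `λ₀ > 0`
  have h3 := (ENNReal.summable_toReal (ne_of_lt hω)).mul_left (lam 0)⁻¹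
  refine Summable.of_nonneg_of_le (fun j => mul_nonneg (hq j) (sq_nonneg _)) (fun j => ?_) h3
  have hn : 0 ≤ qs j * β j t ω ^ 2 := mul_nonneg (hq j) (sq_nonneg _)
  rw [ENNReal.toReal_mul, ENNReal.toReal_ofReal (mul_nonneg (hζ.pos j).le (hq j)),
    ENNReal.toReal_ofReal (sq_nonneg _), le_inv_mul_iff₀ (hζ.pos 0), mul_assoc]
  exact mul_le_mul_of_nonneg_right (hζ.mono (Nat.zero_le j)) hn

/-- The increments of the Brownian motions over the time step from `t_l` to `t_{l+1}`. -/
def gridIncr (β : ℕ → ℝ≥0 → Ω → ℝ) (T : ℝ≥0) (N l : ℕ) (ω : Ω) (j : ℕ) : ℝ :=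
  β j (gridTime T N (l + 1)) ω - β j (gridTime T N l) ω

lemma IsBrownianFamily.measurable_gridIncr (hβ : IsBrownianFamily ℱ P β) (l : ℕ) :
    Measurable (gridIncr β T N l) :=
  measurable_pi_lambda _ fun j => ((hβ.adapted j _).mono (ℱ.le _) le_rfl).sub
    ((hβ.adapted j _).mono (ℱ.le _) le_rfl)

lemma IsBrownianFamily.map_gridIncr (hβ : IsBrownianFamily ℱ P β) (l n : ℕ) :
    P.map (fun ω => gridIncr β T N l ω n) = gaussianReal 0 (T / N) := by
  have h := ((hβ.brownian n).toIsPreBrownianReal.hasLaw_sub (gridTime T N (l + 1))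
    (gridTime T N l)).map_eq
  have h2 : nndist (gridTime T N (l + 1) : ℝ) (gridTime T N l : ℝ) = T / N := by
    apply NNReal.eq
    rw [coe_nndist, Real.dist_eq, gridTime_succ, NNReal.coe_add, add_sub_cancel_left,
      abs_of_nonneg (NNReal.coe_nonneg _)]
  have h3 := h.trans (congrArg (gaussianReal 0) h2)
  exact h3

lemma IsEulerScheme.ae_mem_V (h : IsEulerScheme ℱ P ν T N u₀ (wiener ζ qs β) u π)
    (hu₀ : ∀ᵐ ω ∂P, u₀ ω ∈ spaceV L) {l : ℕ} (hl : l ≤ N) : ∀ᵐ ω ∂P, u l ω ∈ spaceV L := by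
  rcases Nat.eq_zero_or_pos l with rfl | h0
  · rw [h.init]; exact hu₀
  · exact h.mem_V l (Finset.mem_Icc.mpr ⟨h0, hl⟩)

/-- Each step of the scheme is a stationary problem, whose right-hand side is the previous velocity
plus the noise increment. -/
lemma IsEulerScheme.ae_isStep (h : IsEulerScheme ℱ P ν T N u₀ (wiener ζ qs β) u π)
    (hζ : IsStokesEigenbasis ζ lam) (hu₀ : ∀ᵐ ω ∂P, u₀ ω ∈ spaceV L) {l : ℕ} (hl : l < N) :
    ∀ᵐ ω ∂P, IsStep (T / N) ν (u (l + 1) ω)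
      (u l ω + (wiener ζ qs β (gridTime T N (l + 1)) ω - wiener ζ qs β (gridTime T N l) ω))
      (π (l + 1) ω) := by
  have hl' : l + 1 ∈ Finset.Icc 1 N := Finset.mem_Icc.mpr ⟨by omega, hl⟩
  filter_upwards [h.ae_mem_V hu₀ hl.le, h.mem_V _ hl', h.momentum _ hl'] with ω h1 h2 h3
  refine ⟨h2, hζ.add_mem h1.1 (hζ.sub_mem (hζ.wiener_mem ..) (hζ.wiener_mem ..)), fun φ hφ => ?_⟩
  have h4 := h3 φ hφ
  rw [Nat.add_sub_cancel, inner_sub_left] at h4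
  rw [inner_add_left]
  linarith

/-- The enstrophy inequality of one step of the scheme, in terms of the coefficients. -/
lemma IsEulerScheme.ae_ens_add_pal_le (h : IsEulerScheme ℱ P ν T N u₀ (wiener ζ qs β) u π)
    (hζ : IsStokesEigenbasis ζ lam) (hu₀ : ∀ᵐ ω ∂P, u₀ ω ∈ spaceV L)
    (hβ : IsBrownianFamily ℱ P β) (hq : ∀ j, 0 ≤ qs j) (hK : HasSum (fun j => lam j * qs j) K₀)
    (hν : 0 < ν) (hT : 0 < T) {l : ℕ} (hl : l < N) :
    ∀ᵐ ω ∂P, ens ζ lam (u (l + 1) ω)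
        + ENNReal.ofReal (2 * (T / N) * ν) * pal ζ lam (u (l + 1) ω)
      ≤ ∑' n, ENNReal.ofReal
        (lam n * (inner ℝ (u l ω) (ζ n) + √(qs n) * gridIncr β T N l ω n) ^ 2) := by
  have hκ : (0 : ℝ) < T / N := by
    have : (0 : ℝ) < N := by exact_mod_cast (by omega : 0 < N)
    have : (0 : ℝ) < T := hT
    positivity
  filter_upwards [h.ae_isStep hζ hu₀ hl, hβ.ae_summable hζ hq hK (gridTime T N (l + 1)),
    hβ.ae_summable hζ hq hK (gridTime T N l)] with ω h1 h2 h3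
  refine (h1.ens_add_pal_le hζ hκ hν).trans (le_of_eq (tsum_congr fun n => ?_))
  rw [inner_add_left, inner_sub_left, hζ.inner_wiener hq h2, hζ.inner_wiener hq h3, gridIncr,
    mul_sub]

/-- The enstrophy at the step `l` together with the palinstrophy dissipated up to that step. -/
def totalEnstrophy (ζ : ℕ → VectorL2 L) (lam : ℕ → ℝ) (c : ℝ) (u : ℕ → Ω → VectorL2 L) (l : ℕ)
    (ω : Ω) : ℝ≥0∞ :=
  ens ζ lam (u l ω) + ENNReal.ofReal c * ∑ i ∈ Finset.Icc 1 l, pal ζ lam (u i ω)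

lemma IsEulerScheme.measurable_dissipation
    (h : IsEulerScheme ℱ P ν T N u₀ (wiener ζ qs β) u π) (lam : ℕ → ℝ) (c : ℝ) {l : ℕ}
    (hl : l ≤ N) : Measurable[ℱ (gridTime T N l)]
      fun ω => ENNReal.ofReal c * ∑ i ∈ Finset.Icc 1 l, pal ζ lam (u i ω) := by
  refine Measurable.const_mul (Finset.measurable_sum _ fun i hi => ?_) _
  have hi' := (Finset.mem_Icc.mp hi).2
  exact (measurable_pal (mΩ := ℱ (gridTime T N i)) ζ lam (h.adapted_u i (hi'.trans hl))).mono
    (ℱ.mono (gridTime_mono T N hi')) le_rfl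

lemma IsEulerScheme.measurable_totalEnstrophy
    (h : IsEulerScheme ℱ P ν T N u₀ (wiener ζ qs β) u π) (lam : ℕ → ℝ) (c : ℝ) {l : ℕ}
    (hl : l ≤ N) : Measurable (totalEnstrophy ζ lam c u l) :=
  ((measurable_ens ζ lam ((h.adapted_u l hl).mono (ℱ.le _))).add
    ((h.measurable_dissipation lam c hl).mono (ℱ.le _) le_rfl))

/-- The growth of the moments of the total enstrophy over one step of the scheme. -/
lemma IsEulerScheme.lintegral_totalEnstrophy_succ_le [IsProbabilityMeasure P]
    (h : IsEulerScheme ℱ P ν T N u₀ (wiener ζ qs β) u π)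
    (hζ : IsStokesEigenbasis ζ lam) (hu₀ : ∀ᵐ ω ∂P, u₀ ω ∈ spaceV L)
    (hβ : IsBrownianFamily ℱ P β) (hq : ∀ j, 0 ≤ qs j) (hK : HasSum (fun j => lam j * qs j) K₀)
    (hν : 0 < ν) (hT : 0 < T) {p : ℝ} {n : ℕ} (hp : 2 ≤ p) (hn : p ≤ 2 * (n + 1 : ℕ)) {l : ℕ}
    (hl : l < N) :
    ∫⁻ ω, (1 + totalEnstrophy ζ lam (2 * (T / N) * ν) u (l + 1) ω) ^ p ∂P
      ≤ (1 + growthConst p n K₀ T * ((T / N : ℝ≥0) : ℝ≥0∞))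
        * ∫⁻ ω, (1 + totalEnstrophy ζ lam (2 * (T / N) * ν) u l ω) ^ p ∂P := by
  have hN : 1 ≤ N := by omega
  have hκT : T / N ≤ T := div_le_self zero_le (by exact_mod_cast hN)
  have hind := hβ.indep_past (gridTime T N l) (gridTime T N (l + 1))
    (gridTime_mono T N (Nat.le_succ l))
  refine le_trans ?_ (lintegral_step_le (ℱ.le (gridTime T N l)) (fun n => (hζ.pos n).le) hq hK hκT
    (hβ.measurable_gridIncr l) (hβ.map_gridIncr l) hind
    (c := fun n ω => inner ℝ (u l ω) (ζ n))
    (fun n => ((h.adapted_u l hl.le).inner stronglyMeasurable_const).measurable)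
    (h.measurable_dissipation lam (2 * (T / N) * ν) hl.le) hp hn)
  refine lintegral_mono_ae ?_
  filter_upwards [h.ae_ens_add_pal_le hζ hu₀ hβ hq hK hν hT hl] with ω hω
  refine ENNReal.rpow_le_rpow ?_ (by linarith)
  gcongr 1 + ?_
  rw [totalEnstrophy, Finset.sum_Icc_succ_top (by omega), mul_add]
  calc _ = (ens ζ lam (u (l + 1) ω) + ENNReal.ofReal (2 * (T / N) * ν) * pal ζ lam (u (l + 1) ω))
        + ENNReal.ofReal (2 * (T / N) * ν) * ∑ i ∈ Finset.Icc 1 l, pal ζ lam (u i ω) := by ring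
    _ ≤ _ := by gcongr

/-- The moments of the total enstrophy grow at most exponentially. -/
lemma IsEulerScheme.lintegral_totalEnstrophy_le [IsProbabilityMeasure P]
    (h : IsEulerScheme ℱ P ν T N u₀ (wiener ζ qs β) u π)
    (hζ : IsStokesEigenbasis ζ lam) (hu₀ : ∀ᵐ ω ∂P, u₀ ω ∈ spaceV L)
    (hβ : IsBrownianFamily ℱ P β) (hq : ∀ j, 0 ≤ qs j) (hK : HasSum (fun j => lam j * qs j) K₀)
    (hν : 0 < ν) (hT : 0 < T) (hN : 1 ≤ N) {p : ℝ} {n : ℕ} (hp : 2 ≤ p)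
    (hn : p ≤ 2 * (n + 1 : ℕ)) {l : ℕ} (hl : l ≤ N) :
    ∫⁻ ω, (1 + totalEnstrophy ζ lam (2 * (T / N) * ν) u l ω) ^ p ∂P
      ≤ ENNReal.ofReal (Real.exp ((growthConst p n K₀ T).toReal * T))
        * ∫⁻ ω, (1 + ens ζ lam (u₀ ω)) ^ p ∂P := by
  suffices ∫⁻ ω, (1 + totalEnstrophy ζ lam (2 * (T / N) * ν) u l ω) ^ p ∂P
      ≤ (1 + growthConst p n K₀ T * ((T / N : ℝ≥0) : ℝ≥0∞)) ^ l
        * ∫⁻ ω, (1 + ens ζ lam (u₀ ω)) ^ p ∂P by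
    refine this.trans ?_
    gcongr
    exact one_add_mul_pow_le_exp _ (growthConst_ne_top p n K₀ T) T hN hl
  induction l with
  | zero => simp [totalEnstrophy, h.init]
  | succ l ih =>
    refine (h.lintegral_totalEnstrophy_succ_le hζ hu₀ hβ hq hK hν hT hp hn hl).trans ?_
    rw [pow_succ', mul_assoc (1 + growthConst p n K₀ T * _)]
    refine mul_le_mul' le_rfl ?_
    exact ih (by omega)

end Scheme

section Initial

variable {L : ℝ} [hL : Fact (0 < L)]

lemma gradInner_self_nonneg (u : VectorL2 L) : 0 ≤ gradInner u u :=
  Finset.sum_nonneg fun _ _ => Finset.sum_nonneg fun _ _ => real_inner_self_nonneg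

lemma gradNormSq_nonneg (f : ScalarL2 L) : 0 ≤ gradNormSq f :=
  Finset.sum_nonneg fun _ _ => sq_nonneg _

/-- The moment of order `3q` of the initial enstrophy is controlled by the moment of order `6q` of
the norm of `V`. -/
lemma IsStokesEigenbasis.one_add_ens_rpow_le {ζ : ℕ → VectorL2 L} {lam : ℕ → ℝ}
    (hζ : IsStokesEigenbasis ζ lam) {u : VectorL2 L} (hu : VecMemW12 u) {q : ℝ} (hq : 1 ≤ q) :
    (1 + ens ζ lam u) ^ (3 * q)
      ≤ 2 ^ (3 * q - 1) * (1 + ENNReal.ofReal (normV u ^ (6 * q))) := by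
  have h0 : 0 ≤ normV u := Real.sqrt_nonneg _
  have h1 : ens ζ lam u ≤ ENNReal.ofReal (normV u ^ 2) := by
    refine (hζ.ens_le hu).trans (ENNReal.ofReal_le_ofReal ?_)
    rw [normV, Real.sq_sqrt (add_nonneg (sq_nonneg _) (gradInner_self_nonneg u))]
    linarith [sq_nonneg ‖u‖]
  have h2 : ENNReal.ofReal (normV u ^ (6 * q)) = ENNReal.ofReal (normV u ^ 2) ^ (3 * q) := by
    rw [ENNReal.ofReal_rpow_of_nonneg (sq_nonneg _) (by linarith), ← Real.rpow_natCast,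
      ← Real.rpow_mul h0]
    congr 2
    push_cast
    ring
  calc (1 + ens ζ lam u) ^ (3 * q) ≤ (1 + ENNReal.ofReal (normV u ^ 2)) ^ (3 * q) := by
        gcongr
    _ ≤ 2 ^ (3 * q - 1) * (1 ^ (3 * q) + ENNReal.ofReal (normV u ^ 2) ^ (3 * q)) :=
        ENNReal.rpow_add_le_mul_rpow_add_rpow _ _ (by linarith)
    _ = _ := by rw [ENNReal.one_rpow, h2]

end Initial

/-- A bound for the moments of order `3q` of the total enstrophy. -/
def enstrophyConst (T : ℝ≥0) (q K₀ : ℝ) (M : ℝ≥0) : ℝ≥0∞ :=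
  ENNReal.ofReal (Real.exp ((growthConst (3 * q) ⌈3 * q⌉₊ K₀ T).toReal * T))
    * (2 ^ (3 * q - 1) * (1 + M))

/-- The bound for the moment of order `q` of the pressure gradient. -/
def pressureMomentConst (L ν : ℝ) (T : ℝ≥0) (q K₀ : ℝ) (M : ℝ≥0) : ℝ≥0∞ :=
  (1 + pressConst L) ^ q * (2 ^ (q - 1) * ((T : ℝ≥0∞) ^ (q - 1) * T
    + ENNReal.ofReal ((2 * ν)⁻¹) ^ q)) * enstrophyConst T q K₀ M

lemma pressureMomentConst_ne_top {L : ℝ} [Fact (0 < L)] {ν : ℝ} {T : ℝ≥0} {q K₀ : ℝ} {M : ℝ≥0}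
    (hq : 2 ≤ q) : pressureMomentConst L ν T q K₀ M ≠ ∞ := by
  have hp : pressConst L ≠ ∞ := pressConst_ne_top
  have h0 : 0 ≤ q := by linarith
  have h1 : 0 ≤ q - 1 := by linarith
  have h3 : 0 ≤ 3 * q - 1 := by linarith
  unfold pressureMomentConst enstrophyConst
  refine ENNReal.mul_ne_top (ENNReal.mul_ne_top ?_ (ENNReal.mul_ne_top ?_ ?_))
    (ENNReal.mul_ne_top ENNReal.ofReal_ne_top (ENNReal.mul_ne_top ?_ ?_))
  · exact ENNReal.rpow_ne_top_of_nonneg h0 (ENNReal.add_ne_top.mpr ⟨ENNReal.one_ne_top, hp⟩)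
  · exact ENNReal.rpow_ne_top_of_nonneg h1 (by simp)
  · exact ENNReal.add_ne_top.mpr
      ⟨ENNReal.mul_ne_top (ENNReal.rpow_ne_top_of_nonneg h1 ENNReal.coe_ne_top) ENNReal.coe_ne_top,
        ENNReal.rpow_ne_top_of_nonneg h0 ENNReal.ofReal_ne_top⟩
  · exact ENNReal.rpow_ne_top_of_nonneg h3 (by simp)
  · simp

/-- The `q`-th power of the pressure gradient is controlled by the enstrophy and the accumulated
palinstrophy. -/
lemma rpow_sum_gradNormSq_le {L : ℝ} [Fact (0 < L)] {Ω : Type*} {ζ : ℕ → VectorL2 L} {lam : ℕ → ℝ}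
    {ν : ℝ} (hν : 0 < ν) {T : ℝ≥0} {N : ℕ} (hN : 1 ≤ N) {q : ℝ} (hq : 2 ≤ q)
    {u : ℕ → Ω → VectorL2 L} {π : ℕ → Ω → ScalarL2 L} {ω : Ω}
    (h : ∀ l ∈ Finset.Icc 1 N, ENNReal.ofReal (gradNormSq (π l ω))
      ≤ (1 + pressConst L) * (ens ζ lam (u l ω) ^ 3 + pal ζ lam (u l ω))) :
    ENNReal.ofReal (|(T / N : ℝ) * ∑ l ∈ Finset.Icc 1 N, gradNormSq (π l ω)| ^ q)
      ≤ (1 + pressConst L) ^ q * (2 ^ (q - 1) * ((T : ℝ≥0∞) ^ (q - 1)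
          * ∑ l ∈ Finset.Icc 1 N, ((T / N : ℝ≥0) : ℝ≥0∞)
            * (1 + totalEnstrophy ζ lam (2 * (T / N) * ν) u l ω) ^ (3 * q)
        + ENNReal.ofReal ((2 * ν)⁻¹) ^ q
          * (1 + totalEnstrophy ζ lam (2 * (T / N) * ν) u N ω) ^ (3 * q))) := by
  set κ : ℝ≥0 := T / N with hκ
  have hκr : (T / N : ℝ) = κ := by rw [hκ]; push_cast; rfl
  rw [hκr]
  have hq0 : 0 ≤ q := by linarith
  have hsum : 0 ≤ ∑ l ∈ Finset.Icc 1 N, gradNormSq (π l ω) :=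
    Finset.sum_nonneg fun _ _ => gradNormSq_nonneg _
  have e1 : ENNReal.ofReal ((κ : ℝ) * ∑ l ∈ Finset.Icc 1 N, gradNormSq (π l ω))
      ≤ (1 + pressConst L) * (∑ l ∈ Finset.Icc 1 N, (κ : ℝ≥0∞) * ens ζ lam (u l ω) ^ 3
        + κ * ∑ l ∈ Finset.Icc 1 N, pal ζ lam (u l ω)) := by
    rw [ENNReal.ofReal_mul κ.coe_nonneg, ENNReal.ofReal_coe_nnreal,
      ENNReal.ofReal_sum_of_nonneg fun _ _ => gradNormSq_nonneg _]
    calc _ ≤ (κ : ℝ≥0∞) * ∑ l ∈ Finset.Icc 1 N,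
          (1 + pressConst L) * (ens ζ lam (u l ω) ^ 3 + pal ζ lam (u l ω)) := by
          gcongr with l hl
          exact h l hl
      _ = _ := by
          rw [← Finset.mul_sum, ← Finset.mul_sum, Finset.sum_add_distrib]
          ring
  have e2 : (∑ l ∈ Finset.Icc 1 N, (κ : ℝ≥0∞) * ens ζ lam (u l ω) ^ 3) ^ q
      ≤ (T : ℝ≥0∞) ^ (q - 1) * ∑ l ∈ Finset.Icc 1 N, (κ : ℝ≥0∞)
            * (1 + totalEnstrophy ζ lam (2 * κ * ν) u l ω) ^ (3 * q) := by
    refine (rpow_sum_mul_le _ (by linarith) _ _).trans ?_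
    have : ∑ l ∈ Finset.Icc 1 N, (κ : ℝ≥0∞) = T := by
      rw [Finset.sum_const, Nat.card_Icc, Nat.add_sub_cancel, nsmul_eq_mul]
      have hN0 : (N : ℝ≥0) ≠ 0 := by positivity
      have : (N : ℝ≥0) * κ = T := by rw [hκ]; field_simp
      exact_mod_cast this
    rw [this]
    gcongr with l hl
    rw [← ENNReal.rpow_natCast, ← ENNReal.rpow_mul]
    push_cast
    gcongr
    exact le_add_self.trans' le_self_add
  have e3 : (κ * ∑ l ∈ Finset.Icc 1 N, pal ζ lam (u l ω)) ^ q
      ≤ ENNReal.ofReal ((2 * ν)⁻¹) ^ q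
          * (1 + totalEnstrophy ζ lam (2 * κ * ν) u N ω) ^ (3 * q) := by
    have h1 : (κ : ℝ≥0∞) * ∑ l ∈ Finset.Icc 1 N, pal ζ lam (u l ω)
        ≤ ENNReal.ofReal ((2 * ν)⁻¹) * (1 + totalEnstrophy ζ lam (2 * κ * ν) u N ω) := by
      have h2 : (κ : ℝ≥0∞) = ENNReal.ofReal ((2 * ν)⁻¹) * ENNReal.ofReal (2 * κ * ν) := by
        rw [← ENNReal.ofReal_mul (by positivity), ← ENNReal.ofReal_coe_nnreal]
        congr 1
        field_simp
      rw [h2, mul_assoc]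
      gcongr
      exact le_add_self.trans' le_add_self
    refine (ENNReal.rpow_le_rpow h1 hq0).trans ?_
    rw [ENNReal.mul_rpow_of_nonneg _ _ hq0]
    gcongr
    · exact le_self_add
    · linarith
  rw [abs_of_nonneg (mul_nonneg κ.coe_nonneg hsum),
    ← ENNReal.ofReal_rpow_of_nonneg (mul_nonneg κ.coe_nonneg hsum) hq0]
  refine (ENNReal.rpow_le_rpow e1 hq0).trans ?_
  rw [ENNReal.mul_rpow_of_nonneg _ _ hq0]
  gcongr
  refine (ENNReal.rpow_add_le_mul_rpow_add_rpow _ _ (by linarith)).trans ?_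
  gcongr

end

end TorusNSE

end

theorem lemma4p1 (L : ℝ) [Fact (0 < L)] (ν : ℝ) (hν : 0 < ν) (T : ℝ≥0) (hT : 0 < T)
    (q : ℝ) (hq : 2 ≤ q) (K₀ : ℝ) (M : ℝ≥0) :
    ∃ C : ℝ≥0,
      ∀ (Ω : Type*) (mΩ : MeasurableSpace Ω) (P : Measure Ω) (_ : IsProbabilityMeasure P)
        (ℱ : Filtration ℝ≥0 mΩ)
        (ζ : ℕ → TorusNSE.VectorL2 L) (lam : ℕ → ℝ) (_ : TorusNSE.IsStokesEigenbasis ζ lam)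
        (qs : ℕ → ℝ) (_ : ∀ j, 0 ≤ qs j) (_ : HasSum (fun j => lam j * qs j) K₀)
        (β : ℕ → ℝ≥0 → Ω → ℝ) (_ : TorusNSE.IsBrownianFamily ℱ P β)
        (u₀ : Ω → TorusNSE.VectorL2 L) (_ : StronglyMeasurable[ℱ 0] u₀)
        (_ : ∀ᵐ ω ∂P, u₀ ω ∈ TorusNSE.spaceV L)
        (γ₀ : ℝ) (_ : 0 < γ₀)
        (_ : ∫⁻ ω, ENNReal.ofReal
          (Real.exp (γ₀ * TorusNSE.gradInner (u₀ ω) (u₀ ω))) ∂P < ∞)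
        (_ : ∫⁻ ω, ENNReal.ofReal (TorusNSE.normV (u₀ ω) ^ (6 * q)) ∂P = M)
        (N : ℕ) (_ : 1 ≤ N)
        (u : ℕ → Ω → TorusNSE.VectorL2 L) (π : ℕ → Ω → TorusNSE.ScalarL2 L)
        (_ : TorusNSE.IsEulerScheme ℱ P ν T N u₀ (TorusNSE.wiener ζ qs β) u π),
        (∀ᵐ ω ∂P, ∀ l ∈ Finset.Icc 1 N, TorusNSE.MemW12 (π l ω)) ∧
        ∫⁻ ω, ENNReal.ofReal
          (|(T / N : ℝ) * ∑ l ∈ Finset.Icc 1 N, TorusNSE.gradNormSq (π l ω)| ^ q) ∂P ≤ C := by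
  refine ⟨(TorusNSE.pressureMomentConst L ν T q K₀ M).toNNReal, ?_⟩
  intro Ω mΩ P _ ℱ ζ lam hζ qs hqs hK β hβ u₀ _ hu₀ γ₀ _ _ hM N hN u π h
  have hκ : (0 : ℝ) < T / N := by
    have : (0 : ℝ) < N := by exact_mod_cast hN
    have : (0 : ℝ) < T := hT
    positivity
  have hstep : ∀ᵐ ω ∂P, ∀ l ∈ Finset.Icc 1 N, ∃ f,
      TorusNSE.IsStep (T / N : ℝ) ν (u l ω) f (π l ω) := by
    rw [ae_all_iff]
    intro l
    by_cases hl : l ∈ Finset.Icc 1 N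
    · obtain ⟨h1, h2⟩ := Finset.mem_Icc.mp hl
      obtain ⟨k, rfl⟩ : ∃ k, l = k + 1 := ⟨l - 1, by omega⟩
      filter_upwards [h.ae_isStep hζ hu₀ (show k < N by omega)] with ω hω _
      exact ⟨_, hω⟩
    · exact Filter.Eventually.of_forall fun _ hl' => absurd hl' hl
  refine ⟨hstep.mono fun ω hω l hl => (hω l hl).choose_spec.memW12_pressure hκ hν, ?_⟩
  rw [ENNReal.coe_toNNReal (TorusNSE.pressureMomentConst_ne_top hq)]
  set X := TorusNSE.totalEnstrophy ζ lam (2 * (T / N) * ν) u with hX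
  -- the remainder in the expansion of the power `3q` needs an even integer exponent above `3q`
  have hn : 3 * q ≤ 2 * (⌈3 * q⌉₊ + 1 : ℕ) := by
    have := Nat.le_ceil (3 * q)
    push_cast
    linarith
  have hmom : ∀ l ≤ N, ∫⁻ ω, (1 + X l ω) ^ (3 * q) ∂P ≤ TorusNSE.enstrophyConst T q K₀ M := by
    intro l hl
    refine (h.lintegral_totalEnstrophy_le hζ hu₀ hβ hqs hK hν hT hN (by linarith) hn hl).trans ?_
    rw [TorusNSE.enstrophyConst]
    gcongr
    calc ∫⁻ ω, (1 + TorusNSE.ens ζ lam (u₀ ω)) ^ (3 * q) ∂P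
        ≤ ∫⁻ ω, 2 ^ (3 * q - 1)
            * (1 + ENNReal.ofReal (TorusNSE.normV (u₀ ω) ^ (6 * q))) ∂P :=
          lintegral_mono_ae (hu₀.mono fun ω hω => hζ.one_add_ens_rpow_le hω.2 (by linarith))
      _ = 2 ^ (3 * q - 1) * (1 + M) := by
          rw [lintegral_const_mul' _ _ (ENNReal.rpow_ne_top_of_nonneg (by linarith) (by simp)),
            lintegral_add_left measurable_const, hM]
          simp
  have hXm : ∀ l ≤ N, Measurable fun ω => (1 + X l ω) ^ (3 * q) := fun l hl =>
    ((h.measurable_totalEnstrophy lam _ hl).const_add 1).pow_const _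
  calc _ ≤ ∫⁻ ω, (1 + TorusNSE.pressConst L) ^ q * (2 ^ (q - 1) * ((T : ℝ≥0∞) ^ (q - 1)
          * ∑ l ∈ Finset.Icc 1 N, ((T / N : ℝ≥0) : ℝ≥0∞) * (1 + X l ω) ^ (3 * q)
        + ENNReal.ofReal ((2 * ν)⁻¹) ^ q * (1 + X N ω) ^ (3 * q))) ∂P := by
        refine lintegral_mono_ae (hstep.mono fun ω hω => ?_)
        exact TorusNSE.rpow_sum_gradNormSq_le hν hN hq fun l hl =>
          (hω l hl).choose_spec.gradNormSq_le hζ hκ hν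
    _ = (1 + TorusNSE.pressConst L) ^ q * (2 ^ (q - 1) * ((T : ℝ≥0∞) ^ (q - 1)
          * ∑ l ∈ Finset.Icc 1 N, ((T / N : ℝ≥0) : ℝ≥0∞) * ∫⁻ ω, (1 + X l ω) ^ (3 * q) ∂P
        + ENNReal.ofReal ((2 * ν)⁻¹) ^ q * ∫⁻ ω, (1 + X N ω) ^ (3 * q) ∂P)) := by
        have h1 : ∀ l ∈ Finset.Icc 1 N, Measurable fun ω =>
            ((T / N : ℝ≥0) : ℝ≥0∞) * (1 + X l ω) ^ (3 * q) := fun l hl =>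
          (hXm l (Finset.mem_Icc.mp hl).2).const_mul _
        have h2 := Finset.measurable_sum _ h1
        have h3 := (hXm N le_rfl).const_mul (ENNReal.ofReal ((2 * ν)⁻¹) ^ q)
        have h4 := (h2.const_mul ((T : ℝ≥0∞) ^ (q - 1))).add h3
        simp only [Pi.add_def] at h4
        rw [lintegral_const_mul _ (h4.const_mul _), lintegral_const_mul _ h4,
          lintegral_add_right _ h3,
          lintegral_const_mul _ h2, lintegral_const_mul _ (hXm N le_rfl),
          lintegral_finsetSum _ h1]
        congr 4
        exact Finset.sum_congr rfl fun l hl =>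
          lintegral_const_mul _ (hXm l (Finset.mem_Icc.mp hl).2)
    _ ≤ (1 + TorusNSE.pressConst L) ^ q * (2 ^ (q - 1) * ((T : ℝ≥0∞) ^ (q - 1)
          * ∑ l ∈ Finset.Icc 1 N, ((T / N : ℝ≥0) : ℝ≥0∞) * TorusNSE.enstrophyConst T q K₀ M
        + ENNReal.ofReal ((2 * ν)⁻¹) ^ q * TorusNSE.enstrophyConst T q K₀ M)) := by
        gcongr with l hl
        · exact hmom l (Finset.mem_Icc.mp hl).2
        · exact hmom N le_rfl
    _ = TorusNSE.pressureMomentConst L ν T q K₀ M := by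
        have h1 : (N : ℝ≥0∞) * ((T / N : ℝ≥0) : ℝ≥0∞) = T := by
          have hN0 : (N : ℝ≥0) ≠ 0 := by positivity
          have : (N : ℝ≥0) * (T / N) = T := by field_simp
          exact_mod_cast this
        rw [Finset.sum_const, Nat.card_Icc, Nat.add_sub_cancel, nsmul_eq_mul,
          ← mul_assoc (N : ℝ≥0∞), h1, TorusNSE.pressureMomentConst]
        ring
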